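/- **Setting.** Let $I=[-1,1]$ and $c=0$. For an integer $k\ge 0$ let $\mathcal B^k(I)$ be the space of continuous functions $f:I\to\mathbb R$ that are $C^k$ on $[-1,0]$ and on $[0,1]$ and satisfy $f(1)=f(-1)$, normed by $|f|_k=\max_{0\le i\le k}\max\{\sup_{[-1,0]}|D^if|,\ \sup_{[0,1]}|D^if|\}$. For $k\ge1$ a *piecewise expanding $C^k$ unimodal map* is an $f\in\mathcal B^k(I)$ with $f(\pm1)=-1$, $\inf_{[-1,0]}Df>1$, $\sup_{[0,1]}Df<-1$ and $f(0)\le 1$ (so that $f(I)\subset I$); put $\lambda_f=\min|Df|>1$. A *$C^k$ family* of such maps is a $C^k$ map $t\mapsto f_t$ from $(-\delta,\delta)$ to the normed space $\mathcal B^k(I)$ all of whose values are piecewise expanding $C^k$ unimodal maps; $\partial_tf_t$ is its derivative. Let $R_t=\{(i,j)\in\mathbb N^2: i<j,\ f_t^i(c)=f_t^j(c)\}$ be the set of critical relations of $f_t$. For bounded $v:I\to\mathbb R$ put $$J(f,v)=\sum_{i}\frac{v(f^i(c))}{Df^i(f(c))},$$ where the sum runs over all $i\ge 0$ if $c$ is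 not periodic under $f$, and over $0\le i\le p-1$ if $c$ is periodic with prime period $p$. A map $f:I\to I$ is *$\epsilon$-expansive* if for every nondegenerate interval $L\subset I$ there is $i\ge1$ with $|f^i(L)|>\epsilon$; a piecewise expanding unimodal map $f_0$ is *stably $\epsilon$-expansive* if every piecewise expanding $C^1$ unimodal map $f$ with $|f-f_0|_1$ small enough is $\epsilon$-expansive. A function is $C^{m+Lip}$ if it is $C^m$ and its $m$-th derivative is Lipschitz; the norm of $C^{m+Lip}(Q)$ is the maximum of the sup norms over $Q$ of the derivatives of order $0,\dots,m$ and of the Lipschitz constant on $Q$ of the $m$-th derivative. **Theorem 1.** For every $k\ge 1$ there is a constant $C$, depending only on $k$, such that the following holds for every $\delta>0$ and every $C^k$ family $f_t$, $t\in(-\delta,\delta)$, of piecewise expanding $C^k$ unimodal maps. The following properties are equivalent ("for small $t$" means: for all $|t|<\epsilon$, for some $\epsilon\in(0,\delta]$): - **A.** For small $t$, $R_t=R_0$. - **B.** For small $t$, there is a homeomorphism $h_t:I\to I$ with $h_t\circ f_0=f_t\circ h_t$. - **C.** For some $\epsilon\in(0,\delta]$ there are homeomorphisms $h_t:I\to I$,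 $|t|<\epsilon$, with $h_t\circ f_0=f_t\circ h_t$, such that $(x,t)\mapsto h_t(x)$ is continuous on $I\times(-\epsilon,\epsilon)$, for each $x\in I$ the function $t\mapsto h_t(x)$ is $C^{k-1+Lip}$ on $(-\epsilon,\epsilon)$, and for each compact interval $Q\subset(-\epsilon,\epsilon)$: - the set $\{t\mapsto h_t(x): x\in I\}$ is bounded in $C^{k-1+Lip}(Q)$; - its diameter in $C^{k-1+Lip}(Q)$ is at most $C\Big(\sup_{t\in Q}\dfrac{\max_{0\le j\le k}|\partial_t^jf_t|_k}{1-\lambda_{f_t}^{-1}}\Big)^{2k-1}$; - for all $x\in I$, $t\mapsto h_t(x)$ is Lipschitz on $Q$ with constant $\sup_{t\in Q}\dfrac{|\partial_tf_t|_0}{1-\lambda_{f_t}^{-1}}$. Furthermore, A, B and C imply - **D.** For small $t$, $J(f_t,\partial_sf_s|_{s=t})=0$. If in addition $f_0$ is stably $\epsilon$-expansive for some $\epsilon>0$, then D is equivalent to A, B and C. -/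

import Mathlib

open Set

noncomputable section

namespace PEU

/-- The interval `I = [-1, 1]`, as a type. -/
abbrev I : Type := ↥(Icc (-1 : ℝ) 1)

theorem neg_one_le_one' : (-1 : ℝ) ≤ 1 := by norm_num

/-- The left endpoint `-1` of `I`. -/
def left : I := ⟨-1, by norm_num⟩

/-- The right endpoint `1` of `I`. -/
def right : I := ⟨1, by norm_num⟩

/-- The critical point `c = 0`. -/
def c : I := ⟨0, by norm_num⟩

/-- A function on `I`, extended to `ℝ` by constants. It serves only to speak of derivatives
within subintervals of `[-1, 1]`. -/
def ext (g : I → ℝ) : ℝ → ℝ := IccExtend neg_one_le_one' g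

theorem ext_apply (g : I → ℝ) (x : I) : ext g x = g x := IccExtend_val _ _ _

theorem ext_add (g₁ g₂ : I → ℝ) : ext (g₁ + g₂) = ext g₁ + ext g₂ := rfl

theorem ext_smul (a : ℝ) (g : I → ℝ) : ext (a • g) = a • ext g := rfl

/-- The linear space of piecewise `C^k` functions on `I`: continuous functions that are `C^k` on
`[-1, 0]` and on `[0, 1]` (one-sided derivatives at the endpoints), with equal values at `1` and
`-1`. -/
def pcSubmodule (k : ℕ) : Submodule ℝ (I → ℝ) where
  carrier := {g | Continuous g ∧ ContDiffOn ℝ k (ext g) (Icc (-1) 0) ∧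
    ContDiffOn ℝ k (ext g) (Icc 0 1) ∧ g right = g left}
  add_mem' := by
    rintro a b ⟨ha0, ha1, ha2, ha3⟩ ⟨hb0, hb1, hb2, hb3⟩
    exact ⟨ha0.add hb0, ha1.add hb1, ha2.add hb2, by simp [ha3, hb3]⟩
  zero_mem' := by
    refine ⟨continuous_const, ?_, ?_, rfl⟩
    · exact contDiffOn_const (c := (0 : ℝ))
    · exact contDiffOn_const (c := (0 : ℝ))
  smul_mem' := by
    rintro a b ⟨hb0, hb1, hb2, hb3⟩
    exact ⟨hb0.const_smul a, hb1.const_smul a, hb2.const_smul a, by simp [hb3]⟩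

/-- The space `𝓑^k(I)` of piecewise `C^k` functions. It is a type of its own, so that it carries
the `C^k` norm below and not the topology of pointwise convergence. -/
def PC (k : ℕ) : Type := ↥(pcSubmodule k)

namespace PC

variable {k : ℕ}

instance : AddCommGroup (PC k) := inferInstanceAs (AddCommGroup ↥(pcSubmodule k))

instance : Module ℝ (PC k) := inferInstanceAs (Module ℝ ↥(pcSubmodule k))

/-- The underlying function `I → ℝ`. -/
def toFun (f : PC k) : I → ℝ := f.1

instance : CoeFun (PC k) (fun _ => I → ℝ) := ⟨toFun⟩

theorem uniqueDiffOn_left : UniqueDiffOn ℝ (Icc (-1 : ℝ) 0) := uniqueDiffOn_Icc (by norm_num)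

theorem uniqueDiffOn_right : UniqueDiffOn ℝ (Icc (0 : ℝ) 1) := uniqueDiffOn_Icc (by norm_num)

theorem contDiffOn_left (f : PC k) : ContDiffOn ℝ k (ext f) (Icc (-1) 0) := f.2.2.1

theorem contDiffOn_right (f : PC k) : ContDiffOn ℝ k (ext f) (Icc 0 1) := f.2.2.2.1

/-- The `i`-th derivative of a function that is `C^k` on `S`, as a continuous function on `S`. -/
def derivOn (S : Set ℝ) (hS : UniqueDiffOn ℝ S) (g : ℝ → ℝ) (hg : ContDiffOn ℝ k g S)
    (i : Fin (k + 1)) : C(↥S, ℝ) where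
  toFun x := iteratedDerivWithin i g S x
  continuous_toFun := by
    have h := hg.continuousOn_iteratedDerivWithin (m := (i : ℕ))
      (by exact_mod_cast Nat.lt_succ_iff.mp i.2) hS
    exact continuousOn_iff_continuous_domRestrict.mp h

/-- All derivatives of order `0, …, k` on the two pieces `[-1, 0]` and `[0, 1]`. -/
def jet (k : ℕ) : PC k →ₗ[ℝ]
    (Fin (k + 1) → C(↥(Icc (-1 : ℝ) 0), ℝ) × C(↥(Icc (0 : ℝ) 1), ℝ)) where
  toFun f i := (derivOn _ uniqueDiffOn_left (ext f) f.contDiffOn_left i,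
    derivOn _ uniqueDiffOn_right (ext f) f.contDiffOn_right i)
  map_add' f g := by
    funext i
    have hi : ((i : ℕ) : WithTop ℕ∞) ≤ (k : WithTop ℕ∞) := by
      exact_mod_cast Nat.lt_succ_iff.mp i.2
    refine Prod.ext (ContinuousMap.ext fun x => ?_) (ContinuousMap.ext fun x => ?_)
    · exact iteratedDerivWithin_add x.2 uniqueDiffOn_left
        ((f.contDiffOn_left.of_le hi) x x.2) ((g.contDiffOn_left.of_le hi) x x.2)
    · exact iteratedDerivWithin_add x.2 uniqueDiffOn_right
        ((f.contDiffOn_right.of_le hi) x x.2) ((g.contDiffOn_right.of_le hi) x x.2)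
  map_smul' a f := by
    funext i
    have hi : ((i : ℕ) : WithTop ℕ∞) ≤ (k : WithTop ℕ∞) := by
      exact_mod_cast Nat.lt_succ_iff.mp i.2
    refine Prod.ext (ContinuousMap.ext fun x => ?_) (ContinuousMap.ext fun x => ?_)
    · exact iteratedDerivWithin_const_smul x.2 uniqueDiffOn_left a
        ((f.contDiffOn_left.of_le hi) x x.2)
    · exact iteratedDerivWithin_const_smul x.2 uniqueDiffOn_right a
        ((f.contDiffOn_right.of_le hi) x x.2)

theorem jet_injective (k : ℕ) : Function.Injective (jet k) := by
  intro f g hfg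
  have h0 := congrFun hfg 0
  apply Subtype.ext
  funext x
  rcases le_total (x : ℝ) 0 with hx | hx
  · have h1 := congrArg (fun p => p.1 ⟨(x : ℝ), x.2.1, hx⟩) h0
    have h2 : ext f (x : ℝ) = ext g (x : ℝ) := by
      simpa [jet, derivOn] using h1
    rwa [ext_apply, ext_apply] at h2
  · have h1 := congrArg (fun p => p.2 ⟨(x : ℝ), hx, x.2.2⟩) h0
    have h2 : ext f (x : ℝ) = ext g (x : ℝ) := by
      simpa [jet, derivOn] using h1
    rwa [ext_apply, ext_apply] at h2

/-- The norm `|f|_k`: the largest of the sup norms of the derivatives of order `0, …, k` on the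
two pieces. -/
instance : NormedAddCommGroup (PC k) := NormedAddCommGroup.induced _ _ (jet k) (jet_injective k)

instance : NormedSpace ℝ (PC k) := NormedSpace.induced ℝ _ _ (jet k)

theorem norm_le_iff (f : PC k) {r : ℝ} (hr : 0 ≤ r) : ‖f‖ ≤ r ↔ ∀ i ≤ k,
    (∀ x ∈ Icc (-1 : ℝ) 0, |iteratedDerivWithin i (ext f) (Icc (-1) 0) x| ≤ r) ∧
    (∀ x ∈ Icc (0 : ℝ) 1, |iteratedDerivWithin i (ext f) (Icc 0 1) x| ≤ r) := by
  have h : ‖f‖ = ‖jet k f‖ := rfl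
  rw [h, pi_norm_le_iff_of_nonneg hr]
  constructor
  · intro H i hi
    have H' := H ⟨i, Nat.lt_succ_of_le hi⟩
    rw [Prod.norm_def, max_le_iff, ContinuousMap.norm_le _ hr, ContinuousMap.norm_le _ hr] at H'
    exact ⟨fun x hx => H'.1 ⟨x, hx⟩, fun x hx => H'.2 ⟨x, hx⟩⟩
  · intro H i
    have H' := H i (Nat.lt_succ_iff.mp i.2)
    rw [Prod.norm_def, max_le_iff, ContinuousMap.norm_le _ hr, ContinuousMap.norm_le _ hr]
    exact ⟨fun x => H'.1 x x.2, fun x => H'.2 x x.2⟩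

/-- A piecewise `C^k` function with `k ≥ 1`, seen as a piecewise `C^1` function. -/
def toC1 (hk : 1 ≤ k) (f : PC k) : PC 1 :=
  ⟨f, f.2.1, f.contDiffOn_left.of_le (by exact_mod_cast hk),
    f.contDiffOn_right.of_le (by exact_mod_cast hk), f.2.2.2.2⟩

end PC

/-- The set `𝓤^k` of piecewise expanding `C^k` unimodal maps (for `k ≥ 1`). -/
def U (k : ℕ) : Set (PC k) :=
  {f | (f left = -1 ∧ f right = -1) ∧
    (∃ a > 1, (∀ x ∈ Icc (-1 : ℝ) 0, a ≤ derivWithin (ext f) (Icc (-1) 0) x) ∧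
      (∀ x ∈ Icc (0 : ℝ) 1, derivWithin (ext f) (Icc 0 1) x ≤ -a)) ∧
    f c ≤ 1}

/-- The minimal expansion `λ_f = min |Df|` (over both pieces). -/
def expansion {k : ℕ} (f : PC k) : ℝ :=
  sInf ((fun x => |derivWithin (ext f) (Icc (-1) 0) x|) '' Icc (-1) 0 ∪
    (fun x => |derivWithin (ext f) (Icc 0 1) x|) '' Icc 0 1)

/-- The map `I → I` given by a function on `I` with values in `[-1, 1]`; the projection onto
`[-1, 1]` does nothing for piecewise expanding unimodal maps, see `selfMap_coe`. -/
def selfMap (g : I → ℝ) : I → I := fun x => projIcc (-1) 1 neg_one_le_one' (g x)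

theorem mem_Icc_of_mem_U {k : ℕ} (hk : 1 ≤ k) {f : PC k} (hf : f ∈ U k) (x : I) :
    f x ∈ Icc (-1 : ℝ) 1 := by
  obtain ⟨⟨hl, hr⟩, ⟨a, ha, h1, h2⟩, hc⟩ := hf
  have hmono : MonotoneOn (ext f) (Icc (-1) 0) := by
    apply monotoneOn_of_deriv_nonneg (convex_Icc _ _) f.contDiffOn_left.continuousOn
    · exact (f.contDiffOn_left.differentiableOn (by exact_mod_cast (by omega : k ≠ 0))).mono
        interior_subset
    · intro y hy
      have := h1 y (interior_subset hy)
      rw [derivWithin_of_mem_nhds (mem_interior_iff_mem_nhds.mp hy)] at this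
      linarith
  have hanti : AntitoneOn (ext f) (Icc 0 1) := by
    apply antitoneOn_of_deriv_nonpos (convex_Icc _ _) f.contDiffOn_right.continuousOn
    · exact (f.contDiffOn_right.differentiableOn (by exact_mod_cast (by omega : k ≠ 0))).mono
        interior_subset
    · intro y hy
      have := h2 y (interior_subset hy)
      rw [derivWithin_of_mem_nhds (mem_interior_iff_mem_nhds.mp hy)] at this
      linarith
  have el : ext f (-1) = -1 := (ext_apply f left).trans hl
  have er : ext f 1 = -1 := (ext_apply f right).trans hr
  have ec : ext f 0 ≤ 1 := (ext_apply f c).le.trans hc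
  rw [← ext_apply f x]
  rcases le_total (x : ℝ) 0 with hx | hx
  · have e1 := hmono (a := -1) (b := x) (by norm_num) ⟨x.2.1, hx⟩ x.2.1
    have e2 := hmono (a := (x : ℝ)) (b := 0) ⟨x.2.1, hx⟩ (by norm_num) hx
    exact ⟨by linarith, by linarith⟩
  · have e1 := hanti (a := (x : ℝ)) (b := 1) ⟨hx, x.2.2⟩ (by norm_num) x.2.2
    have e2 := hanti (a := 0) (b := (x : ℝ)) (by norm_num) ⟨hx, x.2.2⟩ hx
    exact ⟨by linarith, by linarith⟩

theorem selfMap_coe {k : ℕ} (hk : 1 ≤ k) {f : PC k} (hf : f ∈ U k) (x : I) :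
    (selfMap f x : ℝ) = f x := by
  simp [selfMap, projIcc_of_mem _ (mem_Icc_of_mem_U hk hf x)]

/-- The critical relations of `f`: the pairs `i < j` with `f^i(c) = f^j(c)`. -/
def criticalRelations (f : I → ℝ) : Set (ℕ × ℕ) :=
  {p | (selfMap f)^[p.1] c = (selfMap f)^[p.2] c ∧ p.1 < p.2}

/-- The derivative `Df^i(x)` of the `i`-th iterate (one-sided at `x = ±1`). -/
def iterDeriv (f : I → ℝ) (i : ℕ) (x : I) : ℝ :=
  derivWithin (ext fun y => ((selfMap f)^[i] y : ℝ)) (Icc (-1) 1) x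

open Classical in
/-- The functional `J(f, v) = ∑ v(f^i(c)) / Df^i(f(c))`, where the sum runs over all `i ≥ 0` if
`c` is not periodic, and over `0 ≤ i < p` if `c` has prime period `p`. -/
def J (f v : I → ℝ) : ℝ :=
  if c ∈ Function.periodicPts (selfMap f) then
    ∑ i ∈ Finset.range (Function.minimalPeriod (selfMap f) c),
      v ((selfMap f)^[i] c) / iterDeriv f i (selfMap f c)
  else ∑' i : ℕ, v ((selfMap f)^[i] c) / iterDeriv f i (selfMap f c)

/-- `T` is `ε`-expansive: every (nondegenerate) interval has an iterate of order at least one that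
is longer than `ε`. -/
def Expansive (ε : ℝ) (T : I → I) : Prop :=
  ∀ L : Set I, L.OrdConnected → L.Nontrivial → ∃ i ≥ 1, ε < Metric.diam (T^[i] '' L)

/-- `f` is stably `ε`-expansive: all piecewise expanding unimodal maps that are `C^1`-close to `f`
are `ε`-expansive. -/
def StablyExpansive (ε : ℝ) (f : PC 1) : Prop :=
  ∃ η > 0, ∀ g ∈ U 1, ‖g - f‖ < η → Expansive ε (selfMap g)

/-- `f_t`, `t ∈ (-δ, δ)`, is a `C^k` family of piecewise expanding `C^k` unimodal maps: a `C^k` map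
from `(-δ, δ)` to the normed space `𝓑^k(I)`, with values in `𝓤^k`. -/
def IsFamily (k : ℕ) (δ : ℝ) (f : ℝ → PC k) : Prop :=
  ContDiffOn ℝ k f (Ioo (-δ) δ) ∧ ∀ t ∈ Ioo (-δ) δ, f t ∈ U k

/-- `g` is `C^{m+Lip}` on the open interval `(a, b)`. -/
def IsCLip (m : ℕ) (g : ℝ → ℝ) (a b : ℝ) : Prop :=
  ContDiffOn ℝ m g (Ioo a b) ∧ ∃ K, LipschitzOnWith K (iteratedDeriv m g) (Ioo a b)

/-- The `C^{m+Lip}` norm on `[a, b]` of a function `g`, which is `C^{m+Lip}` near `[a, b]`, is at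
most `r`. -/
def CLipNormLE (m : ℕ) (g : ℝ → ℝ) (a b r : ℝ) : Prop :=
  (∀ i ≤ m, ∀ t ∈ Icc a b, |iteratedDeriv i g t| ≤ r) ∧
  (∀ s ∈ Icc a b, ∀ t ∈ Icc a b, |iteratedDeriv m g s - iteratedDeriv m g t| ≤ r * |s - t|)

section Conditions

variable {k : ℕ} (δ : ℝ) (f : ℝ → PC k)

/-- The set of critical relations is constant for small `t`. -/
def CondA : Prop :=
  ∃ ε > 0, ε ≤ δ ∧ ∀ t ∈ Ioo (-ε) ε, criticalRelations (f t) = criticalRelations (f 0)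

/-- For small `t`, some homeomorphism `h_t` of `I` satisfies `h_t ∘ f_0 = f_t ∘ h_t`. -/
def CondB : Prop :=
  ∃ ε > 0, ε ≤ δ ∧ ∀ t ∈ Ioo (-ε) ε,
    ∃ h : I ≃ₜ I, Function.Semiconj h (selfMap (f 0)) (selfMap (f t))

/-- There are conjugacies `h_t` for `t ∈ (-ε, ε)` that are jointly continuous, are `C^{k-1+Lip}`
in `t`, and satisfy uniform bounds on each compact interval `[a, b] ⊆ (-ε, ε)`, namely: the
functions `t ↦ h_t(x)`, `x ∈ I`, form a bounded subset of `C^{k-1+Lip}[a, b]`; the diameter of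
this subset is at most `C * M ^ (2 * k - 1)`, where `M` bounds
`max_{j ≤ k} |∂_t^j f_t|_k / (1 - 1 / λ_{f_t})` on `[a, b]`; and the functions `t ↦ h_t(x)` are
`M`-Lipschitz on `[a, b]`, where `M` bounds `sup |∂_t f_t| / (1 - 1 / λ_{f_t})` on `[a, b]`. -/
def CondC (C : ℝ) : Prop :=
  ∃ ε > 0, ε ≤ δ ∧ ∃ h : ℝ → (I ≃ₜ I),
    (∀ t ∈ Ioo (-ε) ε, Function.Semiconj (h t) (selfMap (f 0)) (selfMap (f t))) ∧
    ContinuousOn (fun p : I × ℝ => h p.2 p.1) (univ ×ˢ Ioo (-ε) ε) ∧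
    (∀ x : I, IsCLip (k - 1) (fun t => (h t x : ℝ)) (-ε) ε) ∧
    ∀ a b : ℝ, -ε < a → a ≤ b → b < ε →
      (∃ K, ∀ x : I, CLipNormLE (k - 1) (fun t => (h t x : ℝ)) a b K) ∧
      (∀ M : ℝ,
        (∀ t ∈ Icc a b, ∀ j ≤ k, ‖iteratedDeriv j f t‖ / (1 - (expansion (f t))⁻¹) ≤ M) →
        ∀ x y : I, CLipNormLE (k - 1) (fun t => (h t x : ℝ) - (h t y : ℝ)) a b
          (C * M ^ (2 * k - 1))) ∧
      (∀ M : ℝ,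
        (∀ t ∈ Icc a b, ∀ y : I, |(deriv f t : PC k) y| / (1 - (expansion (f t))⁻¹) ≤ M) →
        ∀ x : I, ∀ s ∈ Icc a b, ∀ t ∈ Icc a b, |(h s x : ℝ) - (h t x : ℝ)| ≤ M * |s - t|)

/-- `J(f_t, ∂_s f_s |_{s = t}) = 0` for small `t`. -/
def CondD : Prop :=
  ∃ ε > 0, ε ≤ δ ∧ ∀ t ∈ Ioo (-ε) ε, J (f t) (deriv f t : PC k) = 0

end Conditions

end PEU

end

/-! The core is structural stability in the space of bounded functions. For each `x` keep the branch
(`side x`) that `f 0` uses there, extend the branches of `f t` to all of `ℝ` by Taylor polynomials,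
and look for a bounded function `H t`, not required to be continuous, with `branch (side x) (H t x)
= H t (f 0 x)`. At `t = 0` the identity solves this. The linearisation there is `w ↦ s w - w ∘ T`
with `|s| ≥ a > 1`, invertible by a Neumann series (`exists_twist_equiv`). Superposition operators
are `C^k` (`contDiff_superpose`), so the implicit function theorem yields a `C^k` curve `t ↦ H t`
for every family, with no condition on the critical orbit (`exists_shadowing_family`).

Condition A turns `H t` into a conjugacy. It keeps each `f_t^n(c)` on the same side of `c`
(`mem_piece_iterate_iff`), hence `H t` sends critical orbit to critical orbit. A pair of points
violating monotonicity, injectivity or density of the range would then be mapped to a worse such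
pair, with gap growing exponentially, which is impossible in a bounded interval
(`exists_homeomorph_of_shadowing`, built on `nonpos_of_expanding`). The estimates in C follow by
differentiating the equation for `H t` and absorbing the top-order term by expansion
(`norm_iteratedDeriv_le`, `norm_deriv_shadow_le`). B implies A because `c` is the only point alone
in its fibre, so that a conjugacy must fix it.

For D, the velocity field `α_t = ∂_t h_t ∘ h_t⁻¹` is a bounded solution of `α ∘ f = v + f' α`.
Iterating this equation along the critical orbit shows that `J(f, v) = 0` exactly if `α c = 0`
(`J_eq_zero_iff`), which holds since `h_t` fixes `c`.

Conversely, D provides bounded fields `α_t` with `α_t c = 0`, and all curves `t ↦ f_t^n(c)` solve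
`x' = α_t(x)`. The fields need not be continuous, so uniqueness of solutions is not automatic. It is
obtained from expansivity: the interval between two points reached from one initial point is mapped
by `f_t` into another interval of that kind, and all of these are short, so they are degenerate
(`reach_subsingleton`). Hence critical orbits that meet at one time meet at all nearby times, which
is A. -/

noncomputable section

namespace PEU

open Filter Topology BoundedContinuousFunction

/-! ### Smoothness of superposition operators on bounded functions. -/

section Superposition

set_option linter.unusedSectionVars false

variable {X E F : Type} [TopologicalSpace X] [NormedAddCommGroup E] [NormedSpace ℝ E]
  [ProperSpace E] [NormedAddCommGroup F] [NormedSpace ℝ F]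

/-- The superposition operator `u ↦ g ∘ u` on bounded continuous functions. -/
def superpose (g : C(E, F)) (u : X →ᵇ E) : X →ᵇ F :=
  ⟨g.comp u.toContinuousMap, by
    have hK : IsCompact (closure (range u)) := u.isBounded_range.isCompact_closure
    obtain ⟨C, hC⟩ := Metric.isBounded_iff.1 (hK.image g.continuous).isBounded
    exact ⟨C, fun x y => hC ⟨u x, subset_closure ⟨x, rfl⟩, rfl⟩
      ⟨u y, subset_closure ⟨y, rfl⟩, rfl⟩⟩⟩

@[simp] theorem superpose_apply (g : C(E, F)) (u : X →ᵇ E) (x : X) :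
    superpose g u x = g (u x) := rfl

/-- Heine's theorem on the ball of radius `R + 1`, compact since `E` is proper; capping `δ` at `1`
keeps `b` in that ball. It makes estimates for `g ∘ u` uniform in the argument of `u`. -/
theorem exists_uniform_modulus (g : C(E, F)) (R : ℝ) {ε : ℝ} (hε : 0 < ε) :
    ∃ δ > 0, ∀ a b : E, ‖a‖ ≤ R → ‖b - a‖ < δ → ‖g b - g a‖ < ε := by
  have hK : IsCompact (Metric.closedBall (0 : E) (R + 1)) := isCompact_closedBall _ _
  have hu := hK.uniformContinuousOn_of_continuous g.continuous.continuousOn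
  obtain ⟨δ, hδ, H⟩ := Metric.uniformContinuousOn_iff.1 hu ε hε
  refine ⟨min δ 1, lt_min hδ one_pos, fun a b ha hab => ?_⟩
  have h1 : ‖b‖ ≤ R + 1 := by
    have := norm_add_le (b - a) a
    have := hab.trans_le (min_le_right _ _)
    simp only [sub_add_cancel] at *
    linarith
  rw [← dist_eq_norm]
  exact H b (by simpa using h1) a (by simp; linarith)
    (by rw [dist_eq_norm]; exact hab.trans_le (min_le_left _ _))

theorem continuous_superpose (g : C(E, F)) :
    Continuous (superpose g : (X →ᵇ E) → (X →ᵇ F)) := by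
  rw [Metric.continuous_iff]
  intro u ε hε
  obtain ⟨δ, hδ, H⟩ := exists_uniform_modulus g ‖u‖ (half_pos hε)
  refine ⟨δ, hδ, fun v hv => lt_of_le_of_lt ?_ (half_lt_self hε)⟩
  rw [dist_le (half_pos hε).le]
  intro x
  rw [dist_eq_norm]
  refine (H _ _ (u.norm_coe_le_norm x) ?_).le
  rw [← dist_eq_norm]
  exact (dist_coe_le_dist x).trans_lt hv

/-- Pointwise application of bounded operator-valued functions. -/
def pointwiseApply : (X →ᵇ (E →L[ℝ] F)) →L[ℝ] ((X →ᵇ E) →L[ℝ] (X →ᵇ F)) :=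
  LinearMap.mkContinuous₂
    (LinearMap.mk₂ ℝ
      (fun (A : X →ᵇ (E →L[ℝ] F)) (w : X →ᵇ E) =>
        BoundedContinuousFunction.ofNormedAddCommGroup (fun x => A x (w x))
          (A.continuous.clm_apply w.continuous) (‖A‖ * ‖w‖) (fun x =>
            (A x).le_of_opNorm_le_of_le (A.norm_coe_le_norm x) (w.norm_coe_le_norm x)))
      (fun _ _ _ => by ext; simp) (fun _ _ _ => by ext; simp)
      (fun _ _ _ => by ext; simp) (fun _ _ _ => by ext; simp))
    1 (fun A w => by
      rw [one_mul]
      exact norm_ofNormedAddCommGroup_le _ (by positivity) (fun x =>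
        (A x).le_of_opNorm_le_of_le (A.norm_coe_le_norm x) (w.norm_coe_le_norm x)))

@[simp] theorem pointwiseApply_apply (A : X →ᵇ (E →L[ℝ] F)) (w : X →ᵇ E) (x : X) :
    pointwiseApply A w x = A x (w x) := rfl

/-- The mean value inequality for `g` near each `u x`, where the modulus of continuity of `g'`
depends only on `‖u‖`. The remainder is therefore uniform in `x`. -/
theorem hasFDerivAt_superpose (g : C(E, F)) (g' : C(E, E →L[ℝ] F))
    (h : ∀ x, HasFDerivAt g (g' x) x) (u : X →ᵇ E) :
    HasFDerivAt (superpose g) (pointwiseApply (superpose g' u)) u := by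
  rw [hasFDerivAt_iff_isLittleO, Asymptotics.isLittleO_iff]
  intro ε hε
  obtain ⟨δ, hδ, H⟩ := exists_uniform_modulus g' ‖u‖ hε
  filter_upwards [Metric.ball_mem_nhds u hδ] with v hv
  refine (norm_le (by positivity)).2 fun x => ?_
  simp only [coe_sub, Pi.sub_apply, superpose_apply, pointwiseApply_apply]
  have hx : ‖v x - u x‖ ≤ ‖v - u‖ := (v - u).norm_coe_le_norm x
  have hvu : ‖v - u‖ < δ := by rwa [← dist_eq_norm]
  have key := Convex.norm_image_sub_le_of_norm_hasFDerivWithin_le' (f := g) (f' := g')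
    (φ := g' (u x)) (s := Metric.ball (u x) δ) (C := ε)
    (fun z _ => (h z).hasFDerivWithinAt)
    (fun z hz => (H _ _ (u.norm_coe_le_norm x) (by rwa [← dist_eq_norm])).le)
    (convex_ball _ _) (Metric.mem_ball_self hδ)
    (y := v x) (by rw [Metric.mem_ball, dist_eq_norm]; exact hx.trans_lt hvu)
  exact key.trans (by gcongr)

/-- The derivative is again a superposition operator, for `g'`, followed by a fixed continuous
linear map. The target space changes to `E →L[ℝ] F` in the induction, so it is quantified inside. -/
theorem contDiff_superpose (m : ℕ) :
    ∀ {F : Type} [NormedAddCommGroup F] [NormedSpace ℝ F] (g : C(E, F)),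
      ContDiff ℝ m g → ContDiff ℝ m (superpose g : (X →ᵇ E) → (X →ᵇ F)) := by
  induction m with
  | zero =>
    intro F _ _ g _
    exact contDiff_zero.2 (continuous_superpose g)
  | succ m ih =>
    intro F _ _ g hg
    have hg' : ContDiff ℝ ((m : WithTop ℕ∞) + 1) g := by exact_mod_cast hg
    obtain ⟨g', hg'c, hd⟩ := contDiff_succ_iff_hasFDerivAt.1 hg'
    have := ih (⟨g', hg'c.continuous⟩ : C(E, E →L[ℝ] F)) hg'c
    have hA : ContDiff ℝ m (fun A : X →ᵇ (E →L[ℝ] F) => pointwiseApply A) :=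
      ContinuousLinearMap.contDiff (𝕜 := ℝ) (E := X →ᵇ (E →L[ℝ] F))
        (F := (X →ᵇ E) →L[ℝ] (X →ᵇ F)) pointwiseApply
    have h2 : ContDiff ℝ ((m : WithTop ℕ∞) + 1) (superpose g : (X →ᵇ E) → (X →ᵇ F)) :=
      contDiff_succ_iff_hasFDerivAt.2 ⟨fun u => pointwiseApply (superpose ⟨g', hg'c.continuous⟩ u),
        hA.comp this,
        fun u => hasFDerivAt_superpose g ⟨g', hg'c.continuous⟩ hd u⟩
    exact_mod_cast h2

end Superposition

/-! ### The twisted cohomological equation with expanding coefficient. -/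

section TwistedEquation

variable {X : Type} [TopologicalSpace X]

/-- The operator `w ↦ s w - w ∘ T`. -/
def twist (s : X →ᵇ ℝ) (T : C(X, X)) : (X →ᵇ ℝ) →L[ℝ] (X →ᵇ ℝ) :=
  ContinuousLinearMap.mul ℝ (X →ᵇ ℝ) s - compContinuousCLM ℝ ℝ T

@[simp] theorem twist_apply (s : X →ᵇ ℝ) (T : C(X, X)) (w : X →ᵇ ℝ) (x : X) :
    twist s T w x = s x * w x - w (T x) := rfl

/-- Factor the operator as multiplication by `s` after `1 - B`, with `B w = s⁻¹ · (w ∘ T)`.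
Composition does not increase the sup norm, so `‖B‖ ≤ a⁻¹ < 1` and a Neumann series inverts `1 - B`.
-/
theorem exists_twist_equiv (s : X →ᵇ ℝ) (T : C(X, X)) {a : ℝ} (ha : 1 < a)
    (hs : ∀ x, a ≤ |s x|) :
    ∃ e : (X →ᵇ ℝ) ≃L[ℝ] (X →ᵇ ℝ), (e : (X →ᵇ ℝ) →L[ℝ] (X →ᵇ ℝ)) = twist s T := by
  have ha0 : 0 < a := one_pos.trans ha
  have hs0 : ∀ x, s x ≠ 0 := fun x hx => by have := hs x; simp [hx] at this; linarith
  let r : X →ᵇ ℝ := BoundedContinuousFunction.ofNormedAddCommGroup (fun x => (s x)⁻¹)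
    (s.continuous.inv₀ hs0) a⁻¹ (fun x => by
      rw [norm_inv, Real.norm_eq_abs]; exact inv_anti₀ ha0 (hs x))
  have hr : ‖r‖ ≤ a⁻¹ := norm_ofNormedAddCommGroup_le _ (by positivity) _
  have hrs : r * s = 1 := by ext x; exact inv_mul_cancel₀ (hs0 x)
  have hsr : s * r = 1 := by rw [mul_comm]; exact hrs
  let B : (X →ᵇ ℝ) →L[ℝ] (X →ᵇ ℝ) :=
    (ContinuousLinearMap.mul ℝ (X →ᵇ ℝ) r).comp (compContinuousCLM ℝ ℝ T)
  have hB : ‖B‖ < 1 := by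
    refine lt_of_le_of_lt (ContinuousLinearMap.opNorm_le_bound _ (by positivity)
      (fun w => ?_)) (inv_lt_one_of_one_lt₀ ha)
    refine (norm_le (by positivity)).2 fun x => ?_
    have h1 : B w x = r x * w (T x) := rfl
    rw [h1, norm_mul]
    gcongr
    · exact (r.norm_coe_le_norm x).trans hr
    · exact w.norm_coe_le_norm _
  let eB := ContinuousLinearEquiv.unitsEquiv ℝ (X →ᵇ ℝ) (Units.oneSub B hB)
  let eS : (X →ᵇ ℝ) ≃L[ℝ] (X →ᵇ ℝ) := ContinuousLinearEquiv.equivOfInverse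
    (ContinuousLinearMap.mul ℝ (X →ᵇ ℝ) s) (ContinuousLinearMap.mul ℝ (X →ᵇ ℝ) r)
    (fun w => by simp [← mul_assoc, hrs]) (fun w => by simp [← mul_assoc, hsr])
  refine ⟨eB.trans eS, ?_⟩
  ext w x
  have h1 : eB w = w - B w := rfl
  have h2 : (eB.trans eS) w = s * eB w := rfl
  have h3 : B w x = r x * w (T x) := rfl
  have h4 : s x * r x = 1 := mul_inv_cancel₀ (hs0 x)
  change (eB.trans eS) w x = _
  rw [h2, h1, mul_apply, coe_sub, Pi.sub_apply, h3, twist_apply, mul_sub, ← mul_assoc, h4,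
    one_mul]

theorem exists_twist_solution [DiscreteTopology X] (T : X → X) (s v : X → ℝ) {a b c : ℝ}
    (ha : 1 < a) (hs : ∀ x, a ≤ |s x|) (hsb : ∀ x, |s x| ≤ b) (hv : ∀ x, |v x| ≤ c) :
    ∃ α : X → ℝ, (∀ x, |α x| ≤ c / (a - 1)) ∧ ∀ x, α (T x) = v x + s x * α x := by
  obtain ⟨e, he⟩ := exists_twist_equiv
    (ofNormedAddCommGroupDiscrete s b (fun x => by simpa using hsb x))
    ⟨T, continuous_of_discreteTopology⟩ ha hs
  let V : X →ᵇ ℝ := ofNormedAddCommGroupDiscrete v c (fun x => by simpa using hv x)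
  have h : ∀ x, s x * e.symm (-V) x - e.symm (-V) (T x) = -v x := fun x => by
    have h1 : e (e.symm (-V)) x = -v x := by rw [e.apply_symm_apply]; rfl
    rw [← h1]
    conv_rhs => rw [← ContinuousLinearEquiv.coe_coe, he]
    rfl
  refine ⟨e.symm (-V), fun x => ?_, fun x => by linarith [h x]⟩
  have hc : 0 ≤ c := (abs_nonneg _).trans (hv x)
  -- The explicit bound is read off the equation: `a |α y| ≤ |α (T y)| + |v y| ≤ ‖α‖ + c` for all
  -- `y`.
  have hnorm : ‖e.symm (-V)‖ ≤ (‖e.symm (-V)‖ + c) / a := by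
    refine (norm_le (div_nonneg (by positivity) (by linarith))).2 fun y => ?_
    rw [le_div_iff₀ (by linarith), Real.norm_eq_abs]
    have h1 : |s y| * |e.symm (-V) y| ≤ ‖e.symm (-V)‖ + c := by
      rw [← abs_mul, show s y * e.symm (-V) y = e.symm (-V) (T y) + -v y by linarith [h y]]
      refine (abs_add_le _ _).trans (add_le_add ((e.symm (-V)).norm_coe_le_norm _) ?_)
      rw [abs_neg]; exact hv y
    have := mul_le_mul_of_nonneg_right (hs y) (abs_nonneg (e.symm (-V) y))
    linarith
  rw [le_div_iff₀ (by linarith)] at hnorm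
  rw [le_div_iff₀ (by linarith)]
  have := mul_le_mul_of_nonneg_right ((e.symm (-V)).norm_coe_le_norm x) (by linarith : 0 ≤ a - 1)
  rw [Real.norm_eq_abs] at this
  linarith

end TwistedEquation

/-! ### The implicit function theorem for the shadowing equation. -/

section ImplicitSolution

variable {X : Type} [TopologicalSpace X] [DiscreteTopology X]

/-- The inverse function theorem for `(t, w) ↦ (t, F (t, w))`: its derivative is block triangular
with diagonal blocks `1` and `e`, hence invertible. The local inverse is followed along `t ↦ (t, F
(0, b))`. -/
theorem exists_contDiffAt_implicit {B : Type} [NormedAddCommGroup B] [NormedSpace ℝ B]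
    [CompleteSpace B] {n : ℕ} (hn : 1 ≤ n) (F : ℝ × B → B) (hF : ContDiff ℝ n F) (b : B)
    (F' : ℝ × B →L[ℝ] B) (hF' : HasFDerivAt F F' (0, b)) (e : B ≃L[ℝ] B)
    (he : ∀ w, F' (0, w) = e w) :
    ∃ h : ℝ → B, h 0 = b ∧ ContDiffAt ℝ n h 0 ∧ ∀ᶠ t in 𝓝 0, F (t, h t) = F (0, b) := by
  let Φ : ℝ × B → ℝ × B := fun p => (p.1, F p)
  have hΦ : ContDiff ℝ n Φ := contDiff_fst.prodMk hF
  let eΦ : (ℝ × B) ≃L[ℝ] (ℝ × B) := ContinuousLinearEquiv.equivOfInverse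
    ((ContinuousLinearMap.fst ℝ ℝ B).prod F')
    ((ContinuousLinearMap.fst ℝ ℝ B).prod ((e.symm : B →L[ℝ] B).comp
      (ContinuousLinearMap.snd ℝ ℝ B - F'.comp
        ((ContinuousLinearMap.inl ℝ ℝ B).comp (ContinuousLinearMap.fst ℝ ℝ B)))))
    (fun p => by
      have h1 : F' p = F' (p.1, 0) + F' (0, p.2) := by rw [← map_add]; simp
      refine Prod.ext rfl ?_
      change e.symm (F' p - F' (p.1, 0)) = p.2
      rw [h1, add_sub_cancel_left, he, e.symm_apply_apply])
    (fun p => by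
      refine Prod.ext rfl ?_
      change F' (p.1, e.symm (p.2 - F' (p.1, 0))) = p.2
      have h1 : ∀ w, F' (p.1, w) = F' (p.1, 0) + F' (0, w) := fun w => by rw [← map_add]; simp
      rw [h1, he, e.apply_symm_apply]; abel)
  have hΦ' : HasFDerivAt Φ (eΦ : (ℝ × B) →L[ℝ] (ℝ × B)) (0, b) := hasFDerivAt_fst.prodMk hF'
  have hn0 : (n : WithTop ℕ∞) ≠ 0 := by
    have : n ≠ 0 := by omega
    exact_mod_cast this
  let P := hΦ.contDiffAt.toOpenPartialHomeomorph Φ hΦ' hn0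
  have hsrc : ((0 : ℝ), b) ∈ P.source := hΦ.contDiffAt.mem_toOpenPartialHomeomorph_source hΦ' hn0
  have hinv : ContDiffAt ℝ n P.symm (0, F (0, b)) := hΦ.contDiffAt.to_localInverse hΦ' hn0
  have hcurve : ContDiff ℝ n (fun t : ℝ => (t, F (0, b))) := contDiff_id.prodMk contDiff_const
  refine ⟨fun t => (P.symm (t, F (0, b))).2, ?_, ?_, ?_⟩
  · have : P.symm (P (0, b)) = (0, b) := P.left_inv hsrc
    change (P.symm (0, F (0, b))).2 = b
    exact congrArg Prod.snd this
  · exact contDiff_snd.contDiffAt.comp _ (ContDiffAt.comp (0 : ℝ) hinv hcurve.contDiffAt)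
  · have htgt : P.target ∈ 𝓝 ((0 : ℝ), F (0, b)) := by
      have : P (0, b) ∈ P.target := P.map_source hsrc
      exact P.open_target.mem_nhds this
    filter_upwards [hcurve.continuous.continuousAt.preimage_mem_nhds htgt] with t ht
    have h1 : Φ (P.symm (t, F (0, b))) = (t, F (0, b)) := P.right_inv ht
    have h2 : (P.symm (t, F (0, b))).1 = t := congrArg Prod.fst h1
    have h3 : F (P.symm (t, F (0, b))) = F (0, b) := congrArg Prod.snd h1
    have h4 : P.symm (t, F (0, b)) = (t, (P.symm (t, F (0, b))).2) := Prod.ext h2 rfl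
    rw [h4] at h3
    exact h3

/-- The pair `(t, h)` as a bounded function with values in `ℝ × ℝ`. -/
def constPair : ℝ × (X →ᵇ ℝ) →L[ℝ] (X →ᵇ ℝ × ℝ) :=
  LinearMap.mkContinuous
    { toFun := fun p => ofNormedAddCommGroupDiscrete (fun x => (p.1, p.2 x)) ‖p‖ (fun x => by
        rw [Prod.norm_def, Prod.norm_def]
        exact max_le_max le_rfl (p.2.norm_coe_le_norm x))
      map_add' := fun _ _ => by ext <;> simp
      map_smul' := fun _ _ => by ext <;> simp }
    1 (fun p => by
      rw [one_mul]
      exact norm_ofNormedAddCommGroup_le _ (norm_nonneg _) (fun x => by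
        rw [Prod.norm_def, Prod.norm_def]
        exact max_le_max le_rfl (p.2.norm_coe_le_norm x)))

/-- If `g i` are `C^n` and `∂_y g (i x) (0, y)` is uniformly expanding along a solution `h₀` of
`g (i x) (0, h₀ x) = h₀ (T x)`, then the solution continues to a `C^n` family of solutions. -/
theorem exists_contDiffOn_solution {n : ℕ} (hn : 1 ≤ n) (T : X → X) (left : Set X)
    (g₁ g₂ : ℝ × ℝ → ℝ) (hg₁ : ContDiff ℝ n g₁) (hg₂ : ContDiff ℝ n g₂) (h₀ : X →ᵇ ℝ)
    (h1 : ∀ x ∈ left, g₁ (0, h₀ x) = h₀ (T x)) (h2 : ∀ x ∉ left, g₂ (0, h₀ x) = h₀ (T x))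
    {a : ℝ} (ha : 1 < a) (hs1 : ∀ x ∈ left, a ≤ |deriv (fun y => g₁ (0, y)) (h₀ x)|)
    (hs2 : ∀ x ∉ left, a ≤ |deriv (fun y => g₂ (0, y)) (h₀ x)|) :
    ∃ ε > 0, ∃ h : ℝ → (X →ᵇ ℝ), h 0 = h₀ ∧ ContDiffOn ℝ n h (Ioo (-ε) ε) ∧
      ∀ t ∈ Ioo (-ε) ε, (∀ x ∈ left, g₁ (t, h t x) = h t (T x)) ∧
        (∀ x ∉ left, g₂ (t, h t x) = h t (T x)) := by
  classical
  have hn1 : (1 : WithTop ℕ∞) ≤ n := by exact_mod_cast hn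
  have hn0 : (n : WithTop ℕ∞) ≠ 0 := fun h => by simp [h] at hn1
  let G₁ : C(ℝ × ℝ, ℝ) := ⟨g₁, hg₁.continuous⟩
  let G₂ : C(ℝ × ℝ, ℝ) := ⟨g₂, hg₂.continuous⟩
  let G₁' : C(ℝ × ℝ, ℝ × ℝ →L[ℝ] ℝ) := ⟨fderiv ℝ g₁, hg₁.continuous_fderiv hn0⟩
  let G₂' : C(ℝ × ℝ, ℝ × ℝ →L[ℝ] ℝ) := ⟨fderiv ℝ g₂, hg₂.continuous_fderiv hn0⟩
  -- The indicators select the branch at each point; they count as continuous because `X` is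
  -- discrete.
  let c₁ : X →ᵇ ℝ := ofNormedAddCommGroupDiscrete (fun x => if x ∈ left then 1 else 0) 1
    (fun x => by split_ifs <;> simp)
  let c₂ : X →ᵇ ℝ := ofNormedAddCommGroupDiscrete (fun x => if x ∈ left then 0 else 1) 1
    (fun x => by split_ifs <;> simp)
  let T' : C(X, X) := ⟨T, continuous_of_discreteTopology⟩
  let F : ℝ × (X →ᵇ ℝ) → (X →ᵇ ℝ) := fun p =>
    ContinuousLinearMap.mul ℝ (X →ᵇ ℝ) c₁ (superpose G₁ (constPair p)) +
    ContinuousLinearMap.mul ℝ (X →ᵇ ℝ) c₂ (superpose G₂ (constPair p)) -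
    compContinuousCLM ℝ ℝ T' p.2
  have hF : ContDiff ℝ n F :=
    (((ContinuousLinearMap.contDiff _).comp
      ((contDiff_superpose n G₁ hg₁).comp constPair.contDiff)).add
    ((ContinuousLinearMap.contDiff _).comp
      ((contDiff_superpose n G₂ hg₂).comp constPair.contDiff))).sub
    ((ContinuousLinearMap.contDiff _).comp contDiff_snd)
  have d1 := hasFDerivAt_superpose (X := X) G₁ G₁'
    (fun z => ((hg₁.differentiable hn0) z).hasFDerivAt) (constPair (0, h₀))
  have d2 := hasFDerivAt_superpose (X := X) G₂ G₂'
    (fun z => ((hg₂.differentiable hn0) z).hasFDerivAt) (constPair (0, h₀))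
  have hF' := ((((ContinuousLinearMap.mul ℝ (X →ᵇ ℝ) c₁).hasFDerivAt).comp ((0 : ℝ), h₀)
      (d1.comp ((0 : ℝ), h₀) (constPair (X := X)).hasFDerivAt)).add
    (((ContinuousLinearMap.mul ℝ (X →ᵇ ℝ) c₂).hasFDerivAt).comp ((0 : ℝ), h₀)
      (d2.comp ((0 : ℝ), h₀) (constPair (X := X)).hasFDerivAt))).sub
    (((compContinuousCLM ℝ ℝ T').hasFDerivAt).comp ((0 : ℝ), h₀)
      (hasFDerivAt_snd (𝕜 := ℝ) (E := ℝ) (F := (X →ᵇ ℝ))))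
  let s : X →ᵇ ℝ := c₁ * (pointwiseApply (superpose G₁' (constPair (0, h₀)))
      (constPair (0, 1))) +
    c₂ * (pointwiseApply (superpose G₂' (constPair (0, h₀))) (constPair (0, 1)))
  have hder : ∀ (g : ℝ × ℝ → ℝ), ContDiff ℝ n g → ∀ y,
      deriv (fun y => g (0, y)) y = fderiv ℝ g (0, y) (0, 1) := fun g hg y => by
    have e1 : HasDerivAt (fun y : ℝ => ((0 : ℝ), y)) (0, 1) y :=
      (hasDerivAt_const y (0 : ℝ)).prodMk (hasDerivAt_id y)
    exact ((hg.differentiable hn0 (0, y)).hasFDerivAt.comp_hasDerivAt y e1).deriv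
  have hs : ∀ x, a ≤ |s x| := fun x => by
    have e1 : s x = c₁ x * fderiv ℝ g₁ (0, h₀ x) (0, 1) + c₂ x * fderiv ℝ g₂ (0, h₀ x) (0, 1) :=
      rfl
    rw [e1, ← hder g₁ hg₁, ← hder g₂ hg₂]
    by_cases hx : x ∈ left
    · simpa [c₁, c₂, hx] using hs1 x hx
    · simpa [c₁, c₂, hx] using hs2 x hx
  obtain ⟨e, he⟩ := exists_twist_equiv s T' ha hs
  have hlin : ∀ (L : ℝ × ℝ →L[ℝ] ℝ) (r : ℝ), L (0, r) = L (0, 1) * r := fun L r => by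
    have : ((0 : ℝ), r) = r • ((0 : ℝ), (1 : ℝ)) := by simp
    rw [this, map_smul, smul_eq_mul, mul_comm]
  obtain ⟨h, hh0, hhc, hheq⟩ := exists_contDiffAt_implicit hn F hF h₀ _ hF' e (fun w => by
    rw [← ContinuousLinearEquiv.coe_coe, he]
    ext x
    have e1 : twist s T' w x = (c₁ x * fderiv ℝ g₁ (0, h₀ x) (0, 1) +
      c₂ x * fderiv ℝ g₂ (0, h₀ x) (0, 1)) * w x - w (T x) := rfl
    rw [e1]
    change c₁ x * fderiv ℝ g₁ (0, h₀ x) (0, w x) + c₂ x * fderiv ℝ g₂ (0, h₀ x) (0, w x)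
      - w (T x) = _
    rw [hlin _ (w x), hlin (fderiv ℝ g₂ (0, h₀ x)) (w x)]
    ring)
  -- For finite order, being `C^n` at a point persists on a neighbourhood, which gives the interval.
  have hnn : (n : WithTop ℕ∞) ≠ ((⊤ : ℕ∞) : WithTop ℕ∞) := by
    exact_mod_cast ENat.natCast_ne_top n
  obtain ⟨ε, hε, hball⟩ := Metric.eventually_nhds_iff_ball.1
    ((hhc.eventually hnn).and hheq)
  rw [Real.ball_zero_eq_Ioo] at hball
  refine ⟨ε, hε, h, hh0, fun t ht => (hball t ht).1.contDiffWithinAt, fun t ht => ?_⟩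
  have h0 : ∀ x, F (0, h₀) x = 0 := fun x => by
    change c₁ x * g₁ (0, h₀ x) + c₂ x * g₂ (0, h₀ x) - h₀ (T x) = 0
    by_cases hx : x ∈ left
    · simp [c₁, c₂, hx, h1 x hx]
    · simp [c₁, c₂, hx, h2 x hx]
  have hx0 : ∀ x, c₁ x * g₁ (t, h t x) + c₂ x * g₂ (t, h t x) - h t (T x) = 0 := fun x => by
    rw [← h0 x, ← (hball t ht).2]; rfl
  constructor
  · intro x hx
    have := hx0 x
    simp [c₁, c₂, hx] at this
    linarith
  · intro x hx
    have := hx0 x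
    simp [c₁, c₂, hx] at this
    linarith

end ImplicitSolution

end PEU

end

noncomputable section

namespace PEU

open Filter Topology

/-! ### Extending `C^k` functions from an interval, linearly in the function. -/

section TaylorExtension

variable {V : Type} [NormedAddCommGroup V] [NormedSpace ℝ V] {p q : ℝ} (hpq : p ≤ q) (k : ℕ)
  (D : ℕ → V →L[ℝ] C(Icc p q, ℝ))

/-- The extension to `ℝ`, by Taylor polynomials of total order `k` at `p` and `q`, of the `i`-th
derivative of a `C^k` function on `[p, q]` whose derivatives are given by `D`. -/
def taylorExt (i : ℕ) (y : ℝ) : V →L[ℝ] ℝ :=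
  ∑ j ∈ Finset.range (k + 1 - i), ((y - projIcc p q hpq y) ^ j / (j.factorial : ℝ)) •
    (ContinuousMap.evalCLM ℝ (projIcc p q hpq y)).comp (D (i + j))

theorem taylorExt_apply (i : ℕ) (y : ℝ) (v : V) : taylorExt hpq k D i y v =
    ∑ j ∈ Finset.range (k + 1 - i), (y - projIcc p q hpq y) ^ j / (j.factorial : ℝ) *
      D (i + j) v (projIcc p q hpq y) := by
  simp [taylorExt]

theorem taylorExt_of_mem {i : ℕ} (hi : i ≤ k) {y : ℝ} (hy : y ∈ Icc p q) (v : V) :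
    taylorExt hpq k D i y v = D i v ⟨y, hy⟩ := by
  rw [taylorExt_apply, projIcc_of_mem _ hy, Nat.succ_sub hi, Finset.sum_range_succ']
  simp

theorem continuous_taylorExt (i : ℕ) :
    Continuous fun z : V × ℝ => taylorExt hpq k D i z.2 z.1 := by
  simp_rw [taylorExt_apply]
  refine continuous_finsetSum _ fun j _ => ?_
  have hproj : Continuous fun z : V × ℝ => projIcc p q hpq z.2 :=
    continuous_projIcc.comp continuous_snd
  refine Continuous.mul ?_ (((D (i + j)).continuous.comp continuous_fst).eval hproj)
  exact ((continuous_snd.sub (continuous_subtype_val.comp hproj)).pow j).div_const _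

theorem hasDerivAt_sum_pow_div_factorial (m : ℕ) (c : ℕ → ℝ) (b y : ℝ) :
    HasDerivAt (fun z => ∑ j ∈ Finset.range (m + 1), (z - b) ^ j / (j.factorial : ℝ) * c j)
      (∑ j ∈ Finset.range m, (y - b) ^ j / (j.factorial : ℝ) * c (j + 1)) y := by
  simp_rw [Finset.sum_range_succ' _ m]
  have h : ∀ j ∈ Finset.range m, HasDerivAt
      (fun z => (z - b) ^ (j + 1) / ((j + 1).factorial : ℝ) * c (j + 1))
      ((y - b) ^ j / (j.factorial : ℝ) * c (j + 1)) y := fun j _ => by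
    have h1 := ((((hasDerivAt_id y).sub_const b).pow (j + 1)).div_const
      ((j + 1).factorial : ℝ)).mul_const (c (j + 1))
    refine h1.congr_deriv ?_
    have : (j.factorial : ℝ) ≠ 0 := by positivity
    have : (j : ℝ) + 1 ≠ 0 := by positivity
    simp only [id, Nat.add_sub_cancel, Nat.factorial_succ, Nat.cast_mul, Nat.cast_add,
      Nat.cast_one, mul_one]
    field_simp
  simpa using (HasDerivAt.fun_sum h).add_const (c 0)

variable (hD : ∀ i < k, ∀ v : V, ∀ y : Icc p q,
  HasDerivWithinAt (fun z => D i v (projIcc p q hpq z)) (D (i + 1) v y) (Icc p q) y)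

include hD in
-- Outside `[p, q]` the extension is a Taylor polynomial based at an endpoint, truncated so that its
-- derivative is the extension of the next derivative. The one-sided statements on `Iic p`, `Icc p
-- q` and `Ici q` are glued; a closed set not containing `y` contributes nothing.
theorem hasDerivAt_taylorExt {i : ℕ} (hi : i < k) (v : V) (y : ℝ) :
    HasDerivAt (fun z => taylorExt hpq k D i z v) (taylorExt hpq k D (i + 1) y v) y := by
  have hext : ∀ b : Icc p q, ∀ S : Set ℝ, (∀ z ∈ S, projIcc p q hpq z = b) → y ∈ S →
      HasDerivWithinAt (fun z => taylorExt hpq k D i z v) (taylorExt hpq k D (i + 1) y v) S y := by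
    intro b S hS hy
    have h1 := (hasDerivAt_sum_pow_div_factorial (k - i) (fun j => D (i + j) v b) b y)
    have e1 : taylorExt hpq k D (i + 1) y v = ∑ j ∈ Finset.range (k - i),
        (y - b) ^ j / (j.factorial : ℝ) * D (i + (j + 1)) v b := by
      rw [taylorExt_apply, hS y hy, Nat.add_sub_add_right]
      refine Finset.sum_congr rfl fun j _ => ?_
      rw [show i + 1 + j = i + (j + 1) by ring]
    have e2 : ∀ z ∈ S, taylorExt hpq k D i z v = ∑ j ∈ Finset.range (k - i + 1),
        (z - b) ^ j / (j.factorial : ℝ) * D (i + j) v b := fun z hz => by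
      rw [taylorExt_apply, hS z hz, show k + 1 - i = k - i + 1 by omega]
    rw [e1]
    exact h1.hasDerivWithinAt.congr e2 (e2 y hy)
  have hcl : ∀ S : Set ℝ, IsClosed S → y ∉ S → HasDerivWithinAt
      (fun z => taylorExt hpq k D i z v) (taylorExt hpq k D (i + 1) y v) S y := fun S hS hy =>
    HasFDerivWithinAt.of_notMem_closure (by rwa [hS.closure_eq])
  have hl : HasDerivWithinAt (fun z => taylorExt hpq k D i z v)
      (taylorExt hpq k D (i + 1) y v) (Iic p) y := by
    by_cases hy : y ∈ Iic p
    · exact hext ⟨p, left_mem_Icc.2 hpq⟩ _ (fun z hz => projIcc_of_le_left hpq hz) hy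
    · exact hcl _ isClosed_Iic hy
  have hr : HasDerivWithinAt (fun z => taylorExt hpq k D i z v)
      (taylorExt hpq k D (i + 1) y v) (Ici q) y := by
    by_cases hy : y ∈ Ici q
    · exact hext ⟨q, right_mem_Icc.2 hpq⟩ _ (fun z hz => projIcc_of_right_le hpq hz) hy
    · exact hcl _ isClosed_Ici hy
  have hm : HasDerivWithinAt (fun z => taylorExt hpq k D i z v)
      (taylorExt hpq k D (i + 1) y v) (Icc p q) y := by
    by_cases hy : y ∈ Icc p q
    · rw [taylorExt_of_mem hpq k D hi hy]
      refine (hD i hi v ⟨y, hy⟩).congr (fun z hz => ?_) ?_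
      · rw [taylorExt_of_mem hpq k D hi.le hz, projIcc_of_mem hpq hz]
      · rw [taylorExt_of_mem hpq k D hi.le hy, projIcc_of_mem hpq hy]
    · exact hcl _ isClosed_Icc hy
  have hu := (hl.union hm).union hr
  rw [Iic_union_Icc_eq_Iic hpq, Iic_union_Ici, hasDerivWithinAt_univ] at hu
  exact hu

include hD in
-- Both partial derivatives exist and are continuous. The one in time replaces `f` by `deriv f`, by
-- linearity in `V`, and the one in space raises `i` to `i + 1`.
theorem hasStrictFDerivAt_taylorExt {J : Set ℝ} (hJ : IsOpen J) {f : ℝ → V}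
    (hf : ContDiffOn ℝ 1 f J) {i : ℕ} (hi : i < k) {t : ℝ} (ht : t ∈ J) (y : ℝ) :
    HasStrictFDerivAt (fun z : ℝ × ℝ => taylorExt hpq k D i z.2 (f z.1))
      (taylorExt hpq k D i y (deriv f t) • ContinuousLinearMap.fst ℝ ℝ ℝ +
        taylorExt hpq k D (i + 1) y (f t) • ContinuousLinearMap.snd ℝ ℝ ℝ) (t, y) := by
  have hd : ∀ s ∈ J, HasDerivAt f (deriv f s) s := fun s hs =>
    ((hf.differentiableOn one_ne_zero).differentiableAt (hJ.mem_nhds hs)).hasDerivAt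
  have hc : ContinuousAt (deriv f) t :=
    (hf.continuousOn_deriv_of_isOpen hJ le_rfl).continuousAt (hJ.mem_nhds ht)
  have hev : ∀ᶠ v : ℝ × ℝ in 𝓝 (t, y), v.1 ∈ J :=
    continuous_fst.continuousAt.preimage_mem_nhds (hJ.mem_nhds ht)
  have hcont : ∀ (j : ℕ) (g : ℝ → V), ContinuousAt g t →
      ContinuousAt (fun z : ℝ × ℝ => taylorExt hpq k D j z.2 (g z.1)) (t, y) := fun j g hg =>
    (continuous_taylorExt hpq k D j).continuousAt.comp
      (f := fun z : ℝ × ℝ => (g z.1, z.2))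
      ((hg.comp_of_eq continuous_fst.continuousAt rfl).prodMk continuous_snd.continuousAt)
  have key := hasStrictFDerivAt_uncurry_coprod (𝕜 := ℝ) (u := (t, y))
    (f := fun s z => taylorExt hpq k D i z (f s))
    (f₁ := fun s z => taylorExt hpq k D i z (deriv f s) • ContinuousLinearMap.id ℝ ℝ)
    (f₂ := fun s z => taylorExt hpq k D (i + 1) z (f s) • ContinuousLinearMap.id ℝ ℝ)
    (by
      filter_upwards [hev] with v hv
      have := (taylorExt hpq k D i v.2).hasFDerivAt.comp_hasDerivAt v.1 (hd v.1 hv)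
      refine this.hasFDerivAt.congr_fderiv ?_
      ext; simp [Function.HasUncurry.uncurry])
    (by
      filter_upwards with v
      refine (hasDerivAt_taylorExt hpq k D hD hi (f v.1) v.2).hasFDerivAt.congr_fderiv ?_
      ext; simp [Function.HasUncurry.uncurry])
    ((hcont i _ hc).smul continuousAt_const)
    ((hcont (i + 1) _ (hd t ht).continuousAt).smul continuousAt_const)
  refine key.congr_fderiv ?_
  ext <;> simp [Function.HasUncurry.uncurry]

include hD in
-- The two partial derivatives have the same form, with `(i, deriv f)` and `(i + 1, f)`, so the
-- induction is over all `i` and `f` at once; `i + m ≤ k` says that enough space derivatives remain.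
theorem contDiffOn_taylorExt {J : Set ℝ} (hJ : IsOpen J) (m : ℕ) : ∀ (i : ℕ) (f : ℝ → V),
    i + m ≤ k → ContDiffOn ℝ m f J →
    ContDiffOn ℝ m (fun z : ℝ × ℝ => taylorExt hpq k D i z.2 (f z.1)) (J ×ˢ univ) := by
  induction m with
  | zero =>
    intro i f _ hf
    refine contDiffOn_zero.2 ((continuous_taylorExt hpq k D i).comp_continuousOn
      (f := fun z : ℝ × ℝ => (f z.1, z.2)) ?_)
    exact (hf.continuousOn.comp continuousOn_fst fun z hz => hz.1).prodMk continuousOn_snd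
  | succ m ih =>
    intro i f him hf
    have hf1 : ContDiffOn ℝ 1 f J := hf.of_le (by exact_mod_cast Nat.succ_le_succ (Nat.zero_le m))
    have hJu : IsOpen (J ×ˢ (univ : Set ℝ)) := hJ.prod isOpen_univ
    have hf' : ContDiffOn ℝ ((m : WithTop ℕ∞) + 1) f J := by exact_mod_cast hf
    have hder := fun z (hz : z ∈ J ×ˢ (univ : Set ℝ)) =>
      (hasStrictFDerivAt_taylorExt hpq k D hD hJ hf1 (i := i) (by omega) hz.1 z.2).hasFDerivAt
    have hfd : ContDiffOn ℝ m (deriv f) J := ((contDiffOn_succ_iff_deriv_of_isOpen hJ).1 hf').2.2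
    have goal : ContDiffOn ℝ ((m : WithTop ℕ∞) + 1)
        (fun z : ℝ × ℝ => taylorExt hpq k D i z.2 (f z.1)) (J ×ˢ univ) := by
      refine (contDiffOn_succ_iff_fderiv_of_isOpen hJu).2
        ⟨fun z hz => (hder z hz).differentiableAt.differentiableWithinAt, by simp, ?_⟩
      refine ContDiffOn.congr ?_ fun z hz => (hder z hz).fderiv
      exact ((ih i (deriv f) (by omega) hfd).smul contDiffOn_const).add
        ((ih (i + 1) f (by omega) (hf'.of_le (by exact_mod_cast Nat.le_succ m))).smul
          contDiffOn_const)
    exact_mod_cast goal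

end TaylorExtension

end PEU

end

noncomputable section

namespace PEU

open Filter Topology

/-! ### The two branches of a piecewise `C^k` map, extended to the line. -/

section Branches

variable {k : ℕ}

/-- The interval of monotonicity: `[-1, 0]` for `true`, `[0, 1]` for `false`. -/
def piece (σ : Bool) : Set ℝ := if σ then Icc (-1) 0 else Icc 0 1

theorem hasDerivWithinAt_iteratedDerivWithin_projIcc {p q : ℝ} (hpq : p < q) {g : ℝ → ℝ}
    (hg : ContDiffOn ℝ k g (Icc p q)) {i : ℕ} (hi : i < k) (y : Icc p q) :
    HasDerivWithinAt (fun z => iteratedDerivWithin i g (Icc p q) (projIcc p q hpq.le z))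
      (iteratedDerivWithin (i + 1) g (Icc p q) y) (Icc p q) y := by
  have h1 := hg.differentiableOn_iteratedDerivWithin (m := i) (by exact_mod_cast hi)
    (uniqueDiffOn_Icc hpq) y y.2
  rw [iteratedDerivWithin_succ]
  refine h1.hasDerivWithinAt.congr (fun z hz => ?_) ?_
  · rw [projIcc_of_mem hpq.le hz]
  · rw [projIcc_val]

/-- The jet as a continuous linear map. -/
def jetCLM (k : ℕ) : PC k →L[ℝ]
    (Fin (k + 1) → C(↥(Icc (-1 : ℝ) 0), ℝ) × C(↥(Icc (0 : ℝ) 1), ℝ)) :=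
  LinearMap.mkContinuous (PC.jet k) 1 (fun f => by rw [one_mul]; exact le_of_eq rfl)

/-- The `i`-th derivative on `[-1, 0]`, zero for `i > k`. -/
def derivLeft (k i : ℕ) : PC k →L[ℝ] C(↥(Icc (-1 : ℝ) 0), ℝ) :=
  if h : i < k + 1 then (ContinuousLinearMap.fst ℝ _ _).comp
    ((ContinuousLinearMap.proj (⟨i, h⟩ : Fin (k + 1))).comp (jetCLM k)) else 0

/-- The `i`-th derivative on `[0, 1]`, zero for `i > k`. -/
def derivRight (k i : ℕ) : PC k →L[ℝ] C(↥(Icc (0 : ℝ) 1), ℝ) :=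
  if h : i < k + 1 then (ContinuousLinearMap.snd ℝ _ _).comp
    ((ContinuousLinearMap.proj (⟨i, h⟩ : Fin (k + 1))).comp (jetCLM k)) else 0

theorem derivLeft_apply {i : ℕ} (h : i ≤ k) (v : PC k) (y : ↥(Icc (-1 : ℝ) 0)) :
    derivLeft k i v y = iteratedDerivWithin i (ext v) (Icc (-1) 0) y := by
  rw [derivLeft, dif_pos (Nat.lt_succ_of_le h)]; rfl

theorem derivRight_apply {i : ℕ} (h : i ≤ k) (v : PC k) (y : ↥(Icc (0 : ℝ) 1)) :
    derivRight k i v y = iteratedDerivWithin i (ext v) (Icc 0 1) y := by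
  rw [derivRight, dif_pos (Nat.lt_succ_of_le h)]; rfl

theorem derivLeft_hasDerivWithinAt : ∀ i < k, ∀ v : PC k, ∀ y : ↥(Icc (-1 : ℝ) 0),
    HasDerivWithinAt (fun z => derivLeft k i v (projIcc (-1) 0 (by norm_num) z))
      (derivLeft k (i + 1) v y) (Icc (-1) 0) y := fun i hi v y => by
  simp_rw [derivLeft_apply hi.le, derivLeft_apply (Nat.succ_le_of_lt hi)]
  exact hasDerivWithinAt_iteratedDerivWithin_projIcc (by norm_num) v.contDiffOn_left hi y

theorem derivRight_hasDerivWithinAt : ∀ i < k, ∀ v : PC k, ∀ y : ↥(Icc (0 : ℝ) 1),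
    HasDerivWithinAt (fun z => derivRight k i v (projIcc 0 1 (by norm_num) z))
      (derivRight k (i + 1) v y) (Icc 0 1) y := fun i hi v y => by
  simp_rw [derivRight_apply hi.le, derivRight_apply (Nat.succ_le_of_lt hi)]
  exact hasDerivWithinAt_iteratedDerivWithin_projIcc (by norm_num) v.contDiffOn_right hi y

/-- The `i`-th derivative at `y` of the Taylor extension to `ℝ` of a branch. -/
def branch (k : ℕ) (σ : Bool) (i : ℕ) (y : ℝ) : PC k →L[ℝ] ℝ :=
  if σ then taylorExt (p := -1) (q := 0) (by norm_num) k (derivLeft k) i y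
  else taylorExt (p := 0) (q := 1) (by norm_num) k (derivRight k) i y

theorem branch_of_mem {σ : Bool} {i : ℕ} (hi : i ≤ k) {y : ℝ} (hy : y ∈ piece σ) (v : PC k) :
    branch k σ i y v = iteratedDerivWithin i (ext v) (piece σ) y := by
  cases σ
  · change taylorExt _ _ _ _ _ _ = _
    rw [taylorExt_of_mem _ _ _ hi hy, derivRight_apply hi]; rfl
  · change taylorExt _ _ _ _ _ _ = _
    rw [taylorExt_of_mem _ _ _ hi hy, derivLeft_apply hi]; rfl

theorem piece_subset (σ : Bool) : piece σ ⊆ Icc (-1) 1 := by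
  cases σ
  · exact Icc_subset_Icc_left (by norm_num)
  · exact Icc_subset_Icc_right (by norm_num)

theorem branch_zero {σ : Bool} (x : I) (hx : (x : ℝ) ∈ piece σ) (v : PC k) :
    branch k σ 0 x v = v x := by
  rw [branch_of_mem (Nat.zero_le k) hx, iteratedDerivWithin_zero, ext_apply]

theorem branch_one (hk : 1 ≤ k) {σ : Bool} {y : ℝ} (hy : y ∈ piece σ) (v : PC k) :
    branch k σ 1 y v = derivWithin (ext v) (piece σ) y := by
  rw [branch_of_mem hk hy, iteratedDerivWithin_one]

theorem abs_branch_le {σ : Bool} {i : ℕ} (hi : i ≤ k) {y : ℝ} (hy : y ∈ piece σ) (v : PC k) :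
    |branch k σ i y v| ≤ ‖v‖ := by
  rw [branch_of_mem hi hy]
  have := (PC.norm_le_iff v (norm_nonneg v)).1 le_rfl i hi
  cases σ
  · exact this.2 y hy
  · exact this.1 y hy

theorem exists_mem_piece (x : I) : ∃ σ, (x : ℝ) ∈ piece σ := by
  rcases le_total (x : ℝ) 0 with h | h
  · exact ⟨true, x.2.1, h⟩
  · exact ⟨false, h, x.2.2⟩

theorem abs_apply_le_norm (v : PC k) (x : I) : |v x| ≤ ‖v‖ := by
  obtain ⟨σ, hσ⟩ := exists_mem_piece x
  rw [← branch_zero x hσ v]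
  exact abs_branch_le (Nat.zero_le k) hσ v

theorem continuous_branch (σ : Bool) (i : ℕ) :
    Continuous fun z : PC k × ℝ => branch k σ i z.2 z.1 := by
  cases σ <;> exact continuous_taylorExt _ _ _ _

theorem hasDerivAt_branch (σ : Bool) {i : ℕ} (hi : i < k) (v : PC k) (y : ℝ) :
    HasDerivAt (fun z => branch k σ i z v) (branch k σ (i + 1) y v) y := by
  cases σ
  · exact hasDerivAt_taylorExt _ _ _ derivRight_hasDerivWithinAt hi v y
  · exact hasDerivAt_taylorExt _ _ _ derivLeft_hasDerivWithinAt hi v y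

theorem contDiffOn_branch (σ : Bool) {J : Set ℝ} (hJ : IsOpen J) {m i : ℕ} {f : ℝ → PC k}
    (him : i + m ≤ k) (hf : ContDiffOn ℝ m f J) :
    ContDiffOn ℝ m (fun z : ℝ × ℝ => branch k σ i z.2 (f z.1)) (J ×ˢ univ) := by
  cases σ
  · exact contDiffOn_taylorExt _ _ _ derivRight_hasDerivWithinAt hJ m i f him hf
  · exact contDiffOn_taylorExt _ _ _ derivLeft_hasDerivWithinAt hJ m i f him hf

theorem hasFDerivAt_branch (σ : Bool) {J : Set ℝ} (hJ : IsOpen J) {f : ℝ → PC k}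
    (hf : ContDiffOn ℝ 1 f J) {i : ℕ} (hi : i < k) {t : ℝ} (ht : t ∈ J) (y : ℝ) :
    HasFDerivAt (fun z : ℝ × ℝ => branch k σ i z.2 (f z.1))
      (branch k σ i y (deriv f t) • ContinuousLinearMap.fst ℝ ℝ ℝ +
        branch k σ (i + 1) y (f t) • ContinuousLinearMap.snd ℝ ℝ ℝ) (t, y) := by
  cases σ
  · exact (hasStrictFDerivAt_taylorExt _ _ _ derivRight_hasDerivWithinAt hJ hf hi ht
      y).hasFDerivAt
  · exact (hasStrictFDerivAt_taylorExt _ _ _ derivLeft_hasDerivWithinAt hJ hf hi ht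
      y).hasFDerivAt

theorem hasDerivWithinAt_branch_comp (σ : Bool) {J : Set ℝ} (hJ : IsOpen J) {f : ℝ → PC k}
    (hf : ContDiffOn ℝ 1 f J) {i : ℕ} (hi : i < k) {t : ℝ} (ht : t ∈ J) {y : ℝ → ℝ} {y' : ℝ}
    {S : Set ℝ} (hy : HasDerivWithinAt y y' S t) :
    HasDerivWithinAt (fun s => branch k σ i (y s) (f s))
      (branch k σ i (y t) (deriv f t) + branch k σ (i + 1) (y t) (f t) * y') S t := by
  have := (hasFDerivAt_branch σ hJ hf hi ht (y t)).comp_hasDerivWithinAt t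
    ((hasDerivWithinAt_id t S).prodMk hy)
  exact this.congr_deriv (by simp)

theorem hasDerivAt_branch_comp (σ : Bool) {J : Set ℝ} (hJ : IsOpen J) {f : ℝ → PC k}
    (hf : ContDiffOn ℝ 1 f J) {i : ℕ} (hi : i < k) {t : ℝ} (ht : t ∈ J) {y : ℝ → ℝ} {y' : ℝ}
    (hy : HasDerivAt y y' t) :
    HasDerivAt (fun s => branch k σ i (y s) (f s))
      (branch k σ i (y t) (deriv f t) + branch k σ (i + 1) (y t) (f t) * y') t := by
  rw [← hasDerivWithinAt_univ] at *
  exact hasDerivWithinAt_branch_comp σ hJ hf hi ht hy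

end Branches

/-! ### Expansion of the branches and its stability. -/

section UnimodalMaps

variable {k : ℕ}

/-- The sign of the slope on a branch. -/
def orient (σ : Bool) : ℝ := if σ then 1 else -1

/-- `a` is a lower bound for the expansion of `f`. -/
def ExpandsBy (a : ℝ) (f : PC k) : Prop :=
  ∀ σ, ∀ y ∈ piece σ, a ≤ orient σ * branch k σ 1 y f

theorem abs_orient_mul (σ : Bool) (r : ℝ) : |orient σ * r| = |r| := by
  cases σ <;> simp [orient]

theorem ExpandsBy.le_abs {a : ℝ} {f : PC k} (h : ExpandsBy a f) {σ : Bool} {y : ℝ}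
    (hy : y ∈ piece σ) : a ≤ |branch k σ 1 y f| :=
  (h σ y hy).trans ((le_abs_self _).trans (abs_orient_mul σ _).le)

theorem exists_expandsBy (hk : 1 ≤ k) {f : PC k} (hf : f ∈ U k) : ∃ a > 1, ExpandsBy a f := by
  obtain ⟨a, ha, h1, h2⟩ := hf.2.1
  refine ⟨a, ha, fun σ y hy => ?_⟩
  rw [branch_one hk hy]
  cases σ
  · have := h2 y hy
    simp only [orient, piece, Bool.false_eq_true, if_false]
    linarith
  · have := h1 y hy
    simp only [orient, piece, if_true]
    linarith

theorem expansion_le (hk : 1 ≤ k) (f : PC k) {σ : Bool} {y : ℝ} (hy : y ∈ piece σ) :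
    expansion f ≤ |branch k σ 1 y f| := by
  rw [branch_one hk hy]
  refine csInf_le ⟨0, ?_⟩ ?_
  · rintro _ (⟨x, _, rfl⟩ | ⟨x, _, rfl⟩) <;> exact abs_nonneg _
  · cases σ
    · exact Or.inr ⟨y, hy, rfl⟩
    · exact Or.inl ⟨y, hy, rfl⟩

theorem ExpandsBy.le_expansion (hk : 1 ≤ k) {a : ℝ} {f : PC k} (h : ExpandsBy a f) :
    a ≤ expansion f := by
  refine le_csInf ⟨_, Or.inl ⟨0, by norm_num, rfl⟩⟩ ?_
  rintro _ (⟨x, hx, rfl⟩ | ⟨x, hx, rfl⟩)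
  · have := h.le_abs (σ := true) hx
    rwa [branch_one hk (σ := true) hx] at this
  · have := h.le_abs (σ := false) hx
    rwa [branch_one hk (σ := false) hx] at this

theorem one_lt_expansion (hk : 1 ≤ k) {f : PC k} (hf : f ∈ U k) : 1 < expansion f := by
  obtain ⟨a, ha, h⟩ := exists_expandsBy hk hf
  exact lt_of_lt_of_le ha (h.le_expansion hk)

theorem ExpandsBy.mono_of_norm_sub_le (hk : 1 ≤ k) {a r : ℝ} {f g : PC k} (h : ExpandsBy a f)
    (hfg : ‖g - f‖ ≤ r) : ExpandsBy (a - r) g := by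
  intro σ y hy
  have h1 := h σ y hy
  have h2 := (abs_branch_le hk hy (g - f)).trans hfg
  rw [← abs_orient_mul, map_sub, mul_sub, abs_le] at h2
  linarith [h2.1]

/-- Slopes stay expanding on a neighbourhood of each branch, uniformly for maps near `f`. -/
theorem exists_expanding_neighbourhood {a b : ℝ} {f : PC k} (h : ExpandsBy a f) (hb : b < a) :
    ∃ η > 0, ∀ g : PC k, ‖g - f‖ < η → ∀ σ, ∀ x ∈ piece σ, ∀ y, |y - x| < η →
      b ≤ orient σ * branch k σ 1 y g := by
  have hσ : ∀ σ, ∃ η > 0, ∀ g : PC k, ‖g - f‖ < η → ∀ x ∈ piece σ, ∀ y, |y - x| < η →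
      b ≤ orient σ * branch k σ 1 y g := by
    intro σ
    have hK : IsCompact (({f} : Set (PC k)) ×ˢ piece σ) := by
      refine isCompact_singleton.prod ?_
      cases σ <;> exact isCompact_Icc
    have hO : IsOpen {z : PC k × ℝ | b < orient σ * branch k σ 1 z.2 z.1} :=
      isOpen_lt continuous_const ((continuous_branch σ 1).const_mul _)
    obtain ⟨η, hη, hsub⟩ := hK.exists_thickening_subset_open hO (by
      rintro ⟨g, y⟩ ⟨hg, hy⟩
      obtain rfl : g = f := hg
      exact hb.trans_le (h σ y hy))
    refine ⟨η, hη, fun g hg x hx y hy => le_of_lt ?_⟩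
    refine hsub (a := (g, y)) (Metric.mem_thickening_iff.2 ⟨(f, x), ⟨rfl, hx⟩, ?_⟩)
    rw [Prod.dist_eq]
    exact max_lt (by rwa [dist_eq_norm]) (by rwa [Real.dist_eq])
  obtain ⟨η₁, h1, H1⟩ := hσ true
  obtain ⟨η₂, h2, H2⟩ := hσ false
  refine ⟨min η₁ η₂, lt_min h1 h2, fun g hg σ x hx y hy => ?_⟩
  cases σ
  · exact H2 g (hg.trans_le (min_le_right _ _)) x hx y (hy.trans_le (min_le_right _ _))
  · exact H1 g (hg.trans_le (min_le_left _ _)) x hx y (hy.trans_le (min_le_left _ _))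

theorem le_orient_mul_sub_of_le_slope (hk : 1 ≤ k) {σ : Bool} {g : PC k} {b y z : ℝ} (hyz : y ≤ z)
    (h : ∀ w ∈ Icc y z, b ≤ orient σ * branch k σ 1 w g) :
    b * (z - y) ≤ orient σ * (branch k σ 0 z g - branch k σ 0 y g) := by
  have hd : ∀ w, HasDerivAt (fun w => orient σ * branch k σ 0 w g)
      (orient σ * branch k σ 1 w g) w := fun w =>
    (hasDerivAt_branch σ (by omega) g w).const_mul _
  have := (convex_Icc y z).mul_sub_le_image_sub_of_le_deriv
    (f := fun w => orient σ * branch k σ 0 w g)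
    (fun w _ => (hd w).continuousAt.continuousWithinAt)
    (fun w _ => (hd w).differentiableAt.differentiableWithinAt) (C := b)
    (fun w hw => by rw [(hd w).deriv]; exact h w (interior_subset hw))
    y (left_mem_Icc.2 hyz) z (right_mem_Icc.2 hyz) hyz
  rw [mul_sub (orient σ)]
  exact this

end UnimodalMaps

end PEU

end

noncomputable section

namespace PEU

open Filter Topology

/-- A positive value of `d` could be multiplied by `a` indefinitely within `P`, exceeding `B`. In
the applications `P` singles out bad configurations of points and `d` measures their size. -/
theorem nonpos_of_expanding {X : Type} (P : X → Prop) (d : X → ℝ) {a B : ℝ} (ha : 1 < a)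
    (hB : ∀ x, P x → d x ≤ B) (step : ∀ x, P x → ∃ y, P y ∧ a * d x ≤ d y) {x : X} (hx : P x) :
    d x ≤ 0 := by
  by_contra! hpos
  have h : ∀ n : ℕ, ∃ y, P y ∧ a ^ n * d x ≤ d y := by
    intro n
    induction n with
    | zero => exact ⟨x, hx, by simp⟩
    | succ n ih =>
      obtain ⟨y, hy, h1⟩ := ih
      obtain ⟨z, hz, h2⟩ := step y hy
      refine ⟨z, hz, le_trans ?_ h2⟩
      rw [pow_succ', mul_assoc]
      gcongr
  obtain ⟨n, hn⟩ := pow_unbounded_of_one_lt (B / d x) ha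
  obtain ⟨y, hy, h1⟩ := h n
  rw [div_lt_iff₀ hpos] at hn
  linarith [hB y hy]

/-! ### Unimodal dynamics, derivatives of iterates, and the functional `J`. -/

section Dynamics

variable {k : ℕ}

/-- The branch containing `x`; at the critical point, the left one. -/
def side (x : I) : Bool := decide ((x : ℝ) ≤ 0)

theorem mem_piece_side (x : I) : (x : ℝ) ∈ piece (side x) := by
  by_cases h : (x : ℝ) ≤ 0
  · simp [side, h, piece, x.2.1]
  · simp [side, h, piece, x.2.2]; linarith

theorem c_mem_piece (σ : Bool) : (c : ℝ) ∈ piece σ := by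
  cases σ <;> simp [piece, c]

theorem mem_piece_or_straddle (x y : I) :
    (∃ σ, (x : ℝ) ∈ piece σ ∧ (y : ℝ) ∈ piece σ) ∨ ((x : ℝ) < 0 ∧ 0 < (y : ℝ)) ∨
      ((y : ℝ) < 0 ∧ 0 < (x : ℝ)) := by
  rcases le_or_gt (x : ℝ) 0 with hx | hx <;> rcases le_or_gt (y : ℝ) 0 with hy | hy
  · exact Or.inl ⟨true, ⟨x.2.1, hx⟩, ⟨y.2.1, hy⟩⟩
  · rcases hx.eq_or_lt with hx | hx
    · exact Or.inl ⟨false, ⟨hx.ge, x.2.2⟩, ⟨hy.le, y.2.2⟩⟩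
    · exact Or.inr (Or.inl ⟨hx, hy⟩)
  · rcases hy.eq_or_lt with hy | hy
    · exact Or.inl ⟨false, ⟨hx.le, x.2.2⟩, ⟨hy.ge, y.2.2⟩⟩
    · exact Or.inr (Or.inr ⟨hy, hx⟩)
  · exact Or.inl ⟨false, ⟨hx.le, x.2.2⟩, ⟨hy.le, y.2.2⟩⟩

theorem ordConnected_piece (σ : Bool) : (piece σ).OrdConnected := by
  cases σ <;> exact ordConnected_Icc

theorem coe_eq_zero {x : I} : (x : ℝ) = 0 ↔ x = c := by
  rw [Subtype.ext_iff]; rfl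

theorem ExpandsBy.le_orient_mul_sub (hk : 1 ≤ k) {a : ℝ} {f : PC k} (h : ExpandsBy a f)
    {σ : Bool} {x y : I} (hx : (x : ℝ) ∈ piece σ) (hy : (y : ℝ) ∈ piece σ) (hxy : x ≤ y) :
    a * (y - x) ≤ orient σ * (f y - f x) := by
  have := le_orient_mul_sub_of_le_slope hk (σ := σ) (g := f) (b := a) (y := x) (z := y) hxy
    (fun w hw => h σ w ((ordConnected_piece σ).out hx hy hw))
  rwa [branch_zero y hy, branch_zero x hx] at this

theorem ExpandsBy.mul_abs_sub_le (hk : 1 ≤ k) {a : ℝ} {f : PC k} (h : ExpandsBy a f)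
    {σ : Bool} {x y : I} (hx : (x : ℝ) ∈ piece σ) (hy : (y : ℝ) ∈ piece σ) :
    a * |(x : ℝ) - y| ≤ |f x - f y| := by
  rcases le_total x y with hxy | hxy
  · rw [abs_sub_comm, abs_of_nonneg (sub_nonneg.2 (show (x : ℝ) ≤ y from hxy)), abs_sub_comm]
    exact (h.le_orient_mul_sub hk hx hy hxy).trans ((le_abs_self _).trans (abs_orient_mul σ _).le)
  · rw [abs_of_nonneg (sub_nonneg.2 (show (y : ℝ) ≤ x from hxy))]
    exact (h.le_orient_mul_sub hk hy hx hxy).trans ((le_abs_self _).trans (abs_orient_mul σ _).le)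

theorem continuous_ext (f : PC k) : Continuous (ext f) :=
  (show Continuous (f : I → ℝ) from f.2.1).Icc_extend'

theorem exists_preimage_mem_piece (hk : 1 ≤ k) {f : PC k} (hf : f ∈ U k) (σ : Bool) {w : I}
    (hw : w ≤ selfMap f c) : ∃ x : I, (x : ℝ) ∈ piece σ ∧ selfMap f x = w := by
  have hw' : (w : ℝ) ≤ ext f 0 := by
    have : (w : ℝ) ≤ selfMap f c := hw
    rw [selfMap_coe hk hf] at this
    exact this.trans (ext_apply f c).ge
  have el : ext f (-1) = -1 := (ext_apply f left).trans hf.1.1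
  have er : ext f 1 = -1 := (ext_apply f right).trans hf.1.2
  have key : ∃ x ∈ piece σ, ext f x = w := by
    cases σ
    · exact intermediate_value_Icc' zero_le_one (continuous_ext f).continuousOn
        ⟨er.le.trans w.2.1, hw'⟩
    · exact intermediate_value_Icc (by norm_num) (continuous_ext f).continuousOn
        ⟨el.le.trans w.2.1, hw'⟩
  obtain ⟨x, hx, hxw⟩ := key
  refine ⟨⟨x, piece_subset σ hx⟩, hx, Subtype.ext ?_⟩
  rw [selfMap_coe hk hf, ← hxw]
  exact (ext_apply f ⟨x, piece_subset σ hx⟩).symm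

theorem selfMap_le_selfMap_c (hk : 1 ≤ k) {f : PC k} (hf : f ∈ U k) (x : I) :
    selfMap f x ≤ selfMap f c := by
  obtain ⟨a, ha, h⟩ := exists_expandsBy hk hf
  change (selfMap f x : ℝ) ≤ selfMap f c
  rw [selfMap_coe hk hf, selfMap_coe hk hf]
  rcases le_total (x : ℝ) 0 with hx | hx
  · have := h.le_orient_mul_sub hk (σ := true) (x := x) (y := c) ⟨x.2.1, hx⟩ (c_mem_piece _) hx
    simp only [orient, if_true, one_mul] at this
    have h2 : 0 ≤ a * ((c : ℝ) - x) := mul_nonneg (by linarith) (sub_nonneg.2 hx)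
    linarith
  · have := h.le_orient_mul_sub hk (σ := false) (x := c) (y := x) (c_mem_piece _) ⟨hx, x.2.2⟩ hx
    simp only [orient, Bool.false_eq_true, if_false] at this
    have h2 : 0 ≤ a * ((x : ℝ) - c) := mul_nonneg (by linarith) (sub_nonneg.2 hx)
    linarith

theorem eq_of_selfMap_eq_of_mem (hk : 1 ≤ k) {f : PC k} (hf : f ∈ U k) {σ : Bool} {x y : I}
    (hx : (x : ℝ) ∈ piece σ) (hy : (y : ℝ) ∈ piece σ) (hxy : selfMap f x = selfMap f y) :
    x = y := by
  obtain ⟨a, ha, h⟩ := exists_expandsBy hk hf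
  have h1 := h.mul_abs_sub_le hk hx hy
  rw [← selfMap_coe hk hf, ← selfMap_coe hk hf, hxy, sub_self, abs_zero] at h1
  have h2 : |(x : ℝ) - y| ≤ 0 := by nlinarith [abs_nonneg ((x : ℝ) - y)]
  exact Subtype.ext (sub_eq_zero.1 (abs_eq_zero.1 (le_antisymm h2 (abs_nonneg _))))

/-- Every value up to `f c` is attained on both pieces, so a fibre is a single point only if that
point lies in both. The description of `c` is purely set-theoretic, hence preserved by conjugacies.
-/
theorem eq_c_iff_forall_selfMap_eq (hk : 1 ≤ k) {f : PC k} (hf : f ∈ U k) (x : I) :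
    x = c ↔ ∀ y, selfMap f y = selfMap f x → y = x := by
  constructor
  · rintro rfl y hy
    exact eq_of_selfMap_eq_of_mem hk hf (mem_piece_side y) (c_mem_piece _) hy
  · intro h
    have hx := selfMap_le_selfMap_c hk hf x
    obtain ⟨y, hy, hy'⟩ := exists_preimage_mem_piece hk hf true hx
    obtain ⟨z, hz, hz'⟩ := exists_preimage_mem_piece hk hf false hx
    rw [h y hy'] at hy
    rw [h z hz'] at hz
    exact coe_eq_zero.1 (le_antisymm hy.2 hz.1)

theorem criticalRelations_eq_of_semiconj (hk : 1 ≤ k) {f g : PC k} (hf : f ∈ U k) (hg : g ∈ U k)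
    (h : I ≃ I) (hh : Function.Semiconj h (selfMap f) (selfMap g)) :
    criticalRelations g = criticalRelations f := by
  have hc : h c = c := by
    rw [eq_c_iff_forall_selfMap_eq hk hg]
    intro y hy
    obtain ⟨x, rfl⟩ := h.surjective y
    rw [← hh x, ← hh c] at hy
    rw [(eq_c_iff_forall_selfMap_eq hk hf c).1 rfl x (h.injective hy)]
  ext ⟨i, j⟩
  simp only [criticalRelations, mem_ofPred_eq]
  have : ∀ i, (selfMap g)^[i] c = h ((selfMap f)^[i] c) := fun i => by
    rw [(hh.iterate_right i) c, hc]
  rw [this, this, h.injective.eq_iff]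

/-- The slope of `f` at `x`; at the critical point, the left one. -/
def slope (f : PC k) (x : I) : ℝ := branch k (side x) 1 x f

theorem iterate_succ_coe (hk : 1 ≤ k) {f : PC k} (hf : f ∈ U k) (n : ℕ) (x : I) :
    ((selfMap f)^[n + 1] x : ℝ) = f ((selfMap f)^[n] x) := by
  rw [Function.iterate_succ_apply', selfMap_coe hk hf]

/-- As long as the orbit has not met `c`, the iterates of nearby points stay in one piece, where the
map agrees with a differentiable extended branch; the chain rule applies. -/
theorem hasDerivWithinAt_iterate (hk : 1 ≤ k) {f : PC k} (hf : f ∈ U k) (x : I) (n : ℕ)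
    (hx : ∀ j < n, (selfMap f)^[j] x ≠ c) :
    HasDerivWithinAt (ext fun y => ((selfMap f)^[n] y : ℝ))
      (∏ j ∈ Finset.range n, slope f ((selfMap f)^[j] x)) (Icc (-1) 1) x := by
  induction n with
  | zero =>
    simp only [Finset.range_zero, Finset.prod_empty]
    refine (hasDerivWithinAt_id (x : ℝ) (Icc (-1) 1)).congr (fun z hz => ?_) ?_
    · exact ext_apply _ ⟨z, hz⟩
    · exact ext_apply _ x
  | succ n ih =>
    have ih := ih fun j hj => hx j (by omega)
    set w := (selfMap f)^[n] x with hw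
    have hw0 : (w : ℝ) ≠ 0 := fun h => hx n (by omega) (coe_eq_zero.1 h)
    have hout : HasDerivAt (fun z => branch k (side w) 0 z f) (slope f w)
        (ext (fun y => ((selfMap f)^[n] y : ℝ)) x) := by
      rw [ext_apply]
      exact hasDerivAt_branch _ (by omega) f w
    rw [Finset.prod_range_succ, mul_comm]
    refine (hout.comp_hasDerivWithinAt (x : ℝ) ih).congr_of_eventuallyEq_of_mem ?_ x.2
    have hpiece : ∀ᶠ z in 𝓝[Icc (-1) 1] (x : ℝ),
        ext (fun y => ((selfMap f)^[n] y : ℝ)) z ∈ piece (side w) := by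
      have hct : Tendsto (ext (fun y => ((selfMap f)^[n] y : ℝ))) (𝓝[Icc (-1) 1] (x : ℝ))
          (𝓝 (w : ℝ)) := by
        have := ih.continuousWithinAt
        unfold ContinuousWithinAt at this
        rwa [ext_apply] at this
      have hI : ∀ z ∈ Icc (-1 : ℝ) 1, ext (fun y => ((selfMap f)^[n] y : ℝ)) z ∈
          Icc (-1 : ℝ) 1 := fun z hz => by
        rw [show z = ((⟨z, hz⟩ : I) : ℝ) from rfl, ext_apply]
        exact Subtype.prop _
      rcases lt_or_gt_of_ne hw0 with h | h
      · have hs : side w = true := by simp [side, h.le]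
        filter_upwards [hct.eventually (gt_mem_nhds h), self_mem_nhdsWithin] with z hz hzI
        rw [hs]
        exact ⟨(hI z hzI).1, hz.le⟩
      · have hs : side w = false := by simp [side, h]
        filter_upwards [hct.eventually (lt_mem_nhds h), self_mem_nhdsWithin] with z hz hzI
        rw [hs]
        exact ⟨hz.le, (hI z hzI).2⟩
    filter_upwards [hpiece, self_mem_nhdsWithin] with z hz hzI
    rw [show z = ((⟨z, hzI⟩ : I) : ℝ) from rfl, ext_apply] at hz
    rw [Function.comp_apply, show z = ((⟨z, hzI⟩ : I) : ℝ) from rfl, ext_apply, ext_apply,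
      branch_zero _ hz, iterate_succ_coe hk hf]

theorem iterDeriv_eq_prod (hk : 1 ≤ k) {f : PC k} (hf : f ∈ U k) (x : I) (n : ℕ)
    (hx : ∀ j < n, (selfMap f)^[j] x ≠ c) :
    iterDeriv f n x = ∏ j ∈ Finset.range n, slope f ((selfMap f)^[j] x) :=
  (hasDerivWithinAt_iterate hk hf x n hx).derivWithin (uniqueDiffOn_Icc (by norm_num) x x.2)

/-- For a bounded solution `α` of the twisted cohomological equation `α ∘ f = v + f' α`, the
functional `J(f, v)` vanishes exactly if `α` vanishes at the critical point. -/
theorem J_eq_zero_iff (hk : 1 ≤ k) {f : PC k} (hf : f ∈ U k) (v α : I → ℝ) {A B : ℝ}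
    (hα : ∀ x, |α x| ≤ A) (hv : ∀ x, |v x| ≤ B)
    (h : ∀ x, α (selfMap f x) = v x + slope f x * α x) : J f v = 0 ↔ α c = 0 := by
  obtain ⟨a, ha, hexp⟩ := exists_expandsBy hk hf
  set T := selfMap f with hT
  have hs : ∀ x, a ≤ |slope f x| := fun x => hexp.le_abs (mem_piece_side x)
  have hs0 : ∀ x, slope f x ≠ 0 := fun x hx => by
    have := hs x
    rw [hx, abs_zero] at this
    linarith
  let P : ℕ → ℝ := fun n => ∏ j ∈ Finset.range n, slope f (T^[j] c)
  have hP0 : ∀ n, P n ≠ 0 := fun n => Finset.prod_ne_zero_iff.2 fun j _ => hs0 _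
  have hPa : ∀ n, a ^ n ≤ |P n| := fun n => by
    rw [Finset.abs_prod]
    calc a ^ n = ∏ j ∈ Finset.range n, a := by simp
      _ ≤ _ := Finset.prod_le_prod (fun _ _ => by linarith) fun j _ => hs _
  have hPs : ∀ n, P (n + 1) = P n * slope f (T^[n] c) := fun n => Finset.prod_range_succ _ n
  let S : ℕ → ℝ := fun n => ∑ i ∈ Finset.range n, v (T^[i] c) / P (i + 1)
  -- Variation of constants along the critical orbit.
  have hS : ∀ n, α (T^[n] c) = P n * (α c + S n) := by
    intro n
    induction n with
    | zero => simp [P, S]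
    | succ n ih =>
      have e1 : S (n + 1) = S n + v (T^[n] c) / P (n + 1) := Finset.sum_range_succ _ n
      rw [Function.iterate_succ_apply', h, ih, e1, hPs n]
      field_simp [hP0 n, hs0 (T^[n] c)]
      ring
  -- The products in `J` start at `T c`, those in `P` at `c`. The discrepancy is the factor `slope f
  -- c`, which is nonzero and does not affect whether `J` vanishes.
  have hterm : ∀ n, (∀ j < n, T^[j + 1] c ≠ c) → v (T^[n] c) / iterDeriv f n (T c) =
      slope f c * (v (T^[n] c) / P (n + 1)) := by
    intro n hn
    have e1 : P (n + 1) = (∏ j ∈ Finset.range n, slope f (T^[j] (T c))) * slope f c :=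
      Finset.prod_range_succ' _ n
    rw [iterDeriv_eq_prod hk hf (T c) n (fun j hj => hn j hj), ← hT, e1]
    have h1 : (∏ j ∈ Finset.range n, slope f (T^[j] (T c))) ≠ 0 :=
      Finset.prod_ne_zero_iff.2 fun j _ => hs0 _
    field_simp [hs0 c]
  by_cases hc : c ∈ Function.periodicPts T
  · have hp := Function.minimalPeriod_pos_of_mem_periodicPts hc
    set p := Function.minimalPeriod T c with hpdef
    have hJ : J f v = slope f c * S p := by
      rw [J, if_pos hc, Finset.mul_sum]
      refine Finset.sum_congr rfl fun i hi => hterm i fun j hj hjc => ?_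
      exact Function.not_isPeriodicPt_of_pos_of_lt_minimalPeriod (Nat.succ_ne_zero j)
        (lt_of_le_of_lt hj (Finset.mem_range.1 hi)) hjc
    have hper : α c = P p * (α c + S p) := by
      rw [← hS p, hpdef, Function.iterate_minimalPeriod]
    rw [hJ, mul_eq_zero, or_iff_right (hs0 c)]
    constructor
    · intro h0
      -- If `S p = 0` then `α c = P p * α c`, and `|P p| > 1` leaves only `α c = 0`.
      rw [h0, add_zero] at hper
      have h1 : 1 < |P p| := (one_lt_pow₀ ha hp.ne').trans_le (hPa p)
      by_contra hne
      have : P p = 1 := by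
        field_simp at hper
        exact hper.symm
      rw [this, abs_one] at h1
      exact lt_irrefl _ h1
    · intro h0
      rw [h0, zero_add, eq_comm, mul_eq_zero, or_iff_right (hP0 p)] at hper
      exact hper
  · have hne : ∀ j, T^[j + 1] c ≠ c := fun j hj =>
      hc (Function.mk_mem_periodicPts (Nat.succ_pos j) hj)
    have hsum : Summable fun n => v (T^[n] c) / P (n + 1) := by
      refine Summable.of_norm_bounded (g := fun n => B * (a⁻¹) ^ n)
        ((summable_geometric_of_lt_one (by positivity) (inv_lt_one_of_one_lt₀ ha)).mul_left B)
        fun n => ?_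
      rw [norm_div, Real.norm_eq_abs, Real.norm_eq_abs, inv_pow, ← div_eq_mul_inv]
      have hB : 0 ≤ B := (abs_nonneg _).trans (hv c)
      refine div_le_div₀ hB (hv _) (by positivity) ?_
      exact (pow_le_pow_right₀ ha.le (Nat.le_succ n)).trans (hPa (n + 1))
    have hJ : J f v = slope f c * ∑' n, v (T^[n] c) / P (n + 1) := by
      rw [J, if_neg hc, ← tsum_mul_left]
      exact tsum_congr fun n => hterm n fun j _ => hne j
    -- `α` is bounded while `|P n|` grows exponentially, so dividing `hS` by `P n` gives the limit.
    have hlim : Tendsto S atTop (𝓝 (-α c)) := by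
      have h1 : Tendsto (fun n => α (T^[n] c) / P n) atTop (𝓝 0) := by
        have hA : 0 ≤ A := (abs_nonneg _).trans (hα c)
        refine squeeze_zero_norm (a := fun n => A * (a⁻¹) ^ n) (fun n => ?_) ?_
        · rw [norm_div, Real.norm_eq_abs, Real.norm_eq_abs, inv_pow, ← div_eq_mul_inv]
          exact div_le_div₀ hA (hα _) (by positivity) (hPa n)
        · simpa using (tendsto_pow_atTop_nhds_zero_of_lt_one (r := a⁻¹) (by positivity)
            (inv_lt_one_of_one_lt₀ ha)).const_mul A
      have h2 : S = fun n => α (T^[n] c) / P n - α c := by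
        funext n
        rw [hS n]
        field_simp [hP0 n]
        ring
      rw [h2]
      simpa using h1.sub_const (α c)
    rw [hJ, tendsto_nhds_unique hsum.hasSum.tendsto_sum_nat hlim, mul_eq_zero,
      or_iff_right (hs0 c), neg_eq_zero]

end Dynamics

end PEU

end

noncomputable section

namespace PEU

open Filter Topology

/-! ### From shadowing functions to topological conjugacies. -/

section Conjugacy

variable {k : ℕ}

theorem convex_piece (σ : Bool) : Convex ℝ (piece σ) := by
  cases σ <;> exact convex_Icc _ _

/-- Multiplying by `z - y` makes the inequality symmetric in the two points. This quadratic form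
records expansion and orientation together and avoids ordering the points later. -/
theorem mul_sq_le_orient_mul_of_le {σ : Bool} {a y z u v : ℝ}
    (h : a * (z - y) ≤ orient σ * (v - u)) (hyz : y ≤ z) :
    a * (z - y) ^ 2 ≤ orient σ * (v - u) * (z - y) := by
  have := mul_le_mul_of_nonneg_right h (sub_nonneg.2 hyz)
  linarith [this, pow_two (z - y), mul_assoc a (z - y) (z - y)]

theorem ExpandsBy.mul_sq_le (hk : 1 ≤ k) {a : ℝ} {f : PC k} (hf : f ∈ U k) (h : ExpandsBy a f)
    {σ : Bool} {x y : I} (hx : (x : ℝ) ∈ piece σ) (hy : (y : ℝ) ∈ piece σ) :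
    a * ((x : ℝ) - y) ^ 2 ≤
      orient σ * ((selfMap f x : ℝ) - selfMap f y) * ((x : ℝ) - y) := by
  rw [selfMap_coe hk hf, selfMap_coe hk hf]
  rcases le_total x y with hxy | hxy
  · have := mul_sq_le_orient_mul_of_le (h.le_orient_mul_sub hk hx hy hxy) hxy
    linarith
  · exact mul_sq_le_orient_mul_of_le (h.le_orient_mul_sub hk hy hx hxy) hxy

theorem branch_mul_sq_le (hk : 1 ≤ k) {g : PC k} {σ : Bool} {a η : ℝ}
    (hexp : ∀ x ∈ piece σ, ∀ y, |y - x| < η → a ≤ orient σ * branch k σ 1 y g)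
    {y z : ℝ} (hy : ∃ x ∈ piece σ, |y - x| < η) (hz : ∃ x ∈ piece σ, |z - x| < η) :
    a * (y - z) ^ 2 ≤ orient σ * (branch k σ 0 y g - branch k σ 0 z g) * (y - z) := by
  have hconv : (Metric.thickening η (piece σ)).OrdConnected :=
    ((convex_piece σ).thickening η).ordConnected
  have hmem : ∀ w, w ∈ Metric.thickening η (piece σ) ↔ ∃ x ∈ piece σ, |w - x| < η := fun w => by
    simp [Metric.mem_thickening_iff, Real.dist_eq]
  have key : ∀ y z, (∃ x ∈ piece σ, |y - x| < η) → (∃ x ∈ piece σ, |z - x| < η) → y ≤ z →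
      a * (z - y) ≤ orient σ * (branch k σ 0 z g - branch k σ 0 y g) := fun y z hy hz hyz =>
    le_orient_mul_sub_of_le_slope hk hyz fun w hw => by
      obtain ⟨x, hx, hwx⟩ := (hmem w).1 (hconv.out ((hmem y).2 hy) ((hmem z).2 hz) hw)
      exact hexp x hx w hwx
  rcases le_total y z with hyz | hyz
  · have := mul_sq_le_orient_mul_of_le (key y z hy hz hyz) hyz
    linarith
  · exact mul_sq_le_orient_mul_of_le (key z y hz hy hyz) hyz

theorem mul_abs_le_of_mul_sq_le {σ : Bool} {a X X' : ℝ}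
    (h : a * X ^ 2 ≤ orient σ * X' * X) : a * |X| ≤ |X'| := by
  have h1 : a * |X| * |X| ≤ |X'| * |X| := by
    calc a * |X| * |X| = a * X ^ 2 := by rw [mul_assoc, abs_mul_abs_self, pow_two]
      _ ≤ _ := h
      _ ≤ |orient σ * X' * X| := le_abs_self _
      _ = |X'| * |X| := by rw [abs_mul, abs_orient_mul]
  rcases (abs_nonneg X).eq_or_lt with h0 | h0
  · rw [← h0, mul_zero]; exact abs_nonneg _
  · exact le_of_mul_le_mul_right h1 h0

/-- On a common branch both maps preserve or both reverse order, so a pair that is ordered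
oppositely in the two systems stays so. -/
theorem mul_neg_of_mul_sq_le {σ : Bool} {a b X X' Y Y' : ℝ} (ha : 0 < a) (hb : 0 < b)
    (hX : a * X ^ 2 ≤ orient σ * X' * X) (hY : b * Y ^ 2 ≤ orient σ * Y' * Y)
    (h : X * Y < 0) : X' * Y' < 0 := by
  have hX0 : X ≠ 0 := fun h0 => by simp [h0] at h
  have hY0 : Y ≠ 0 := fun h0 => by simp [h0] at h
  have h1 : 0 < orient σ * X' * X := lt_of_lt_of_le (by positivity) hX
  have h2 : 0 < orient σ * Y' * Y := lt_of_lt_of_le (by positivity) hY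
  have h3 := mul_pos h1 h2
  have h4 : orient σ * X' * X * (orient σ * Y' * Y) = (X' * Y') * (X * Y) := by
    cases σ <;> simp [orient] <;> ring
  rw [h4] at h3
  exact (neg_iff_neg_of_mul_pos h3).2 h

/-- A shadowing solution `H` of `g ∘ H = H ∘ f` (with the branches of `g` extended, and chosen
according to the position with respect to `f`) is a topological conjugacy if the critical orbits
of `f` and `g` are on the same sides of `c`. -/
theorem exists_homeomorph_of_shadowing (hk : 1 ≤ k) {f g : PC k} (hf : f ∈ U k) (hg : g ∈ U k)
    {a η : ℝ} (ha : 1 < a) (H : I → ℝ)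
    (hexp : ∀ σ, ∀ x ∈ piece σ, ∀ y, |y - x| < η → a ≤ orient σ * branch k σ 1 y g)
    (hHη : ∀ x : I, |H x - x| < η)
    (hH : ∀ x, branch k (side x) 0 (H x) g = H (selfMap f x))
    (hsign : ∀ n σ, ((selfMap f)^[n] c : ℝ) ∈ piece σ ↔ ((selfMap g)^[n] c : ℝ) ∈ piece σ) :
    ∃ h : I ≃ₜ I, (∀ x, (h x : ℝ) = H x) ∧ Function.Semiconj h (selfMap f) (selfMap g) ∧
      ∀ σ (x : I), (x : ℝ) ∈ piece σ → (h x : ℝ) ∈ piece σ := by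
  obtain ⟨b, hb, hfexp⟩ := exists_expandsBy hk hf
  obtain ⟨b', hb', hgexp⟩ := exists_expandsBy hk hg
  have ha0 : 0 < a := one_pos.trans ha
  have hb0 : 0 < b := one_pos.trans hb
  have hη : 0 < η := (abs_nonneg _).trans_lt (hHη c)
  set S := selfMap f with hS
  set T := selfMap g with hT
  have habs : ∀ x : I, |(x : ℝ)| ≤ 1 := fun x => abs_le.2 x.2
  have hHb : ∀ x : I, |H x| ≤ 1 + η := fun x => by
    have h1 := abs_add_le (H x - x) x
    rw [sub_add_cancel] at h1
    linarith [hHη x, habs x]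
  have hnear : ∀ σ (x : I), (x : ℝ) ∈ piece σ → ∃ z ∈ piece σ, |H x - z| < η :=
    fun σ x hx => ⟨x, hx, hHη x⟩
  have hself : ∀ σ (x : I), (x : ℝ) ∈ piece σ → ∃ z ∈ piece σ, |(x : ℝ) - z| < η :=
    fun σ x hx => ⟨x, hx, by simpa using hη⟩
  have hgz : ∀ σ (x : I), (x : ℝ) ∈ piece σ → branch k σ 0 x g = T x := fun σ x hx => by
    rw [branch_zero x hx, hT, selfMap_coe hk hg]
  -- the critical orbit is shadowed by the critical orbit
  have horbit : ∀ n, H (S^[n] c) = T^[n] c := by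
    intro n
    refine sub_eq_zero.1 (abs_eq_zero.1 (le_antisymm ?_ (abs_nonneg _)))
    refine nonpos_of_expanding (fun _ : ℕ => True)
      (fun n => |H (S^[n] c) - T^[n] c|) ha (B := 1 + η + 1) (fun n _ => ?_) (fun n _ => ?_) trivial
    · have := abs_sub (H (S^[n] c)) (T^[n] c)
      linarith [hHb (S^[n] c), habs (T^[n] c)]
    · refine ⟨n + 1, trivial, ?_⟩
      have h1 := mem_piece_side (S^[n] c)
      have h2 := (hsign n _).1 h1
      have h3 := branch_mul_sq_le hk (hexp _) (hnear _ _ h1) (hself _ _ h2)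
      rw [hH, hgz _ _ h2] at h3
      simp only [Function.iterate_succ_apply']
      exact mul_abs_le_of_mul_sq_le h3
  have hHc : H c = 0 := horbit 0
  -- Only the point `c` belongs to both pieces; since `H c = 0`, where the two branches agree, the
  -- convention in `side` does not matter.
  have hHσ : ∀ σ (x : I), (x : ℝ) ∈ piece σ → branch k σ 0 (H x) g = H (S x) := by
    intro σ x hx
    by_cases hs : side x = σ
    · rw [← hs, hH]
    · have hxc : x = c := by
        have h1 := mem_piece_side x
        rw [← coe_eq_zero]
        revert h1 hs hx
        cases σ <;> cases side x <;> simp [piece] <;> intros <;> linarith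
      rw [hxc, ← hH, hHc]
      have h0 : ∀ σ, branch k σ 0 0 g = g c := fun σ => branch_zero c (c_mem_piece σ) g
      rw [h0, h0]
  have hpairH : ∀ σ (x y : I), (x : ℝ) ∈ piece σ → (y : ℝ) ∈ piece σ →
      a * (H x - H y) ^ 2 ≤ orient σ * (H (S x) - H (S y)) * (H x - H y) := fun σ x y hx hy => by
    have := branch_mul_sq_le hk (hexp σ) (hnear σ x hx) (hnear σ y hy)
    rwa [hHσ σ x hx, hHσ σ y hy] at this
  have hpairS : ∀ σ (x y : I), (x : ℝ) ∈ piece σ → (y : ℝ) ∈ piece σ →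
      b * ((x : ℝ) - y) ^ 2 ≤ orient σ * ((S x : ℝ) - S y) * ((x : ℝ) - y) := fun σ x y hx hy =>
    hfexp.mul_sq_le hk hf hx hy
  have hdist : ∀ x y, |H x - H y| ≤ 2 * (1 + η) := fun x y => by
    have := abs_sub (H x) (H y)
    linarith [hHb x, hHb y]
  have hnonneg : ∀ n, 0 < (S^[n] c : ℝ) → 0 < (T^[n] c : ℝ) := fun n h => by
    by_contra! h'
    exact absurd ((hsign n true).2 ⟨(T^[n] c).2.1, h'⟩).2 (not_le.2 h)
  have hnonpos : ∀ n, (S^[n] c : ℝ) < 0 → (T^[n] c : ℝ) < 0 := fun n h => by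
    by_contra! h'
    exact absurd ((hsign n false).2 ⟨h', (T^[n] c).2.2⟩).1 (not_le.2 h)
  -- Monotonicity is shown first against points of the critical orbit, whose images under `H` have
  -- known signs. If `x` and `S^[n] c` straddle `c`, then replacing `S^[n] c` by `c` keeps the order
  -- violation and enlarges the gap, and both points then lie in one piece.
  have hone : ∀ (n : ℕ) (x : I), 0 ≤ ((x : ℝ) - S^[n] c) * (H x - H (S^[n] c)) := by
    intro n x
    by_contra! hneg
    have hP := nonpos_of_expanding
      (fun p : I × ℕ => ((p.1 : ℝ) - S^[p.2] c) * (H p.1 - H (S^[p.2] c)) < 0)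
      (fun p => |H p.1 - H (S^[p.2] c)|) ha (B := 2 * (1 + η)) (fun p _ => hdist _ _)
      (by
        have hsame : ∀ (x : I) (n : ℕ) σ, (x : ℝ) ∈ piece σ → ((S^[n] c : I) : ℝ) ∈ piece σ →
            ((x : ℝ) - S^[n] c) * (H x - H (S^[n] c)) < 0 →
            ((S x : ℝ) - S^[n + 1] c) * (H (S x) - H (S^[n + 1] c)) < 0 ∧
            a * |H x - H (S^[n] c)| ≤ |H (S x) - H (S^[n + 1] c)| := by
          intro x n σ hx hn hxn
          rw [Function.iterate_succ_apply']
          exact ⟨mul_neg_of_mul_sq_le hb0 ha0 (hpairS σ _ _ hx hn) (hpairH σ _ _ hx hn) hxn,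
            mul_abs_le_of_mul_sq_le (hpairH σ _ _ hx hn)⟩
        rintro ⟨x, n⟩ hxn
        dsimp only at hxn
        rcases mem_piece_or_straddle x (S^[n] c) with ⟨σ, hx, hn⟩ | ⟨hx, hn⟩ | ⟨hn, hx⟩
        · exact ⟨(S x, n + 1), hsame x n σ hx hn hxn⟩
        · have h1 : 0 < H x - H (S^[n] c) := by
            by_contra! h'
            nlinarith
          have h2 := hnonneg n hn
          rw [horbit n] at h1
          have h3 := hsame x 0 true ⟨x.2.1, hx.le⟩ (c_mem_piece _) (by
            simp only [Function.iterate_zero, id, hHc, sub_zero]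
            rw [show (c : ℝ) = 0 from rfl, sub_zero]
            exact mul_neg_of_neg_of_pos hx (by linarith))
          refine ⟨(S x, 1), h3.1, le_trans ?_ h3.2⟩
          simp only [Function.iterate_zero, id, hHc, sub_zero, horbit n]
          rw [abs_of_pos h1, abs_of_pos (by linarith)]
          nlinarith
        · have h1 : H x - H (S^[n] c) < 0 := by
            by_contra! h'
            nlinarith
          have h2 := hnonpos n hn
          rw [horbit n] at h1
          have h3 := hsame x 0 false ⟨hx.le, x.2.2⟩ (c_mem_piece _) (by
            simp only [Function.iterate_zero, id, hHc, sub_zero]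
            rw [show (c : ℝ) = 0 from rfl, sub_zero]
            exact mul_neg_of_pos_of_neg hx (by linarith))
          refine ⟨(S x, 1), h3.1, le_trans ?_ h3.2⟩
          simp only [Function.iterate_zero, id, hHc, sub_zero, horbit n]
          rw [abs_of_neg h1, abs_of_neg (by linarith)]
          nlinarith) (x := (x, n)) hneg
    have h0 : H x - H (S^[n] c) = 0 := abs_eq_zero.1 (le_antisymm hP (abs_nonneg _))
    rw [h0, mul_zero] at hneg
    exact lt_irrefl _ hneg
  have hsgn : ∀ x : I, 0 ≤ (x : ℝ) * H x := fun x => by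
    have := hone 0 x
    simpa [hHc, show (c : ℝ) = 0 from rfl] using this
  have hneg : ∀ x : I, (x : ℝ) < 0 → H x ≤ 0 := fun x hx => by
    by_contra! h'
    nlinarith [hsgn x]
  have hpos : ∀ x : I, 0 < (x : ℝ) → 0 ≤ H x := fun x hx => by
    by_contra! h'
    nlinarith [hsgn x]
  -- A violating pair cannot straddle `c`, since `H` is now known to respect the sides of `c`; hence
  -- it can always be iterated.
  have hmono : ∀ x y : I, 0 ≤ ((x : ℝ) - y) * (H x - H y) := by
    intro x y
    by_contra! hlt
    have hP := nonpos_of_expanding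
      (fun p : I × I => ((p.1 : ℝ) - p.2) * (H p.1 - H p.2) < 0)
      (fun p => |H p.1 - H p.2|) ha (B := 2 * (1 + η)) (fun p _ => hdist _ _)
      (by
        rintro ⟨x, y⟩ hxy
        dsimp only at hxy
        rcases mem_piece_or_straddle x y with ⟨σ, hx, hy⟩ | ⟨hx, hy⟩ | ⟨hy, hx⟩
        · exact ⟨(S x, S y), mul_neg_of_mul_sq_le hb0 ha0 (hpairS σ _ _ hx hy)
            (hpairH σ _ _ hx hy) hxy, mul_abs_le_of_mul_sq_le (hpairH σ _ _ hx hy)⟩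
        · nlinarith [hneg x hx, hpos y hy]
        · nlinarith [hneg y hy, hpos x hx]) (x := (x, y)) hlt
    have h0 : H x - H y = 0 := abs_eq_zero.1 (le_antisymm hP (abs_nonneg _))
    rw [h0, mul_zero] at hlt
    exact lt_irrefl _ hlt
  have hdist' : ∀ x y : I, |(x : ℝ) - y| ≤ 2 := fun x y => by
    have := abs_sub (x : ℝ) y
    linarith [habs x, habs y]
  have hsameH : ∀ σ (x y : I), (x : ℝ) ∈ piece σ → (y : ℝ) ∈ piece σ → H x = H y →
      H (S x) = H (S y) := fun σ x y hx hy hxy => by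
    rw [← hHσ σ x hx, ← hHσ σ y hy, hxy]
  -- Again the critical orbit comes first: the case `n = 0` excludes straddling pairs in the general
  -- injectivity statement. The growth is now that of `x - y` under `S`.
  have hinjc : ∀ (x : I) (n : ℕ), H x = H (S^[n] c) → x = S^[n] c := by
    intro x n hxn
    have hP := nonpos_of_expanding (fun p : I × ℕ => H p.1 = H (S^[p.2] c))
      (fun p => |(p.1 : ℝ) - S^[p.2] c|) hb (B := 2) (fun p _ => hdist' _ _)
      (by
        rintro ⟨x, n⟩ hxn
        dsimp only at hxn
        rcases mem_piece_or_straddle x (S^[n] c) with ⟨σ, hx, hn⟩ | ⟨hx, hn⟩ | ⟨hn, hx⟩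
        · refine ⟨(S x, n + 1), ?_, ?_⟩
          · dsimp only
            rw [Function.iterate_succ_apply']
            exact hsameH σ _ _ hx hn hxn
          · dsimp only
            rw [Function.iterate_succ_apply']
            exact mul_abs_le_of_mul_sq_le (hpairS σ _ _ hx hn)
        · rw [horbit n] at hxn
          linarith [hneg x hx, hnonneg n hn]
        · rw [horbit n] at hxn
          linarith [hpos x hx, hnonpos n hn]) (x := (x, n)) hxn
    exact Subtype.ext (sub_eq_zero.1 (abs_eq_zero.1 (le_antisymm hP (abs_nonneg _))))
  have hzero : ∀ x, H x = 0 → x = c := fun x hx => hinjc x 0 (hx.trans hHc.symm)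
  have hinj : ∀ x y, H x = H y → x = y := by
    intro x y hxy
    have hP := nonpos_of_expanding (fun p : I × I => H p.1 = H p.2)
      (fun p => |(p.1 : ℝ) - p.2|) hb (B := 2) (fun p _ => hdist' _ _)
      (by
        rintro ⟨x, y⟩ hxy
        dsimp only at hxy
        rcases mem_piece_or_straddle x y with ⟨σ, hx, hy⟩ | ⟨hx, hy⟩ | ⟨hy, hx⟩
        · exact ⟨(S x, S y), hsameH σ _ _ hx hy hxy,
            mul_abs_le_of_mul_sq_le (hpairS σ _ _ hx hy)⟩
        · have h1 := hneg x hx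
          have h2 := hpos y hy
          exact absurd (coe_eq_zero.2 (hzero x (by linarith))) hx.ne
        · have h1 := hneg y hy
          have h2 := hpos x hx
          exact absurd (coe_eq_zero.2 (hzero y (by linarith))) hy.ne) (x := (x, y)) hxy
    exact Subtype.ext (sub_eq_zero.1 (abs_eq_zero.1 (le_antisymm hP (abs_nonneg _))))
  have hleft_mem : ((left : I) : ℝ) ∈ piece true := ⟨le_rfl, by norm_num [left]⟩
  have hright_mem : ((right : I) : ℝ) ∈ piece false := ⟨by norm_num [right], le_rfl⟩
  -- Expansion near the piece forbids two distinct points whose images are no farther apart. This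
  -- pins `H` at the fixed point `-1` and then at its preimage `1`.
  have hfix : ∀ {σ : Bool} {y z : ℝ}, (∃ x ∈ piece σ, |y - x| < η) → (∃ x ∈ piece σ, |z - x| < η) →
      |branch k σ 0 y g - branch k σ 0 z g| ≤ |y - z| → y = z := fun {σ y z} hy hz hyz => by
    have h1 := mul_abs_le_of_mul_sq_le (branch_mul_sq_le hk (hexp σ) hy hz)
    have h2 : |y - z| ≤ 0 := by nlinarith [abs_nonneg (y - z)]
    exact sub_eq_zero.1 (abs_eq_zero.1 (le_antisymm h2 (abs_nonneg _)))
  have hSl : S left = left := Subtype.ext ((selfMap_coe hk hf left).trans hf.1.1)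
  have hTl : T left = left := Subtype.ext ((selfMap_coe hk hg left).trans hg.1.1)
  have hSr : S right = left := Subtype.ext ((selfMap_coe hk hf right).trans hf.1.2)
  have hTr : T right = left := Subtype.ext ((selfMap_coe hk hg right).trans hg.1.2)
  have hHl : H left = left := hfix (hnear _ _ hleft_mem) (hself _ _ hleft_mem) (by
    rw [hHσ _ _ hleft_mem, hgz _ _ hleft_mem, hSl, hTl])
  have hHr : H right = right := hfix (hnear _ _ hright_mem) (hself _ _ hright_mem) (by
    rw [hHσ _ _ hright_mem, hgz _ _ hright_mem, hSr, hTr, hHl, sub_self, abs_zero]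
    exact abs_nonneg _)
  have hle : ∀ x y : I, x ≤ y → H x ≤ H y := fun x y hxy => by
    rcases (show (x : ℝ) ≤ y from hxy).eq_or_lt with h | h
    · rw [Subtype.ext h]
    · by_contra! h'
      nlinarith [hmono x y]
  have hHI : ∀ x, H x ∈ Icc (-1 : ℝ) 1 := fun x =>
    ⟨hHl.ge.trans (hle left x x.2.1), (hle x right x.2.2).trans hHr.le⟩
  let φ : I → I := fun x => ⟨H x, hHI x⟩
  have hφ : StrictMono φ := fun x y hxy =>
    lt_of_le_of_ne (hle x y hxy.le) fun h => hxy.ne (hinj x y (congrArg Subtype.val h))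
  have hφc : φ c = c := Subtype.ext hHc
  have hφpiece : ∀ σ (x : I), (x : ℝ) ∈ piece σ → (φ x : ℝ) ∈ piece σ := by
    intro σ x hx
    cases σ
    · exact ⟨hHc.ge.trans (hle c x hx.1), (φ x).2.2⟩
    · exact ⟨(φ x).2.1, (hle x c hx.2).trans hHc.le⟩
  have hsemi : Function.Semiconj φ S T := fun x => by
    have h1 := hφpiece _ x (mem_piece_side x)
    exact Subtype.ext ((hH x).symm.trans (hgz _ (φ x) h1))
  have : Nontrivial I := ⟨left, right, fun h => by
    have := congrArg Subtype.val h
    norm_num [left, right] at this⟩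
  have : PreconnectedSpace I := Subtype.preconnectedSpace isPreconnected_Icc
  -- A gap `(u, v)` of the range lies on one side of `c = φ c`, and its image under `T` is a longer
  -- gap. Indeed, a value `φ w` between `T u` and `T v` lies below `T c`, so it lifts along the same
  -- branch in both systems, to a value of `φ` between `u` and `v`.
  have hdense : Dense (range φ) := by
    refine dense_of_exists_between fun {u v} huv => ?_
    by_contra! hno
    have hP := nonpos_of_expanding
      (fun p : I × I => ∀ x, 0 ≤ ((φ x : ℝ) - p.1) * ((φ x : ℝ) - p.2))
      (fun p => |(p.1 : ℝ) - p.2|) hb' (B := 2) (fun p _ => hdist' _ _)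
      (by
        rintro ⟨u, v⟩ huv
        dsimp only at huv
        have hc := huv c
        rw [hφc, show (c : ℝ) = 0 from rfl] at hc
        rcases mem_piece_or_straddle u v with ⟨σ, hu, hv⟩ | ⟨hu, hv⟩ | ⟨hv, hu⟩
        · refine ⟨(T u, T v), fun w => ?_,
            mul_abs_le_of_mul_sq_le (hgexp.mul_sq_le hk hg hu hv)⟩
          dsimp only
          by_contra! hw
          have hwc : φ w ≤ T c := by
            by_contra! hw'
            have h1 : (T c : ℝ) < φ w := hw'
            have h2 : (T u : ℝ) ≤ T c := selfMap_le_selfMap_c hk hg u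
            have h3 : (T v : ℝ) ≤ T c := selfMap_le_selfMap_c hk hg v
            nlinarith
          obtain ⟨z, hz, hzw⟩ := exists_preimage_mem_piece hk hg σ hwc
          have hwc' : w ≤ S c := by
            rw [← hφ.le_iff_le, hsemi c, hφc]
            exact hwc
          obtain ⟨x, hx, hxw⟩ := exists_preimage_mem_piece hk hf σ hwc'
          have hxz : φ x = z := by
            refine eq_of_selfMap_eq_of_mem hk hg (hφpiece σ x hx) hz ?_
            rw [hzw, ← hxw]
            exact (hsemi x).symm
          have h1 := hgexp.mul_sq_le hk hg hz hu
          have h2 := hgexp.mul_sq_le hk hg hz hv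
          rw [hzw] at h1 h2
          have hzu : (z : ℝ) - u ≠ 0 := fun h0 => by
            have : z = u := Subtype.ext (sub_eq_zero.1 h0)
            rw [← hzw, this, hT, sub_self, zero_mul] at hw
            exact lt_irrefl _ hw
          have hzv : (z : ℝ) - v ≠ 0 := fun h0 => by
            have : z = v := Subtype.ext (sub_eq_zero.1 h0)
            rw [← hzw, this, hT, sub_self, mul_zero] at hw
            exact lt_irrefl _ hw
          have hb0' : 0 < b' := by linarith
          have h3 : 0 < orient σ * ((φ w : ℝ) - T u) * ((z : ℝ) - u) :=
            lt_of_lt_of_le (by positivity) h1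
          have h4 : 0 < orient σ * ((φ w : ℝ) - T v) * ((z : ℝ) - v) :=
            lt_of_lt_of_le (by positivity) h2
          have h5 : orient σ * ((φ w : ℝ) - T u) * ((z : ℝ) - u) *
              (orient σ * ((φ w : ℝ) - T v) * ((z : ℝ) - v)) =
              (((φ w : ℝ) - T u) * ((φ w : ℝ) - T v)) * (((z : ℝ) - u) * ((z : ℝ) - v)) := by
            cases σ <;> simp [orient] <;> ring
          have h6 := mul_pos h3 h4
          rw [h5] at h6
          have h7 := (neg_iff_neg_of_mul_pos h6).1 hw
          rw [← hxz] at h7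
          exact absurd (huv x) (not_le.2 h7)
        · nlinarith
        · nlinarith) (x := (u, v)) (fun x => by
          dsimp only
          by_contra! hx
          have huv' : (u : ℝ) < v := huv
          have h1 : u < φ x := by
            change (u : ℝ) < φ x
            by_contra! h'
            nlinarith
          have h2 : φ x < v := by
            change (φ x : ℝ) < v
            by_contra! h'
            nlinarith
          exact hno (φ x) ⟨x, rfl⟩ ⟨h1, h2⟩)
    have h0 : (u : ℝ) = v := sub_eq_zero.1 (abs_eq_zero.1 (le_antisymm hP (abs_nonneg _)))
    exact huv.ne (Subtype.ext h0)
  have hcont : Continuous φ := hφ.monotone.continuous_of_denseRange hdense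
  have hsurj : Function.Surjective φ := fun y =>
    mem_range_of_exists_le_of_exists_ge hcont ⟨left, by
      rw [show φ left = left from Subtype.ext hHl]; exact y.2.1⟩ ⟨right, by
      rw [show φ right = right from Subtype.ext hHr]; exact y.2.2⟩
  exact ⟨(hφ.orderIsoOfSurjective φ hsurj).toHomeomorph, fun x => rfl, hsemi, hφpiece⟩

end Conjugacy

end PEU

end

noncomputable section

namespace PEU

open Filter Topology BoundedContinuousFunction

/-! ### Iterated derivatives of curves in normed spaces. -/

section IteratedDerivatives

variable {E F : Type} [NormedAddCommGroup E] [NormedSpace ℝ E] [NormedAddCommGroup F]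
  [NormedSpace ℝ F]

theorem contDiffOn_iteratedDeriv {J : Set ℝ} (hJ : IsOpen J) (j : ℕ) : ∀ {m : ℕ} {f : ℝ → E},
    ContDiffOn ℝ (m + j : ℕ) f J → ContDiffOn ℝ m (iteratedDeriv j f) J := by
  induction j with
  | zero => intro m f hf; simpa using hf
  | succ j ih =>
    intro m f hf
    have h1 : ContDiffOn ℝ ((m : WithTop ℕ∞) + 1) (iteratedDeriv j f) J := by
      have := ih (m := m + 1) (by rwa [show m + 1 + j = m + (j + 1) by ring])
      exact_mod_cast this
    rw [iteratedDeriv_succ]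
    exact ((contDiffOn_succ_iff_deriv_of_isOpen hJ).1 h1).2.2

theorem contDiffOn_iteratedDeriv_of_le {J : Set ℝ} (hJ : IsOpen J) {n m j : ℕ} (h : m + j ≤ n)
    {f : ℝ → E} (hf : ContDiffOn ℝ n f J) : ContDiffOn ℝ m (iteratedDeriv j f) J :=
  contDiffOn_iteratedDeriv hJ j (hf.of_le (by exact_mod_cast h))

theorem hasDerivAt_iteratedDeriv {J : Set ℝ} (hJ : IsOpen J) {n j : ℕ} (h : j < n)
    {f : ℝ → E} (hf : ContDiffOn ℝ n f J) {t : ℝ} (ht : t ∈ J) :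
    HasDerivAt (iteratedDeriv j f) (iteratedDeriv (j + 1) f t) t := by
  have h1 : ContDiffOn ℝ (1 : ℕ) (iteratedDeriv j f) J :=
    contDiffOn_iteratedDeriv_of_le hJ (by omega) hf
  rw [iteratedDeriv_succ]
  exact ((h1.differentiableOn (by simp)).differentiableAt (hJ.mem_nhds ht)).hasDerivAt

theorem iteratedDeriv_clm_comp {J : Set ℝ} (hJ : IsOpen J) (L : E →L[ℝ] F) {n : ℕ}
    {f : ℝ → E} (hf : ContDiffOn ℝ n f J) {j : ℕ} (hj : j ≤ n) :
    ∀ t ∈ J, iteratedDeriv j (fun s => L (f s)) t = L (iteratedDeriv j f t) := by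
  induction j with
  | zero => intro t _; simp
  | succ j ih =>
    intro t ht
    have h1 : iteratedDeriv j (fun s => L (f s)) =ᶠ[𝓝 t] fun s => L (iteratedDeriv j f s) := by
      filter_upwards [hJ.mem_nhds ht] with s hs
      exact ih (by omega) s hs
    rw [iteratedDeriv_succ, h1.deriv_eq]
    exact (L.hasFDerivAt.comp_hasDerivAt t
      (hasDerivAt_iteratedDeriv hJ (by omega : j < n) hf ht)).deriv

end IteratedDerivatives

/-! ### The smooth family of shadowing functions and conjugacies. -/

section ShadowingFamily

/-- The interval `I` with the discrete topology, so that all bounded functions on it form a Banach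
space. -/
def DiscreteI : Type := I

instance : TopologicalSpace DiscreteI := ⊥

instance : DiscreteTopology DiscreteI := ⟨rfl⟩

variable {k : ℕ}

/-- The implicit function argument takes data smooth for all times. Composing with `ρ` keeps the
parameter inside `(-δ, δ)` and changes nothing for small `t`. -/
theorem exists_reparametrization {δ : ℝ} (hδ : 0 < δ) : ∃ ρ : ℝ → ℝ, ContDiff ℝ (⊤ : ℕ∞) ρ ∧
    (∀ t, ρ t ∈ Ioo (-δ) δ) ∧ ∀ t ∈ Ioo (-(δ / 3)) (δ / 3), ρ t = t := by
  let b : ContDiffBump (0 : ℝ) := ⟨δ / 3, δ / 2, by positivity, by linarith⟩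
  refine ⟨fun t => b t * t, b.contDiff.mul contDiff_id, fun t => ?_, fun t ht => ?_⟩
  · change b t * t ∈ Ioo (-δ) δ
    rw [mem_Ioo, ← abs_lt, abs_mul, abs_of_nonneg b.nonneg]
    by_cases ht : |t| < δ / 2
    · calc b t * |t| ≤ 1 * |t| := by gcongr; exact b.le_one
        _ < δ := by linarith
    · rw [b.zero_of_le_dist (by rw [Real.dist_0_eq_abs]; exact not_lt.1 ht), zero_mul]
      exact hδ
  · change b t * t = t
    rw [b.one_of_mem_closedBall (by
      rw [mem_closedBall_zero_iff, Real.norm_eq_abs]; exact (abs_lt.2 ht).le), one_mul]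

/-- For each family there are bounded functions `H t`, depending on `t` in a `C^k` way, that
semiconjugate `f 0` to the extended branches of `f t`. -/
theorem exists_shadowing_family (hk : 1 ≤ k) {δ : ℝ} (hδ : 0 < δ) {f : ℝ → PC k}
    (hf : IsFamily k δ f) : ∃ ε > 0, ε ≤ δ ∧ ∃ H : ℝ → (DiscreteI →ᵇ ℝ),
      (∀ x : I, H 0 x = x) ∧ ContDiffOn ℝ k H (Ioo (-ε) ε) ∧
      ∀ t ∈ Ioo (-ε) ε, ∀ x : I,
        branch k (side x) 0 (H t x) (f t) = H t (selfMap (f 0) x) := by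
  obtain ⟨ρ, hρ, hρI, hρid⟩ := exists_reparametrization hδ
  have h0 : (0 : ℝ) ∈ Ioo (-δ) δ := ⟨by linarith, hδ⟩
  have hρ0 : ρ 0 = 0 := hρid 0 ⟨by linarith, by linarith⟩
  obtain ⟨a, ha, hexp⟩ := exists_expandsBy hk (hf.2 0 h0)
  have hfρ : ContDiffOn ℝ k (f ∘ ρ) univ :=
    hf.1.comp (hρ.of_le (by exact_mod_cast le_top)).contDiffOn fun t _ => hρI t
  have hg : ∀ σ, ContDiff ℝ k (fun z : ℝ × ℝ => branch k σ 0 z.2 (f (ρ z.1))) := fun σ => by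
    have := contDiffOn_branch σ isOpen_univ (m := k) (i := 0) (by omega) hfρ
    rwa [univ_prod_univ, contDiffOn_univ] at this
  have hder : ∀ σ (y : ℝ), deriv (fun y => branch k σ 0 y (f (ρ 0))) y = branch k σ 1 y (f 0) :=
    fun σ y => by
      rw [hρ0]
      exact (hasDerivAt_branch σ (by omega) (f 0) y).deriv
  let h₀ : DiscreteI →ᵇ ℝ := ofNormedAddCommGroupDiscrete (fun x : I => (x : ℝ)) 1
    (fun x : I => abs_le.2 x.2)
  have heq : ∀ σ (x : I), side x = σ → branch k σ 0 x (f (ρ 0)) = selfMap (f 0) x :=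
    fun σ x hx => by
      rw [hρ0, branch_zero x (hx ▸ mem_piece_side x), selfMap_coe hk (hf.2 0 h0)]
  obtain ⟨ε, hε, H, hH0, hHc, hHe⟩ := exists_contDiffOn_solution (X := DiscreteI) hk
    (selfMap (f 0)) {x : I | side x = true}
    (fun z => branch k true 0 z.2 (f (ρ z.1))) (fun z => branch k false 0 z.2 (f (ρ z.1)))
    (hg true) (hg false) h₀
    (fun x hx => heq true x hx) (fun x hx => heq false x (Bool.eq_false_iff.2 hx))
    ha
    (fun x hx => by
      rw [show (fun y => branch k true 0 ((0 : ℝ), y).2 (f (ρ ((0 : ℝ), y).1))) =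
        fun y => branch k true 0 y (f (ρ 0)) from rfl, hder]
      have h1 : side (x : I) = true := hx
      exact hexp.le_abs (h1 ▸ mem_piece_side (x : I)))
    (fun x hx => by
      rw [show (fun y => branch k false 0 ((0 : ℝ), y).2 (f (ρ ((0 : ℝ), y).1))) =
        fun y => branch k false 0 y (f (ρ 0)) from rfl, hder]
      have h1 : side (x : I) = false := Bool.eq_false_iff.2 hx
      exact hexp.le_abs (h1 ▸ mem_piece_side (x : I)))
  have hε' : min ε (δ / 3) ≤ δ := (min_le_right _ _).trans (by linarith)
  have hsub : Ioo (-(min ε (δ / 3))) (min ε (δ / 3)) ⊆ Ioo (-ε) ε :=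
    Ioo_subset_Ioo (neg_le_neg (min_le_left _ _)) (min_le_left _ _)
  refine ⟨min ε (δ / 3), lt_min hε (by linarith), hε', H, fun x => by rw [hH0]; rfl,
    hHc.mono hsub, fun t ht x => ?_⟩
  have hρt : ρ t = t := hρid t
    (Ioo_subset_Ioo (neg_le_neg (min_le_right _ _)) (min_le_right _ _) ht)
  have h1 := hHe t (hsub ht)
  cases hs : side x
  · have h2 : branch k false 0 (H t x) (f (ρ t)) = H t (selfMap (f 0) x) := h1.2 x
      (fun h3 : side x = true => by rw [hs] at h3; exact Bool.false_ne_true h3)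
    rwa [hρt] at h2
  · have h2 : branch k true 0 (H t x) (f (ρ t)) = H t (selfMap (f 0) x) := h1.1 x hs
    rwa [hρt] at h2

theorem continuous_apply : Continuous fun p : PC k × I => p.1 p.2 := by
  have h : (fun p : PC k × I => p.1 p.2) = fun p : PC k × I =>
      if (p.2 : ℝ) ≤ 0 then branch k true 0 p.2 p.1 else branch k false 0 p.2 p.1 := by
    funext p
    split_ifs with hp
    · rw [branch_zero (σ := true) p.2 ⟨p.2.2.1, hp⟩]
    · rw [branch_zero (σ := false) p.2 ⟨(not_le.1 hp).le, p.2.2.2⟩]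
  rw [h]
  have hp : Continuous fun p : PC k × I => (p.1, (p.2 : ℝ)) :=
    continuous_fst.prodMk (continuous_subtype_val.comp continuous_snd)
  have hc : ∀ σ, Continuous fun p : PC k × I => branch k σ 0 p.2 p.1 := fun σ => by
    have h1 := (continuous_branch (k := k) σ 0).comp hp
    exact h1
  refine Continuous.if_le (hc true) (hc false) (continuous_subtype_val.comp continuous_snd)
    continuous_const fun p hp => ?_
  have hp' : (p.2 : ℝ) = 0 := hp
  rw [hp', show (0 : ℝ) = ((c : I) : ℝ) from rfl, branch_zero c (c_mem_piece _),
    branch_zero c (c_mem_piece _)]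

theorem continuousOn_selfMap_iterate {J : Set ℝ} {f : ℝ → PC k} (hf : ContinuousOn f J) (n : ℕ) :
    ContinuousOn (fun t => (selfMap (f t))^[n] c) J := by
  induction n with
  | zero => exact continuousOn_const
  | succ n ih =>
    simp_rw [Function.iterate_succ_apply']
    exact continuous_projIcc.comp_continuousOn
      (continuous_apply.comp_continuousOn (hf.prodMk ih))

/-- The relation `(0, n)` says that `f_t^n(c) = c`. As it does not depend on `t`, the continuous
function `t ↦ f_t^n(c)` vanishes always or never, and so keeps its sign. The construction of
conjugacies uses no other critical relations. -/
theorem mem_piece_iterate_iff {ε : ℝ} {f : ℝ → PC k}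
    (hf : ContinuousOn f (Ioo (-ε) ε))
    (hA : ∀ t ∈ Ioo (-ε) ε, criticalRelations (f t) = criticalRelations (f 0))
    {t : ℝ} (ht : t ∈ Ioo (-ε) ε) (n : ℕ) (σ : Bool) :
    ((selfMap (f 0))^[n] c : ℝ) ∈ piece σ ↔ ((selfMap (f t))^[n] c : ℝ) ∈ piece σ := by
  have hε : 0 < ε := by linarith [ht.1, ht.2]
  have h0 : (0 : ℝ) ∈ Ioo (-ε) ε := ⟨by linarith, hε⟩
  rcases Nat.eq_zero_or_pos n with rfl | hn
  · rfl
  have hz : ∀ s ∈ Ioo (-ε) ε, (selfMap (f s))^[n] c = c ↔ (selfMap (f 0))^[n] c = c := by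
    intro s hs
    have h1 : ∀ g : PC k, (0, n) ∈ criticalRelations g ↔ (selfMap g)^[n] c = c := fun g =>
      ⟨fun h => h.1.symm, fun h => ⟨h.symm, hn⟩⟩
    rw [← h1, ← h1, hA s hs]
  by_cases hc : (selfMap (f 0))^[n] c = c
  · rw [hc, (hz t ht).2 hc]
  set ψ : ℝ → ℝ := fun s => ((selfMap (f s))^[n] c : ℝ) with hψ
  have hcont : ContinuousOn ψ (Ioo (-ε) ε) :=
    continuous_subtype_val.comp_continuousOn (continuousOn_selfMap_iterate hf n)
  have hne : ∀ s ∈ Ioo (-ε) ε, ψ s ≠ 0 := fun s hs h => hc ((hz s hs).1 (coe_eq_zero.1 h))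
  have hsign : ∀ s ∈ Ioo (-ε) ε, ∀ r ∈ Ioo (-ε) ε, ψ s < 0 → ψ r < 0 := by
    intro s hs r hr hs0
    by_contra! hr0
    obtain ⟨w, hw, hw0⟩ := isPreconnected_Ioo.intermediate_value hs hr hcont ⟨hs0.le, hr0⟩
    exact hne w hw hw0
  have hiff : ψ 0 < 0 ↔ ψ t < 0 := ⟨hsign 0 h0 t ht, hsign t ht 0 h0⟩
  have h0' := hne 0 h0
  have ht' := hne t ht
  have hb0 := ((selfMap (f 0))^[n] c).2
  have hbt := ((selfMap (f t))^[n] c).2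
  change ψ 0 ∈ piece σ ↔ ψ t ∈ piece σ
  cases σ
  · have e : ∀ r : ℝ, r ∈ Icc (-1 : ℝ) 1 → r ≠ 0 → (r ∈ piece false ↔ ¬ r < 0) := fun r hr hr0 =>
      ⟨fun h => not_lt.2 h.1, fun h => ⟨not_lt.1 h, hr.2⟩⟩
    rw [e _ hb0 h0', e _ hbt ht', hiff]
  · have e : ∀ r : ℝ, r ∈ Icc (-1 : ℝ) 1 → r ≠ 0 → (r ∈ piece true ↔ r < 0) := fun r hr hr0 =>
      ⟨fun h => lt_of_le_of_ne h.2 hr0, fun h => ⟨hr.1, h.le⟩⟩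
    rw [e _ hb0 h0', e _ hbt ht', hiff]

theorem exists_norm_iteratedDeriv_le {E : Type} [NormedAddCommGroup E] [NormedSpace ℝ E]
    {ε₀ : ℝ} {H : ℝ → E} {n : ℕ} (hH : ContDiffOn ℝ n H (Ioo (-ε₀) ε₀))
    {ε : ℝ} (hε : ε < ε₀) :
    ∃ K, ∀ j ≤ n, ∀ t ∈ Ioo (-ε) ε, ‖iteratedDeriv j H t‖ ≤ K := by
  have h1 : ∀ j, ∃ K, 0 ≤ K ∧ (j ≤ n → ∀ t ∈ Ioo (-ε) ε, ‖iteratedDeriv j H t‖ ≤ K) := by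
    intro j
    by_cases hj : j ≤ n
    · have hc : ContinuousOn (iteratedDeriv j H) (Icc (-ε) ε) :=
        (contDiffOn_iteratedDeriv_of_le (m := 0) isOpen_Ioo (by omega) hH).continuousOn.mono
          (Icc_subset_Ioo (by linarith) hε)
      obtain ⟨K, hK⟩ := isCompact_Icc.exists_bound_of_continuousOn hc
      exact ⟨max K 0, le_max_right _ _, fun _ t ht =>
        (hK t (Ioo_subset_Icc_self ht)).trans (le_max_left _ _)⟩
    · exact ⟨0, le_rfl, fun h => absurd h hj⟩
  choose K hK0 hK using h1
  refine ⟨∑ j ∈ Finset.range (n + 1), K j, fun j hj t ht => (hK j hj t ht).trans ?_⟩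
  exact Finset.single_le_sum (f := K) (fun i _ => hK0 i)
    (Finset.mem_range.2 (Nat.lt_succ_of_le hj))

/-- If the critical relations do not change, the shadowing functions are conjugacies. -/
theorem exists_conjugacy_family (hk : 1 ≤ k) {δ : ℝ} {f : ℝ → PC k}
    (hf : IsFamily k δ f) (hA : CondA δ f) :
    ∃ ε > 0, ε ≤ δ ∧ ∃ (H : ℝ → (DiscreteI →ᵇ ℝ)) (h : ℝ → (I ≃ₜ I)),
      ContDiffOn ℝ k H (Ioo (-ε) ε) ∧
      (∃ K, ∀ j ≤ k, ∀ t ∈ Ioo (-ε) ε, ‖iteratedDeriv j H t‖ ≤ K) ∧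
      ∀ t ∈ Ioo (-ε) ε, (∀ x : I, (h t x : ℝ) = H t x) ∧
        Function.Semiconj (h t) (selfMap (f 0)) (selfMap (f t)) ∧
        (∀ σ (x : I), (x : ℝ) ∈ piece σ → H t x ∈ piece σ) ∧
        ∀ x : I, branch k (side x) 0 (H t x) (f t) = H t (selfMap (f 0) x) := by
  obtain ⟨εA, hεA, hεAδ, hA⟩ := hA
  have hδ : 0 < δ := hεA.trans_le hεAδ
  have h0 : (0 : ℝ) ∈ Ioo (-δ) δ := ⟨by linarith, hδ⟩
  obtain ⟨ε₁, hε₁, hε₁δ, H, hH0, hHc, hHe⟩ := exists_shadowing_family hk hδ hf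
  obtain ⟨a, ha, hexp⟩ := exists_expandsBy hk (hf.2 0 h0)
  obtain ⟨b, hb1, hba⟩ := exists_between ha
  obtain ⟨η, hη, hnb⟩ := exists_expanding_neighbourhood hexp hba
  have hfc : ContinuousOn f (Ioo (-δ) δ) := hf.1.continuousOn
  have e1 : ∀ᶠ t in 𝓝 (0 : ℝ), ‖f t - f 0‖ < η := by
    have := (hfc.continuousAt (isOpen_Ioo.mem_nhds h0)).eventually (Metric.ball_mem_nhds _ hη)
    filter_upwards [this] with t ht
    rwa [← dist_eq_norm]
  have e2 : ∀ᶠ t in 𝓝 (0 : ℝ), ‖H t - H 0‖ < η := by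
    have := (hHc.continuousOn.continuousAt (isOpen_Ioo.mem_nhds ⟨by linarith, hε₁⟩)).eventually
      (Metric.ball_mem_nhds (H 0) hη)
    filter_upwards [this] with t ht
    rwa [← dist_eq_norm]
  obtain ⟨ε₂, hε₂, hball⟩ := Metric.eventually_nhds_iff_ball.1 (e1.and e2)
  rw [Real.ball_zero_eq_Ioo] at hball
  -- Halving `ε₁` puts the closed interval inside the domain of `H`, so that the derivatives of `H`
  -- are bounded.
  let ε := min (min εA ε₂) (ε₁ / 2)
  have hεpos : 0 < ε := lt_min (lt_min hεA hε₂) (by linarith)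
  have hsub : ∀ {r : ℝ}, ε ≤ r → Ioo (-ε) ε ⊆ Ioo (-r) r := fun h =>
    Ioo_subset_Ioo (neg_le_neg h) h
  have hεA' : ε ≤ εA := (min_le_left _ _).trans (min_le_left _ _)
  have hε₂' : ε ≤ ε₂ := (min_le_left _ _).trans (min_le_right _ _)
  have hε₁' : ε < ε₁ := (min_le_right _ _).trans_lt (by linarith)
  have hex : ∀ t, ∃ h : I ≃ₜ I, t ∈ Ioo (-ε) ε → (∀ x : I, (h x : ℝ) = H t x) ∧
      Function.Semiconj h (selfMap (f 0)) (selfMap (f t)) ∧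
      (∀ σ (x : I), (x : ℝ) ∈ piece σ → H t x ∈ piece σ) := by
    intro t
    by_cases ht : t ∈ Ioo (-ε) ε
    · have hb := hball t (hsub hε₂' ht)
      obtain ⟨h, h1, h2, h3⟩ := exists_homeomorph_of_shadowing hk (hf.2 0 h0)
        (hf.2 t (hsub (hεA'.trans hεAδ) ht)) hb1 (H t) (hnb (f t) hb.1)
        (fun x => by
          have h4 : |H t x - H 0 x| ≤ ‖H t - H 0‖ :=
            (H t - H 0).norm_coe_le_norm (x : DiscreteI)
          rw [hH0 x] at h4
          exact h4.trans_lt hb.2)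
        (hHe t (hsub hε₁'.le ht))
        (fun n σ => mem_piece_iterate_iff (hfc.mono (Ioo_subset_Ioo (neg_le_neg hεAδ) hεAδ)) hA
          (hsub hεA' ht) n σ)
      exact ⟨h, fun _ => ⟨h1, h2, fun σ x hx => by rw [← h1]; exact h3 σ x hx⟩⟩
    · exact ⟨Homeomorph.refl I, fun h => absurd h ht⟩
  choose h hh using hex
  exact ⟨ε, hεpos, hεA'.trans hεAδ, H, h, hHc.mono (hsub hε₁'.le),
    exists_norm_iteratedDeriv_le hHc hε₁', fun t ht => ⟨(hh t ht).1, (hh t ht).2.1, (hh t ht).2.2,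
      hHe t (hsub hε₁'.le ht)⟩⟩

end ShadowingFamily

end PEU

end

noncomputable section

namespace PEU

open Filter Topology BoundedContinuousFunction

/-! ### Quantitative bounds for the derivatives of conjugacies in `t`. -/

section DerivativeBounds

variable {k : ℕ}

/-- Growth of the constants in the bounds for derivatives of `t ↦ φ (t, y t)`. -/
def growth (B : ℝ) : ℕ → ℝ
  | 0 => 1
  | i + 1 => growth B i * (1 + 2 ^ i * B)

theorem one_le_growth {B : ℝ} (hB : 0 ≤ B) (i : ℕ) : 1 ≤ growth B i := by
  induction i with
  | zero => exact le_rfl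
  | succ i ih =>
    have : 0 ≤ 2 ^ i * B := by positivity
    exact one_le_mul_of_one_le_of_one_le ih (by linarith)

theorem growth_mono {B : ℝ} (hB : 0 ≤ B) : Monotone (growth B) :=
  monotone_nat_of_le_succ fun i => by
    have : 0 ≤ 2 ^ i * B := by positivity
    exact le_mul_of_one_le_right (by linarith [one_le_growth hB i]) (by linarith)

theorem contDiffOn_branch_comp (σ : Bool) {J : Set ℝ} (hJ : IsOpen J) {f : ℝ → PC k}
    (hf : ContDiffOn ℝ k f J) {y : ℝ → ℝ} (hy : ContDiffOn ℝ k y J) {i a b : ℕ}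
    (ha : a + i ≤ k) (hb : b + i ≤ k) :
    ContDiffOn ℝ i (fun s => branch k σ b (y s) (iteratedDeriv a f s)) J := by
  have h1 := contDiffOn_branch σ hJ hb
    (contDiffOn_iteratedDeriv_of_le hJ (by omega : i + a ≤ k) hf)
  have h2 : ContDiffOn ℝ i (fun s => (s, y s)) J :=
    contDiffOn_id.prodMk (hy.of_le (by exact_mod_cast (by omega : i ≤ k)))
  have hmaps : MapsTo (fun s => (s, y s)) J (J ×ˢ univ) := fun s hs => ⟨hs, trivial⟩
  have h3 := h1.comp h2 hmaps
  exact h3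

/-- One chain rule followed by the Leibniz formula. The terms are again of the same type, with `a`
or `b` raised by one and fewer derivatives outside, which makes the estimates recursive. -/
theorem iteratedDeriv_succ_branch_comp (σ : Bool) {J : Set ℝ} (hJ : IsOpen J) {f : ℝ → PC k}
    (hf : ContDiffOn ℝ k f J) {y : ℝ → ℝ} (hy : ContDiffOn ℝ k y J) {i a b : ℕ}
    (ha : a + (i + 1) ≤ k) (hb : b + (i + 1) ≤ k) {t : ℝ} (ht : t ∈ J) :
    iteratedDeriv (i + 1) (fun s => branch k σ b (y s) (iteratedDeriv a f s)) t =
      iteratedDeriv i (fun s => branch k σ b (y s) (iteratedDeriv (a + 1) f s)) t +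
      ∑ j ∈ Finset.range (i + 1), (i.choose j : ℝ) *
        iteratedDeriv j (fun s => branch k σ (b + 1) (y s) (iteratedDeriv a f s)) t *
        iteratedDeriv (i - j + 1) y t := by
  have h1 : deriv (fun s => branch k σ b (y s) (iteratedDeriv a f s)) =ᶠ[𝓝 t] fun s =>
      branch k σ b (y s) (iteratedDeriv (a + 1) f s) +
        branch k σ (b + 1) (y s) (iteratedDeriv a f s) * deriv y s := by
    filter_upwards [hJ.mem_nhds ht] with s hs
    have hfa : ContDiffOn ℝ (1 : ℕ) (iteratedDeriv a f) J :=
      contDiffOn_iteratedDeriv_of_le hJ (by omega) hf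
    have hys : HasDerivAt y (deriv y s) s := ((hy.differentiableOn (by
      have : k ≠ 0 := by omega
      exact_mod_cast this)).differentiableAt (hJ.mem_nhds hs)).hasDerivAt
    rw [iteratedDeriv_succ]
    exact (hasDerivAt_branch_comp σ hJ (by exact_mod_cast hfa) (by omega) hs hys).deriv
  have hc : ∀ a b, a + i ≤ k → b + i ≤ k →
      ContDiffAt ℝ i (fun s => branch k σ b (y s) (iteratedDeriv a f s)) t := fun a b ha hb =>
    (contDiffOn_branch_comp σ hJ hf hy ha hb).contDiffAt (hJ.mem_nhds ht)
  have hd : ContDiffAt ℝ i (deriv y) t := by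
    have := contDiffOn_iteratedDeriv_of_le hJ (by omega : i + 1 ≤ k) hy
    rw [iteratedDeriv_one] at this
    exact this.contDiffAt (hJ.mem_nhds ht)
  rw [iteratedDeriv_succ', h1.iteratedDeriv_eq, iteratedDeriv_fun_add
    (hc _ _ (by omega) (by omega)) ((hc _ _ (by omega) (by omega)).mul hd),
    iteratedDeriv_fun_mul (hc _ _ (by omega) (by omega)) hd]
  simp_rw [iteratedDeriv_succ']

/-- A derivative of order `j` carries the weight `2 * j - 1`, which truncated subtraction makes `0`
for `j = 0`. For `j ≤ i` the two weights add up to `2 * i`, except for `j = 0`, where they give `2 *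
i + 1`. -/
theorem abs_choose_mul_le {i j e : ℕ} {B G N M p q : ℝ} (hM : 1 ≤ M) (hB : 0 ≤ B) (hG : 0 ≤ G)
    (hN : 0 ≤ N) (hp : |p| ≤ G * N * M ^ (2 * j - 1)) (hq : |q| ≤ B * M ^ (2 * (i - j + 1) - 1))
    (he : (2 * j - 1) + (2 * (i - j + 1) - 1) ≤ e) :
    |(i.choose j : ℝ) * p * q| ≤ (i.choose j : ℝ) * (G * N * B * M ^ e) := by
  have hM0 : 0 ≤ M := by linarith
  rw [mul_assoc, abs_mul, abs_mul, abs_of_nonneg (Nat.cast_nonneg (i.choose j) : (0 : ℝ) ≤ _)]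
  refine mul_le_mul_of_nonneg_left ?_ (Nat.cast_nonneg _)
  calc |p| * |q| ≤ (G * N * M ^ (2 * j - 1)) * (B * M ^ (2 * (i - j + 1) - 1)) := by gcongr
    _ = G * N * B * M ^ ((2 * j - 1) + (2 * (i - j + 1) - 1)) := by rw [pow_add]; ring
    _ ≤ _ := by gcongr

theorem abs_iteratedDeriv_branch_comp_le (σ : Bool) {J : Set ℝ} (hJ : IsOpen J) {f : ℝ → PC k}
    (hf : ContDiffOn ℝ k f J) {y : ℝ → ℝ} (hy : ContDiffOn ℝ k y J) {t : ℝ} (ht : t ∈ J)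
    {N M B : ℝ} (hM : 1 ≤ M) (hB : 0 ≤ B)
    (hN : ∀ a ≤ k, ∀ b ≤ k, |branch k σ b (y t) (iteratedDeriv a f t)| ≤ N) (i : ℕ) :
    (∀ j, 1 ≤ j → j ≤ i → |iteratedDeriv j y t| ≤ B * M ^ (2 * j - 1)) →
    ∀ a b, a + i ≤ k → b + i ≤ k →
      |iteratedDeriv i (fun s => branch k σ b (y s) (iteratedDeriv a f s)) t| ≤
        growth B i * N * M ^ (2 * i - 1) := by
  have hN0 : 0 ≤ N := (abs_nonneg _).trans (hN 0 (Nat.zero_le k) 0 (Nat.zero_le k))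
  have hM0 : 0 ≤ M := by linarith
  induction i using Nat.strong_induction_on with
  | _ i ih =>
    intro hyb a b ha hb
    rcases i with _ | i
    · simpa [growth] using hN a (by omega) b (by omega)
    · rw [iteratedDeriv_succ_branch_comp σ hJ hf hy ha hb ht]
      have hg := one_le_growth hB i
      have h1 := ih i (by omega) (fun j hj hji => hyb j hj (by omega)) (a + 1) b (by omega)
        (by omega)
      have h2 : ∀ j ∈ Finset.range (i + 1), |(i.choose j : ℝ) *
          iteratedDeriv j (fun s => branch k σ (b + 1) (y s) (iteratedDeriv a f s)) t *
          iteratedDeriv (i - j + 1) y t| ≤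
          (i.choose j : ℝ) * (growth B i * N * B * M ^ (2 * (i + 1) - 1)) := fun j hj => by
        have hj' : j ≤ i := Nat.lt_succ_iff.1 (Finset.mem_range.1 hj)
        refine abs_choose_mul_le hM hB (by linarith) hN0 ?_ (hyb _ (by omega) (by omega))
          (by omega)
        refine (ih j (by omega) (fun l hl hlj => hyb l hl (by omega)) a (b + 1) (by omega)
          (by omega)).trans ?_
        gcongr
        exact growth_mono hB hj'
      calc _ ≤ growth B i * N * M ^ (2 * i - 1) + ∑ j ∈ Finset.range (i + 1),
            (i.choose j : ℝ) * (growth B i * N * B * M ^ (2 * (i + 1) - 1)) :=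
            (abs_add_le _ _).trans (add_le_add h1
              ((Finset.abs_sum_le_sum_abs _ _).trans (Finset.sum_le_sum h2)))
        _ = growth B i * N * M ^ (2 * i - 1) +
            2 ^ i * (growth B i * N * B * M ^ (2 * (i + 1) - 1)) := by
            rw [← Finset.sum_mul, ← Nat.cast_sum, Nat.sum_range_choose]; norm_num
        _ ≤ growth B i * N * M ^ (2 * (i + 1) - 1) +
            2 ^ i * (growth B i * N * B * M ^ (2 * (i + 1) - 1)) := by
            gcongr
            omega
        _ = _ := by rw [growth]; ring

/-- The subtracted product is the Leibniz term `j = 0`, the only one with the top derivative of `y`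
and the only one of weight `2 * m + 1`. The rest has weight at most `2 * m`; the factor `N` later
supplies one more power of `M`. -/
theorem abs_iteratedDeriv_succ_branch_comp_sub_le (σ : Bool) {J : Set ℝ} (hJ : IsOpen J)
    {f : ℝ → PC k} (hf : ContDiffOn ℝ k f J) {y : ℝ → ℝ} (hy : ContDiffOn ℝ k y J) {t : ℝ}
    (ht : t ∈ J) {N M B : ℝ} (hM : 1 ≤ M) (hB : 0 ≤ B)
    (hN : ∀ a ≤ k, ∀ b ≤ k, |branch k σ b (y t) (iteratedDeriv a f t)| ≤ N) {m : ℕ}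
    (hm : m + 1 ≤ k) (hyb : ∀ j, 1 ≤ j → j ≤ m → |iteratedDeriv j y t| ≤ B * M ^ (2 * j - 1)) :
    |iteratedDeriv (m + 1) (fun s => branch k σ 0 (y s) (f s)) t -
      branch k σ 1 (y t) (f t) * iteratedDeriv (m + 1) y t| ≤
        growth B (m + 1) * N * M ^ (2 * m) := by
  have hN0 : 0 ≤ N := (abs_nonneg _).trans (hN 0 (Nat.zero_le k) 0 (Nat.zero_le k))
  have hM0 : 0 ≤ M := by linarith
  have hg := one_le_growth hB m
  have h0 := iteratedDeriv_succ_branch_comp σ hJ hf hy (a := 0) (b := 0) (i := m) (by omega)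
    (by omega) ht
  have hbd := fun i (hi : i ≤ m) => abs_iteratedDeriv_branch_comp_le σ hJ hf hy ht hM hB hN i
    (fun j hj hji => hyb j hj (by omega))
  rw [Finset.sum_range_succ'] at h0
  simp only [iteratedDeriv_zero, Nat.choose_zero_right, Nat.cast_one, one_mul, zero_add,
    Nat.sub_zero] at h0
  have h1 := hbd m le_rfl 1 0 (by omega) (by omega)
  have h2 : ∀ j ∈ Finset.range m, |(m.choose (j + 1) : ℝ) *
      iteratedDeriv (j + 1) (fun s => branch k σ 1 (y s) (f s)) t *
      iteratedDeriv (m - (j + 1) + 1) y t| ≤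
      (m.choose (j + 1) : ℝ) * (growth B m * N * B * M ^ (2 * m)) := fun j hj => by
    have hj' : j < m := Finset.mem_range.1 hj
    refine abs_choose_mul_le hM hB (by linarith) hN0 ?_ (hyb _ (by omega) (by omega)) (by omega)
    have := hbd (j + 1) hj' 0 1 (by omega) (by omega)
    simp only [iteratedDeriv_zero] at this
    refine this.trans ?_
    gcongr
    exact growth_mono hB hj'
  have h3 : ∑ j ∈ Finset.range m, (m.choose (j + 1) : ℝ) ≤ 2 ^ m := by
    have h4 : ∑ j ∈ Finset.range (m + 1), (m.choose j : ℝ) = 2 ^ m := by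
      rw [← Nat.cast_sum, Nat.sum_range_choose]; norm_num
    rw [Finset.sum_range_succ'] at h4
    have : (0 : ℝ) ≤ (m.choose 0 : ℝ) := Nat.cast_nonneg _
    linarith
  rw [h0, add_sub_assoc, add_sub_cancel_right]
  calc _ ≤ growth B m * N * M ^ (2 * m - 1) + ∑ j ∈ Finset.range m,
        (m.choose (j + 1) : ℝ) * (growth B m * N * B * M ^ (2 * m)) :=
        (abs_add_le _ _).trans (add_le_add h1
          ((Finset.abs_sum_le_sum_abs _ _).trans (Finset.sum_le_sum h2)))
    _ ≤ growth B m * N * M ^ (2 * m) + 2 ^ m * (growth B m * N * B * M ^ (2 * m)) := by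
        rw [← Finset.sum_mul]
        gcongr
        omega
    _ = _ := by rw [growth]; ring

/-- Taking the supremum over `x` gives `l ‖u‖ ≤ ‖u‖ + R`. This absorbs the value at the image point
in an expanding equation. -/
theorem norm_mul_le_of_forall_mul_le {X : Type} [TopologicalSpace X] (u : X →ᵇ ℝ) {l R : ℝ}
    (hl : 1 < l) (hR : 0 ≤ R) (h : ∀ x, l * |u x| ≤ ‖u‖ + R) : ‖u‖ * (l - 1) ≤ R := by
  have h1 : ‖u‖ ≤ (‖u‖ + R) / l := (norm_le (by positivity)).2 fun x => by
    rw [le_div_iff₀ (by linarith), mul_comm, Real.norm_eq_abs]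
    exact h x
  rw [le_div_iff₀ (by linarith)] at h1
  linarith

/-- Constants for the bounds on `∂_t^j h_t`, `1 ≤ j ≤ n`. -/
def derivConst : ℕ → ℝ
  | 0 => 0
  | m + 1 => derivConst m + growth (derivConst m) (m + 1)

theorem derivConst_nonneg (n : ℕ) : 0 ≤ derivConst n := by
  induction n with
  | zero => exact le_rfl
  | succ m ih => exact add_nonneg ih (by linarith [one_le_growth ih (m + 1)])

/-- Evaluation at a point of `I` of a bounded function. -/
def evalI (x : I) : (DiscreteI →ᵇ ℝ) →L[ℝ] ℝ :=
  BoundedContinuousFunction.evalCLM (α := DiscreteI) ℝ x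

theorem abs_apply_le (u : DiscreteI →ᵇ ℝ) (x : I) : |u x| ≤ ‖u‖ :=
  BoundedContinuousFunction.norm_coe_le_norm (α := DiscreteI) u x

variable {J : Set ℝ} {f : ℝ → PC k} {H : ℝ → (DiscreteI →ᵇ ℝ)} {T : I → I}

theorem iteratedDeriv_apply (hJ : IsOpen J) (hH : ContDiffOn ℝ k H J) {j : ℕ} (hj : j ≤ k)
    {t : ℝ} (ht : t ∈ J) (x : I) :
    iteratedDeriv j (fun s => H s x) t = iteratedDeriv j H t x :=
  by
  have := iteratedDeriv_clm_comp hJ (evalI x) hH hj t ht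
  exact this

theorem contDiffOn_apply (hH : ContDiffOn ℝ k H J) (x : I) :
    ContDiffOn ℝ k (fun s => H s x) J :=
  (evalI x).contDiff.comp_contDiffOn hH

theorem one_sub_inv_expansion_pos (hk : 1 ≤ k) {g : PC k} (hg : g ∈ U k) :
    0 < 1 - (expansion g)⁻¹ :=
  sub_pos.2 (inv_lt_one_of_one_lt₀ (one_lt_expansion hk hg))

/-- Differentiating the conjugacy equation `m + 1` times gives `l |u x| ≤ |u (T x)| + R` for the top
derivative `u`, with `R` controlled by lower orders and `N = M (1 - l⁻¹)`. Since `(1 - l⁻¹) / (l -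
1) = l⁻¹ ≤ 1`, dividing by `l - 1` costs nothing beyond the factor `M`, whence the exponent `2 * j -
1`. -/
theorem norm_iteratedDeriv_le (hk : 1 ≤ k) (hJ : IsOpen J) (hf : ContDiffOn ℝ k f J)
    (hH : ContDiffOn ℝ k H J)
    (heq : ∀ t ∈ J, ∀ x : I, branch k (side x) 0 (H t x) (f t) = H t (T x))
    {t : ℝ} (ht : t ∈ J) (hft : f t ∈ U k) (hpiece : ∀ x : I, H t x ∈ piece (side x))
    {M : ℝ} (hM1 : 1 ≤ M)
    (hM : ∀ j ≤ k, ‖iteratedDeriv j f t‖ / (1 - (expansion (f t))⁻¹) ≤ M) (n : ℕ) (hn : n ≤ k) :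
    ∀ j, 1 ≤ j → j ≤ n → ‖iteratedDeriv j H t‖ ≤ derivConst n * M ^ (2 * j - 1) := by
  have hl := one_lt_expansion hk hft
  have hq := one_sub_inv_expansion_pos hk hft
  set l := expansion (f t) with hldef
  have hM0 : 0 ≤ M := by linarith
  induction n with
  | zero => intro j hj hj'; omega
  | succ m ih =>
    have ih := ih (by omega)
    have hB := derivConst_nonneg m
    have hgr := one_le_growth hB (m + 1)
    intro j hj hjm
    rcases Nat.lt_or_ge m j with hmj | hmj
    · obtain rfl : j = m + 1 := by omega
      have hN : ∀ (x : I), ∀ a ≤ k, ∀ b ≤ k,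
          |branch k (side x) b (H t x) (iteratedDeriv a f t)| ≤ M * (1 - l⁻¹) :=
        fun x a ha b hb => (abs_branch_le hb (hpiece x) _).trans ((div_le_iff₀ hq).1 (hM a ha))
      have hx : ∀ x : I, l * |iteratedDeriv (m + 1) H t x| ≤ ‖iteratedDeriv (m + 1) H t‖ +
          growth (derivConst m) (m + 1) * (M * (1 - l⁻¹)) * M ^ (2 * m) := by
        intro x
        have h1 := abs_iteratedDeriv_succ_branch_comp_sub_le (side x) hJ hf
          (contDiffOn_apply hH x) ht hM1 hB (hN x) hn (fun j hj hjm => by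
            rw [iteratedDeriv_apply hJ hH (by omega) ht x]
            exact (abs_apply_le _ x).trans (ih j hj hjm))
        have h2 : (fun s => branch k (side x) 0 (H s x) (f s)) =ᶠ[𝓝 t] fun s => H s (T x) := by
          filter_upwards [hJ.mem_nhds ht] with s hs
          exact heq s hs x
        rw [h2.iteratedDeriv_eq, iteratedDeriv_apply hJ hH hn ht,
          iteratedDeriv_apply hJ hH hn ht] at h1
        have h3 := abs_apply_le (iteratedDeriv (m + 1) H t) (T x)
        have h4 : l * |iteratedDeriv (m + 1) H t x| ≤
            |branch k (side x) 1 (H t x) (f t) * iteratedDeriv (m + 1) H t x| := by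
          rw [abs_mul]
          exact mul_le_mul_of_nonneg_right (expansion_le hk _ (hpiece x)) (abs_nonneg _)
        have h5 := abs_sub_abs_le_abs_sub
          (branch k (side x) 1 (H t x) (f t) * iteratedDeriv (m + 1) H t x)
          (iteratedDeriv (m + 1) H t (T x))
        rw [abs_sub_comm] at h5
        linarith
      have h6 := norm_mul_le_of_forall_mul_le (X := DiscreteI) _ hl
        (by have := hq.le; positivity) hx
      have h7 : growth (derivConst m) (m + 1) * (M * (1 - l⁻¹)) * M ^ (2 * m) =
          growth (derivConst m) (m + 1) * M ^ (2 * (m + 1) - 1) * l⁻¹ * (l - 1) := by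
        rw [show 2 * (m + 1) - 1 = 2 * m + 1 by omega, pow_succ]
        have : l ≠ 0 := by linarith
        field_simp
      rw [h7] at h6
      have h8 := le_of_mul_le_mul_right h6 (by linarith)
      have h9 : growth (derivConst m) (m + 1) * M ^ (2 * (m + 1) - 1) * l⁻¹ ≤
          growth (derivConst m) (m + 1) * M ^ (2 * (m + 1) - 1) :=
        mul_le_of_le_one_right (by positivity) (inv_le_one_of_one_le₀ hl.le)
      refine h8.trans (h9.trans ?_)
      gcongr
      exact le_add_of_nonneg_left hB
    · refine (ih j hj hmj).trans ?_
      gcongr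
      exact le_add_of_nonneg_right (by linarith)

theorem hasDerivAt_shadow (hk : 1 ≤ k) (hJ : IsOpen J) (hH : ContDiffOn ℝ k H J) {t : ℝ}
    (ht : t ∈ J) (x : I) : HasDerivAt (fun s => H s x) (deriv H t x) t := by
  have h1 : HasDerivAt H (deriv H t) t := ((hH.differentiableOn (by
    have : k ≠ 0 := by omega
    exact_mod_cast this)).differentiableAt (hJ.mem_nhds ht)).hasDerivAt
  exact (evalI x).hasFDerivAt.comp_hasDerivAt t h1

/-- The derivative of the conjugacy equation in `t`: the twisted cohomological equation for `f t`,
pulled back by `H t`. -/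
theorem deriv_shadow_eq (hk : 1 ≤ k) (hJ : IsOpen J) (hf : ContDiffOn ℝ k f J)
    (hH : ContDiffOn ℝ k H J)
    (heq : ∀ t ∈ J, ∀ x : I, branch k (side x) 0 (H t x) (f t) = H t (T x))
    {t : ℝ} (ht : t ∈ J) (x : I) :
    deriv H t (T x) = branch k (side x) 0 (H t x) (deriv f t) +
      branch k (side x) 1 (H t x) (f t) * deriv H t x := by
  have h1 := hasDerivAt_branch_comp (side x) hJ (hf.of_le (by exact_mod_cast hk)) (i := 0)
    (by omega) ht (hasDerivAt_shadow hk hJ hH ht x)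
  have h2 : (fun s => branch k (side x) 0 (H s x) (f s)) =ᶠ[𝓝 t] fun s => H s (T x) := by
    filter_upwards [hJ.mem_nhds ht] with s hs
    exact heq s hs x
  exact ((hasDerivAt_shadow hk hJ hH ht (T x)).congr_of_eventuallyEq h2).unique h1

theorem norm_deriv_shadow_le (hk : 1 ≤ k) (hJ : IsOpen J) (hf : ContDiffOn ℝ k f J)
    (hH : ContDiffOn ℝ k H J)
    (heq : ∀ t ∈ J, ∀ x : I, branch k (side x) 0 (H t x) (f t) = H t (T x))
    {t : ℝ} (ht : t ∈ J) (hft : f t ∈ U k) (hpiece : ∀ x : I, H t x ∈ piece (side x)) {M : ℝ}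
    (hM : ∀ y : I, |(deriv f t : PC k) y| / (1 - (expansion (f t))⁻¹) ≤ M) :
    ‖deriv H t‖ ≤ M := by
  have hl := one_lt_expansion hk hft
  have hq := one_sub_inv_expansion_pos hk hft
  set l := expansion (f t) with hldef
  have hM0 : 0 ≤ M := (div_nonneg (abs_nonneg _) hq.le).trans (hM c)
  have hx : ∀ x : I, l * |deriv H t x| ≤ ‖deriv H t‖ + M * (1 - l⁻¹) := fun x => by
    have h1 := deriv_shadow_eq hk hJ hf hH heq ht x
    have h2 : |branch k (side x) 0 (H t x) (deriv f t)| ≤ M * (1 - l⁻¹) := by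
      have := branch_zero ⟨H t x, piece_subset _ (hpiece x)⟩ (hpiece x) (deriv f t)
      rw [this]
      exact (div_le_iff₀ hq).1 (hM _)
    have h3 : |deriv H t (T x)| ≤ ‖deriv H t‖ := abs_apply_le _ _
    have h4 : l * |deriv H t x| ≤ |branch k (side x) 1 (H t x) (f t) * deriv H t x| := by
      rw [abs_mul]
      exact mul_le_mul_of_nonneg_right (expansion_le hk _ (hpiece x)) (abs_nonneg _)
    have h5 : branch k (side x) 1 (H t x) (f t) * deriv H t x =
      deriv H t (T x) - branch k (side x) 0 (H t x) (deriv f t) := by linarith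
    rw [h5] at h4
    linarith [abs_sub (deriv H t (T x)) (branch k (side x) 0 (H t x) (deriv f t))]
  have h6 := norm_mul_le_of_forall_mul_le (X := DiscreteI) _ hl (by have := hq.le; positivity) hx
  have h7 : M * (1 - l⁻¹) = M * l⁻¹ * (l - 1) := by
    have : l ≠ 0 := by linarith
    field_simp
  rw [h7] at h6
  exact (le_of_mul_le_mul_right h6 (by linarith)).trans
    (mul_le_of_le_one_right hM0 (inv_le_one_of_one_le₀ hl.le))

end DerivativeBounds

end PEU

end

noncomputable section

namespace PEU

open Filter Topology BoundedContinuousFunction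

/-! ### The equivalence of A, B and C, and the implication to D. -/

section Conclusions

variable {k : ℕ} {δ : ℝ} {f : ℝ → PC k}

theorem condA_of_condB (hk : 1 ≤ k) (hf : IsFamily k δ f) (hB : CondB δ f) : CondA δ f := by
  obtain ⟨ε, hε, hεδ, h⟩ := hB
  refine ⟨ε, hε, hεδ, fun t ht => ?_⟩
  obtain ⟨φ, hφ⟩ := h t ht
  have hsub : Ioo (-ε) ε ⊆ Ioo (-δ) δ := Ioo_subset_Ioo (neg_le_neg hεδ) hεδ
  exact criticalRelations_eq_of_semiconj hk (hf.2 0 (hsub ⟨by linarith, hε⟩)) (hf.2 t (hsub ht))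
    φ.toEquiv hφ

theorem condB_of_condC {C : ℝ} (hC : CondC δ f C) : CondB δ f := by
  obtain ⟨ε, hε, hεδ, h, hh, _⟩ := hC
  exact ⟨ε, hε, hεδ, fun t ht => ⟨h t, hh t ht⟩⟩

/-- The mean value inequality for `L ∘ iteratedDeriv m H`. A general functional `L` covers both
evaluations, for boundedness, and differences of two evaluations, for the diameter. -/
theorem abs_iteratedDeriv_clm_sub_le {ε : ℝ} {H : ℝ → (DiscreteI →ᵇ ℝ)}
    (L : (DiscreteI →ᵇ ℝ) →L[ℝ] ℝ) {m : ℕ} (hH : ContDiffOn ℝ (m + 1 : ℕ) H (Ioo (-ε) ε))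
    {g : ℝ → ℝ} (hg : ∀ t ∈ Ioo (-ε) ε, g t = L (H t)) {S : Set ℝ} (hS : Convex ℝ S)
    (hSJ : S ⊆ Ioo (-ε) ε) {r : ℝ} (hr : ∀ t ∈ S, |L (iteratedDeriv (m + 1) H t)| ≤ r)
    {s t : ℝ} (hs : s ∈ S) (ht : t ∈ S) :
    |iteratedDeriv m g s - iteratedDeriv m g t| ≤ r * |s - t| := by
  have heq : ∀ t ∈ Ioo (-ε) ε, iteratedDeriv m g t = L (iteratedDeriv m H t) := fun t ht => by
    have h1 : g =ᶠ[𝓝 t] fun s => L (H s) := by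
      filter_upwards [isOpen_Ioo.mem_nhds ht] with s hs
      exact hg s hs
    rw [h1.iteratedDeriv_eq]
    exact iteratedDeriv_clm_comp isOpen_Ioo L hH (Nat.le_succ m) t ht
  rw [heq s (hSJ hs), heq t (hSJ ht)]
  exact hS.norm_image_sub_le_of_norm_hasDerivWithin_le
    (f := fun t => L (iteratedDeriv m H t)) (f' := fun t => L (iteratedDeriv (m + 1) H t))
    (fun w hw => (L.hasFDerivAt.comp_hasDerivAt w (hasDerivAt_iteratedDeriv isOpen_Ioo
      (Nat.lt_succ_self m) hH (hSJ hw))).hasDerivWithinAt) hr ht hs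

theorem cLipNormLE_of_clm (hk : 1 ≤ k) {ε : ℝ} {H : ℝ → (DiscreteI →ᵇ ℝ)}
    (hH : ContDiffOn ℝ k H (Ioo (-ε) ε)) (L : (DiscreteI →ᵇ ℝ) →L[ℝ] ℝ) {g : ℝ → ℝ}
    (hg : ∀ t ∈ Ioo (-ε) ε, g t = L (H t)) {a b r : ℝ} (hab : Icc a b ⊆ Ioo (-ε) ε)
    (hr : ∀ i ≤ k, ∀ t ∈ Icc a b, |L (iteratedDeriv i H t)| ≤ r) :
    CLipNormLE (k - 1) g a b r := by
  obtain ⟨m, rfl⟩ : ∃ m, k = m + 1 := ⟨k - 1, by omega⟩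
  rw [Nat.add_sub_cancel]
  refine ⟨fun i hi t ht => ?_, fun s hs t ht => abs_iteratedDeriv_clm_sub_le L hH hg
    (convex_Icc a b) hab (hr (m + 1) le_rfl) hs ht⟩
  have h1 : g =ᶠ[𝓝 t] fun s => L (H s) := by
    filter_upwards [isOpen_Ioo.mem_nhds (hab ht)] with s hs
    exact hg s hs
  rw [h1.iteratedDeriv_eq, iteratedDeriv_clm_comp isOpen_Ioo L hH (by omega) t (hab ht)]
  exact hr i (by omega) t ht

/-- The constant in the bound for the diameter of `{t ↦ h_t(x)}`. -/
def diamConst (k : ℕ) : ℝ := 2 * derivConst k + 2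

theorem condC_of_condA (hk : 1 ≤ k) (hf : IsFamily k δ f) (hA : CondA δ f) :
    CondC δ f (diamConst k) := by
  obtain ⟨ε, hε, hεδ, H, h, hH, ⟨K, hK⟩, hh⟩ := exists_conjugacy_family hk hf hA
  have hJ : IsOpen (Ioo (-ε) ε) := isOpen_Ioo
  have hsub : Ioo (-ε) ε ⊆ Ioo (-δ) δ := Ioo_subset_Ioo (neg_le_neg hεδ) hεδ
  have hfε : ContDiffOn ℝ k f (Ioo (-ε) ε) := hf.1.mono hsub
  have hU : ∀ t ∈ Ioo (-ε) ε, f t ∈ U k := fun t ht => hf.2 t (hsub ht)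
  have heq := fun t ht => (hh t ht).2.2.2
  have hpiece : ∀ t ∈ Ioo (-ε) ε, ∀ x : I, H t x ∈ piece (side x) := fun t ht x =>
    (hh t ht).2.2.1 _ x (mem_piece_side x)
  have hL : ∀ x : I, ∀ t ∈ Ioo (-ε) ε, (h t x : ℝ) = evalI x (H t) := fun x t ht =>
    (hh t ht).1 x
  have hLD : ∀ x y : I, ∀ t ∈ Ioo (-ε) ε,
      (h t x : ℝ) - (h t y : ℝ) = (evalI x - evalI y) (H t) := fun x y t ht => by
    rw [hL x t ht, hL y t ht]; rfl
  have hK0 : ∀ (x : I), ∀ i ≤ k, ∀ t ∈ Ioo (-ε) ε, |evalI x (iteratedDeriv i H t)| ≤ K :=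
    fun x i hi t ht => (abs_apply_le _ x).trans (hK i hi t ht)
  refine ⟨ε, hε, hεδ, h, fun t ht => (hh t ht).2.1, ?_, fun x => ⟨?_, ?_⟩, fun a b ha hab hb => ?_⟩
  · rintro ⟨x, t⟩ ⟨-, ht⟩
    have hHt : ContinuousAt H t := hH.continuousOn.continuousAt (hJ.mem_nhds ht)
    rw [ContinuousWithinAt, tendsto_subtype_rng]
    -- Joint continuity splits into continuity of the single map `h t` and uniform convergence of
    -- `H` as time tends to `t`.
    have h1 : Tendsto (fun p : I × ℝ => ((h t p.1 : ℝ) - h t x) + (H p.2 - H t) p.1)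
        (𝓝 (x, t)) (𝓝 (0 + 0)) := by
      refine Tendsto.add ?_ (squeeze_zero_norm (fun p => abs_apply_le (H p.2 - H t) p.1) ?_)
      · have : Continuous fun p : I × ℝ => (h t p.1 : ℝ) - h t x :=
          (continuous_subtype_val.comp ((h t).continuous.comp continuous_fst)).sub continuous_const
        simpa using this.tendsto (x, t)
      · have h2 : ContinuousAt (fun p : I × ℝ => ‖H p.2 - H t‖) (x, t) :=
          ((hHt.comp_of_eq continuous_snd.continuousAt rfl).sub continuousAt_const).norm
        simpa [ContinuousAt] using h2
    have h3 := (h1.add_const (h t x : ℝ)).mono_left (nhdsWithin_le_nhds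
      (s := univ ×ˢ Ioo (-ε) ε))
    rw [add_zero, zero_add] at h3
    refine h3.congr' ?_
    filter_upwards [self_mem_nhdsWithin] with p hp
    have e1 := hL p.1 p.2 hp.2
    have e2 := hL p.1 t ht
    have e3 : (H p.2 - H t) p.1 = evalI p.1 (H p.2) - evalI p.1 (H t) := rfl
    rw [e3, ← e1, ← e2]
    ring
  · exact ((contDiffOn_apply hH x).of_le (by exact_mod_cast Nat.sub_le k 1)).congr (hL x)
  · obtain ⟨m, rfl⟩ : ∃ m, k = m + 1 := ⟨k - 1, by omega⟩
    refine ⟨K.toNNReal, LipschitzOnWith.of_dist_le_mul fun s hs t ht => ?_⟩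
    rw [Real.dist_eq, Real.dist_eq]
    refine (abs_iteratedDeriv_clm_sub_le (evalI x) hH (hL x) (convex_Ioo _ _) Subset.rfl
      (hK0 x (m + 1) le_rfl) hs ht).trans ?_
    gcongr
    exact Real.le_coe_toNNReal K
  have hIcc : Icc a b ⊆ Ioo (-ε) ε := Icc_subset_Ioo ha hb
  refine ⟨⟨K, fun x => cLipNormLE_of_clm hk hH (evalI x) (hL x) hIcc
    fun i hi t ht => hK0 x i hi t (hIcc ht)⟩, fun M hM x y => ?_, fun M hM x s hs t ht => ?_⟩
  -- The case `j = 0` of the hypothesis suffices: `‖f a‖ ≥ |f a left| = 1`, and the denominator is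
  -- less than `1`.
  · have hM1 : 1 ≤ M := by
      have haI : a ∈ Icc a b := left_mem_Icc.2 hab
      have h1 := hM a haI 0 (Nat.zero_le k)
      have hUa := hU a (hIcc haI)
      have hq := one_sub_inv_expansion_pos hk hUa
      have h2 : 1 ≤ ‖f a‖ := by
        have := abs_apply_le_norm (f a) left
        rwa [hUa.1.1, abs_neg, abs_one] at this
      rw [iteratedDeriv_zero, div_le_iff₀ hq] at h1
      have h3 : 0 < (expansion (f a))⁻¹ := inv_pos.2 (by linarith [one_lt_expansion hk hUa])
      by_contra! hlt
      nlinarith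
    have hB := derivConst_nonneg k
    have hMk : 1 ≤ M ^ (2 * k - 1) := one_le_pow₀ hM1
    refine cLipNormLE_of_clm hk hH (evalI x - evalI y) (hLD x y) hIcc fun i hi t ht => ?_
    rcases Nat.eq_zero_or_pos i with rfl | hi0
    -- Order zero is bounded by the length `2` of `I`, which explains the summand `2` in
    -- `diamConst`.
    · rw [iteratedDeriv_zero, ← hLD x y t (hIcc ht)]
      have h1 := abs_le.2 (h t x).2
      have h2 := abs_le.2 (h t y).2
      refine (abs_sub _ _).trans ((add_le_add h1 h2).trans ?_)
      rw [diamConst]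
      nlinarith
    · have h1 := norm_iteratedDeriv_le hk hJ hfε hH heq (hIcc ht) (hU t (hIcc ht))
        (hpiece t (hIcc ht)) hM1 (hM t ht) k le_rfl i hi0 hi
      have h2 : derivConst k * M ^ (2 * i - 1) ≤ derivConst k * M ^ (2 * k - 1) := by
        gcongr
      have h3 : (evalI x - evalI y) (iteratedDeriv i H t) =
        iteratedDeriv i H t x - iteratedDeriv i H t y := rfl
      rw [h3]
      refine (abs_sub _ _).trans ?_
      rw [diamConst]
      linarith [abs_apply_le (iteratedDeriv i H t) x, abs_apply_le (iteratedDeriv i H t) y]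
  · have h1 : ContDiffOn ℝ (0 + 1 : ℕ) H (Ioo (-ε) ε) := hH.of_le (by exact_mod_cast hk)
    have h2 := abs_iteratedDeriv_clm_sub_le (evalI x) h1 (hL x) (convex_Icc a b) hIcc (r := M)
      (fun t ht => by
        rw [zero_add, iteratedDeriv_one]
        exact (abs_apply_le _ x).trans (norm_deriv_shadow_le hk hJ hfε hH heq (hIcc ht)
          (hU t (hIcc ht)) (hpiece t (hIcc ht)) (hM t ht))) hs ht
    simpa only [iteratedDeriv_zero] using h2

/-- The velocity `∂_t h_t ∘ h_t⁻¹` is a bounded solution of the twisted equation, and it vanishes at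
`c` because every `h_t` fixes `c`. -/
theorem condD_of_condA (hk : 1 ≤ k) (hf : IsFamily k δ f) (hA : CondA δ f) : CondD δ f := by
  obtain ⟨ε, hε, hεδ, H, h, hH, -, hh⟩ := exists_conjugacy_family hk hf hA
  have hJ : IsOpen (Ioo (-ε) ε) := isOpen_Ioo
  have hsub : Ioo (-ε) ε ⊆ Ioo (-δ) δ := Ioo_subset_Ioo (neg_le_neg hεδ) hεδ
  have hfε : ContDiffOn ℝ k f (Ioo (-ε) ε) := hf.1.mono hsub
  refine ⟨ε, hε, hεδ, fun t ht => ?_⟩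
  have heq := fun t ht => (hh t ht).2.2.2
  have hpc : ∀ s ∈ Ioo (-ε) ε, ∀ σ (x : I), (x : ℝ) ∈ piece σ → (h s x : ℝ) ∈ piece σ :=
    fun s hs σ x hx => by rw [(hh s hs).1]; exact (hh s hs).2.2.1 σ x hx
  have hHc : ∀ s ∈ Ioo (-ε) ε, h s c = c := fun s hs =>
    coe_eq_zero.1 (le_antisymm (hpc s hs true c (c_mem_piece _)).2
      (hpc s hs false c (c_mem_piece _)).1)
  -- The equation for `H` uses the branch of `x`, while `slope` uses the branch of `h t x`; the two
  -- have to agree.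
  have hside : ∀ x, side (h t x) = side x := fun x => by
    by_cases hx : x = c
    · rw [hx, hHc t ht]
    · have h1 : (h t x : ℝ) ≠ 0 := fun h0 =>
        hx ((h t).injective ((coe_eq_zero.1 h0).trans (hHc t ht).symm))
      have h2 := hpc t ht _ x (mem_piece_side x)
      have h3 := mem_piece_side (h t x)
      revert h2 h3
      cases side x <;> cases side (h t x) <;> intro h2 h3
      · rfl
      · exact absurd (le_antisymm h3.2 h2.1) h1
      · exact absurd (le_antisymm h2.2 h3.1) h1
      · rfl
  refine (J_eq_zero_iff hk (hf.2 t (hsub ht)) (deriv f t : PC k)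
    (fun y => deriv H t ((h t).symm y)) (A := ‖deriv H t‖) (B := ‖deriv f t‖)
    (fun y => abs_apply_le _ _) (abs_apply_le_norm _) fun y => ?_).2 ?_
  · obtain ⟨x, rfl⟩ := (h t).surjective y
    rw [← (hh t ht).2.1 x, (h t).symm_apply_apply, (h t).symm_apply_apply,
      deriv_shadow_eq hk hJ hfε hH heq ht x, slope, hside x, ← (hh t ht).1 x,
      branch_zero (h t x) (hpc t ht _ x (mem_piece_side x))]
  · have h1 : (h t).symm c = c := (h t).symm_apply_eq.2 (hHc t ht).symm
    change deriv H t ((h t).symm c) = 0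
    rw [h1]
    have h2 : (fun s => H s c) =ᶠ[𝓝 t] fun _ => (0 : ℝ) := by
      filter_upwards [hJ.mem_nhds ht] with s hs
      rw [← (hh s hs).1, hHc s hs]; rfl
    have h3 := hasDerivAt_shadow hk hJ hH ht c
    exact (h3.congr_of_eventuallyEq h2.symm).unique (hasDerivAt_const t 0)

end Conclusions

end PEU

end

noncomputable section

namespace PEU

open Filter Topology

/-! ### Curves along the velocity field and their uniqueness. -/

section InvariantCurves

variable {k : ℕ}

/-- The curves in `I` over the time interval `J` that solve `x' = α_t(x)`. -/
def IsSolution (J : Set ℝ) (α : ℝ → I → ℝ) (x : ℝ → I) : Prop :=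
  ∀ t ∈ J, HasDerivAt (fun s => (x s : ℝ)) (α t (x t)) t

/-- The points reached at time `t` by solutions that start from `p` at time `s`. -/
def reach (J : Set ℝ) (α : ℝ → I → ℝ) (s t : ℝ) (p : I) : Set I :=
  {q | ∃ x, IsSolution J α x ∧ x s = p ∧ x t = q}

variable {J : Set ℝ} {α : ℝ → I → ℝ} {f : ℝ → PC k} {K : ℝ}

theorem isSolution_c (hαc : ∀ t ∈ J, α t c = 0) : IsSolution J α fun _ => c := fun t ht => by
  rw [hαc t ht]
  exact hasDerivAt_const t _

theorem isClosed_piece (σ : Bool) : IsClosed (piece σ) := by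
  cases σ <;> exact isClosed_Icc

/-- The chain rule on each piece turns the twisted equation into the statement. When the curve is at
`c`, its velocity is `α t c = 0`, so the jump of the slope is invisible and the derivatives along
both pieces agree. -/
theorem isSolution_selfMap (hk : 1 ≤ k) (hJ : IsOpen J) (hf : ContDiffOn ℝ 1 f J)
    (hU : ∀ t ∈ J, f t ∈ U k)
    (hα : ∀ t ∈ J, ∀ x, α t (selfMap (f t) x) = (deriv f t : PC k) x + slope (f t) x * α t x)
    (hαc : ∀ t ∈ J, α t c = 0) {x : ℝ → I} (hx : IsSolution J α x) :
    IsSolution J α fun t => selfMap (f t) (x t) := by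
  intro t ht
  have hxt := hx t ht
  have hev : (fun s => (selfMap (f s) (x s) : ℝ)) =ᶠ[𝓝 t] fun s => f s (x s) := by
    filter_upwards [hJ.mem_nhds ht] with s hs
    exact selfMap_coe hk (hU s hs) (x s)
  refine HasDerivAt.congr_of_eventuallyEq ?_ hev
  have hσ : ∀ σ, HasDerivWithinAt (fun s => f s (x s)) (α t (selfMap (f t) (x t)))
      {s | (x s : ℝ) ∈ piece σ} t := by
    intro σ
    by_cases hmem : (x t : ℝ) ∈ piece σ
    · have h1 := hasDerivWithinAt_branch_comp σ hJ hf (i := 0) (by omega) ht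
        (hxt.hasDerivWithinAt (s := {s | (x s : ℝ) ∈ piece σ}))
      have h2 : branch k σ 0 (x t) (deriv f t) + branch k σ 1 (x t) (f t) * α t (x t) =
          α t (selfMap (f t) (x t)) := by
        rw [hα t ht, branch_zero _ hmem]
        congr 1
        by_cases hc : x t = c
        · rw [hc, hαc t ht, mul_zero, mul_zero]
        · have hs : side (x t) = σ := by
            have h3 := mem_piece_side (x t)
            have h4 : (x t : ℝ) ≠ 0 := fun h0 => hc (coe_eq_zero.1 h0)
            revert hmem h3
            cases σ <;> cases side (x t) <;> intro h2 h3
            · rfl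
            · exact absurd (le_antisymm h3.2 h2.1) h4
            · exact absurd (le_antisymm h2.2 h3.1) h4
            · rfl
          rw [slope, hs]
      rw [zero_add, h2] at h1
      exact h1.congr (fun s hs => (branch_zero (x s) hs (f s)).symm)
        (branch_zero (x t) hmem (f t)).symm
    -- If `x t` is off the closed piece then so is `x s` for `s` near `t`, and nothing has to be
    -- shown.
    · refine HasFDerivWithinAt.of_notMem_closure fun hcl => ?_
      rw [mem_closure_iff_frequently] at hcl
      exact hcl (hxt.continuousAt.preimage_mem_nhds ((isClosed_piece σ).isOpen_compl.mem_nhds hmem))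
  have hu := (hσ true).union (hσ false)
  have huniv : {s | (x s : ℝ) ∈ piece true} ∪ {s | (x s : ℝ) ∈ piece false} = univ := by
    refine eq_univ_of_forall fun s => ?_
    obtain ⟨σ, hσ⟩ := exists_mem_piece (x s)
    cases σ
    · exact Or.inr hσ
    · exact Or.inl hσ
  rwa [huniv, hasDerivWithinAt_univ] at hu

theorem isSolution_concat {x y : ℝ → I} (hx : IsSolution J α x) (hy : IsSolution J α y) {r : ℝ}
    (hr : x r = y r) : IsSolution J α fun t => if t ≤ r then x t else y t := by
  intro t ht
  beta_reduce
  rcases lt_trichotomy t r with h | h | h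
  · rw [if_pos h.le]
    refine (hx t ht).congr_of_eventuallyEq ?_
    filter_upwards [gt_mem_nhds h] with s hs
    rw [if_pos hs.le]
  · subst h
    rw [if_pos le_rfl]
    have h1 : HasDerivWithinAt (fun s => ((if s ≤ t then x s else y s : I) : ℝ)) (α t (x t))
        (Iic t) t :=
      (hx t ht).hasDerivWithinAt.congr (fun s hs => by rw [if_pos (mem_Iic.1 hs)]) (by rw [if_pos le_rfl])
    have h2 : HasDerivWithinAt (fun s => ((if s ≤ t then x s else y s : I) : ℝ)) (α t (x t))
        (Ici t) t := by
      have := (hy t ht).hasDerivWithinAt (s := Ici t)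
      rw [← hr] at this
      refine this.congr (fun s hs => ?_) (by rw [if_pos le_rfl, hr])
      rcases eq_or_lt_of_le (show t ≤ s from hs) with h | h
      · rw [← h, if_pos le_rfl, hr]
      · rw [if_neg (not_le.2 h)]
    have := h1.union h2
    rwa [Iic_union_Ici, hasDerivWithinAt_univ] at this
  · rw [if_neg (not_le.2 h)]
    refine (hy t ht).congr_of_eventuallyEq ?_
    filter_upwards [lt_mem_nhds h] with s hs
    rw [if_neg (not_le.2 hs)]

theorem abs_sub_le_of_mem_reach (hJ : Convex ℝ J) (hK : ∀ t ∈ J, ∀ x, |α t x| ≤ K) {s t : ℝ}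
    (hs : s ∈ J) (ht : t ∈ J) {p q : I} (hq : q ∈ reach J α s t p) :
    |(q : ℝ) - p| ≤ K * |t - s| := by
  obtain ⟨x, hx, rfl, rfl⟩ := hq
  exact hJ.norm_image_sub_le_of_norm_hasDerivWithin_le (f := fun s => (x s : ℝ))
    (fun w hw => (hx w hw).hasDerivWithinAt) (fun w hw => hK w hw _) hs ht

/-- The constant curve at `c` is a solution, so one may switch to it at the crossing time and stay
there. -/
theorem c_mem_reach_of_crossing (hαc : ∀ t ∈ J, α t c = 0) {y : ℝ → I} (hy : IsSolution J α y)
    {r s t : ℝ} (hr : r ∈ uIcc s t) (hyr : y r = c) : c ∈ reach J α s t (y s) := by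
  rcases le_total s t with hst | hst
  · rw [uIcc_of_le hst] at hr
    refine ⟨_, isSolution_concat hy (isSolution_c hαc) hyr, if_pos hr.1, ?_⟩
    split_ifs with h
    · rw [le_antisymm h hr.2, hyr]
    · rfl
  · rw [uIcc_of_ge hst] at hr
    refine ⟨_, isSolution_concat (isSolution_c hαc) hy hyr.symm, ?_, if_pos hr.1⟩
    split_ifs with h
    · rw [le_antisymm h hr.2, hyr]
    · rfl

/-- Whichever side of `c` the point `p` is on, the solution to `a` or the one to `b` must cross `c`.
-/
theorem c_mem_reach (hJ : J.OrdConnected) (hαc : ∀ t ∈ J, α t c = 0) {s t : ℝ} (hs : s ∈ J)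
    (ht : t ∈ J) {p a b : I} (ha : a ∈ reach J α s t p) (hb : b ∈ reach J α s t p) (hac : a ≤ c)
    (hcb : c ≤ b) : c ∈ reach J α s t p := by
  have hcont : ∀ x, IsSolution J α x → ContinuousOn (fun w => (x w : ℝ)) (uIcc s t) :=
    fun x hx w hw => (hx w (hJ.uIcc_subset hs ht hw)).continuousAt.continuousWithinAt
  obtain ⟨x, hx, hxs, hxt⟩ := ha
  obtain ⟨y, hy, hys, hyt⟩ := hb
  have key : ∀ z, IsSolution J α z → z s = p → (c : ℝ) ∈ uIcc (z s : ℝ) (z t) →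
      c ∈ reach J α s t p := fun z hz hzs hmem => by
    obtain ⟨r, hr, hrc⟩ := intermediate_value_uIcc (hcont z hz) hmem
    rw [← hzs]
    exact c_mem_reach_of_crossing hαc hz hr (Subtype.ext hrc)
  rcases le_total p c with hp | hp
  · exact key y hy hys (mem_uIcc.2 (Or.inl ⟨by rw [hys]; exact hp, by rw [hyt]; exact hcb⟩))
  · exact key x hx hxs (mem_uIcc.2 (Or.inr ⟨by rw [hxt]; exact hac, by rw [hxs]; exact hp⟩))

theorem selfMap_mem_uIcc (hk : 1 ≤ k) {g : PC k} (hg : g ∈ U k) {σ : Bool} {u v x : I}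
    (hu : (u : ℝ) ∈ piece σ) (hv : (v : ℝ) ∈ piece σ) (hx : x ∈ Icc u v) :
    selfMap g x ∈ uIcc (selfMap g u) (selfMap g v) := by
  obtain ⟨a, ha, h⟩ := exists_expandsBy hk hg
  have hxp : (x : ℝ) ∈ piece σ := (ordConnected_piece σ).out hu hv ⟨hx.1, hx.2⟩
  have h1 := h.le_orient_mul_sub hk hu hxp hx.1
  have h2 := h.le_orient_mul_sub hk hxp hv hx.2
  have h3 : 0 ≤ a * ((x : ℝ) - u) := mul_nonneg (by linarith) (sub_nonneg.2 hx.1)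
  have h4 : 0 ≤ a * ((v : ℝ) - x) := mul_nonneg (by linarith) (sub_nonneg.2 hx.2)
  rw [← selfMap_coe hk hg, ← selfMap_coe hk hg] at h1 h2
  rw [mem_uIcc]
  cases σ
  · right
    simp only [orient, Bool.false_eq_true, if_false] at h1 h2
    constructor <;> change (_ : ℝ) ≤ _ <;> linarith
  · left
    simp only [orient, if_true] at h1 h2
    constructor <;> change (_ : ℝ) ≤ _ <;> linarith

theorem uIcc_subset_of_mem_reach {s t : ℝ} {p u v : I} (hu : u ∈ reach J α s t p)
    (hv : v ∈ reach J α s t p) :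
    ∃ a ∈ reach J α s t p, ∃ b ∈ reach J α s t p, uIcc u v ⊆ Icc a b := by
  rcases le_total u v with h | h
  · exact ⟨u, hu, v, hv, (uIcc_of_le h).subset⟩
  · exact ⟨v, hv, u, hu, (uIcc_of_ge h).subset⟩

/-- The maps send solutions to solutions, so images of reached points are reached from the image of
`p`. If `[a, b]` contains the turning point in its interior, then `c` is itself reached, and its
image is the maximum of the map. -/
theorem exists_image_selfMap_subset (hk : 1 ≤ k) (hJo : IsOpen J) (hJ : J.OrdConnected)
    (hf : ContDiffOn ℝ 1 f J) (hU : ∀ t ∈ J, f t ∈ U k)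
    (hα : ∀ t ∈ J, ∀ x, α t (selfMap (f t) x) = (deriv f t : PC k) x + slope (f t) x * α t x)
    (hαc : ∀ t ∈ J, α t c = 0) {s t : ℝ} (hs : s ∈ J) (ht : t ∈ J) {p a b : I}
    (ha : a ∈ reach J α s t p) (hb : b ∈ reach J α s t p) :
    ∃ a' ∈ reach J α s t (selfMap (f s) p), ∃ b' ∈ reach J α s t (selfMap (f s) p),
      selfMap (f t) '' Icc a b ⊆ Icc a' b' := by
  have hT : ∀ q ∈ reach J α s t p, selfMap (f t) q ∈ reach J α s t (selfMap (f s) p) := by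
    rintro _ ⟨x, hx, rfl, rfl⟩
    exact ⟨_, isSolution_selfMap hk hJo hf hU hα hαc hx, rfl, rfl⟩
  rcases mem_piece_or_straddle a b with ⟨σ, h1, h2⟩ | ⟨h1, h2⟩ | ⟨h1, h2⟩
  · obtain ⟨a', ha', b', hb', hsub⟩ := uIcc_subset_of_mem_reach (hT a ha) (hT b hb)
    refine ⟨a', ha', b', hb', ?_⟩
    rintro _ ⟨x, hx, rfl⟩
    exact hsub (selfMap_mem_uIcc hk (hU t ht) h1 h2 hx)
  · have hc := c_mem_reach hJ hαc hs ht ha hb h1.le h2.le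
    have hmax := selfMap_le_selfMap_c hk (hU t ht)
    have hmin : min (selfMap (f t) a) (selfMap (f t) b) ∈ reach J α s t (selfMap (f s) p) := by
      rcases min_choice (selfMap (f t) a) (selfMap (f t) b) with h | h <;> rw [h]
      · exact hT a ha
      · exact hT b hb
    refine ⟨_, hmin, _, hT c hc, ?_⟩
    rintro _ ⟨x, hx, rfl⟩
    refine ⟨?_, hmax x⟩
    rcases le_total x c with hxc | hxc
    · have := selfMap_mem_uIcc hk (hU t ht) (σ := true) (u := a) (v := c) ⟨a.2.1, h1.le⟩
        (c_mem_piece _) ⟨hx.1, hxc⟩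
      rw [uIcc_of_le (hmax a)] at this
      exact (min_le_left _ _).trans this.1
    · have := selfMap_mem_uIcc hk (hU t ht) (σ := false) (u := c) (v := b) (c_mem_piece _)
        ⟨h2.le, b.2.2⟩ ⟨hxc, hx.2⟩
      rw [uIcc_of_ge (hmax b)] at this
      exact (min_le_right _ _).trans this.1
  · refine ⟨_, hT a ha, _, hT b hb, ?_⟩
    rintro _ ⟨x, hx, rfl⟩
    have h3 : (a : ℝ) ≤ b := hx.1.trans hx.2
    linarith

/-- Expansivity at a scale larger than the distance solutions can travel makes solutions unique. -/
theorem reach_subsingleton (hk : 1 ≤ k) (hJo : IsOpen J) (hJ : J.OrdConnected)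
    (hf : ContDiffOn ℝ 1 f J) (hU : ∀ t ∈ J, f t ∈ U k)
    (hα : ∀ t ∈ J, ∀ x, α t (selfMap (f t) x) = (deriv f t : PC k) x + slope (f t) x * α t x)
    (hαc : ∀ t ∈ J, α t c = 0) (hK : ∀ t ∈ J, ∀ x, |α t x| ≤ K) {ε : ℝ}
    (hexp : ∀ t ∈ J, Expansive ε (selfMap (f t))) {s t : ℝ} (hs : s ∈ J) (ht : t ∈ J)
    (hst : 2 * K * |t - s| ≤ ε) (p : I) : (reach J α s t p).Subsingleton := by
  have hiter : ∀ (n : ℕ) (p a b : I), a ∈ reach J α s t p → b ∈ reach J α s t p →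
      ∃ p' : I, ∃ a' ∈ reach J α s t p', ∃ b' ∈ reach J α s t p',
        (selfMap (f t))^[n] '' Icc a b ⊆ Icc a' b' := by
    intro n
    induction n with
    | zero => intro p a b ha hb; exact ⟨p, a, ha, b, hb, by simp⟩
    | succ n ih =>
      intro p a b ha hb
      obtain ⟨a', ha', b', hb', h1⟩ :=
        exists_image_selfMap_subset hk hJo hJ hf hU hα hαc hs ht ha hb
      obtain ⟨p'', a'', ha'', b'', hb'', h2⟩ := ih _ a' b' ha' hb'
      refine ⟨p'', a'', ha'', b'', hb'', ?_⟩
      rw [Function.iterate_succ, image_comp]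
      exact (image_mono h1).trans h2
  have key : ∀ a ∈ reach J α s t p, ∀ b ∈ reach J α s t p, ¬ a < b := by
    intro a ha b hb hab
    obtain ⟨i, -, hi⟩ := hexp t ht (Icc a b) ordConnected_Icc
      ⟨a, left_mem_Icc.2 hab.le, b, right_mem_Icc.2 hab.le, hab.ne⟩
    obtain ⟨p', a', ha', b', hb', hsub⟩ := hiter i p a b ha hb
    have h1 := abs_le.1 (abs_sub_le_of_mem_reach hJ.convex hK hs ht ha')
    have h2 := abs_le.1 (abs_sub_le_of_mem_reach hJ.convex hK hs ht hb')
    have hK0 : 0 ≤ K := (abs_nonneg _).trans (hK s hs c)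
    have h3 : Metric.diam ((selfMap (f t))^[i] '' Icc a b) ≤ 2 * K * |t - s| := by
      refine Metric.diam_le_of_forall_dist_le (by positivity) fun x hx y hy => ?_
      have hx1 : (a' : ℝ) ≤ x := (hsub hx).1
      have hx2 : (x : ℝ) ≤ b' := (hsub hx).2
      have hy1 : (a' : ℝ) ≤ y := (hsub hy).1
      have hy2 : (y : ℝ) ≤ b' := (hsub hy).2
      rw [Subtype.dist_eq, Real.dist_eq, abs_le]
      constructor <;> linarith
    linarith
  intro a ha b hb
  exact le_antisymm (not_lt.1 (key b hb a ha)) (not_lt.1 (key a ha b hb))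

end InvariantCurves

/-! ### From the vanishing of `J` to constant critical relations. -/

section Converse

variable {k : ℕ} {δ : ℝ} {f : ℝ → PC k}

theorem norm_toC1_sub_le (hk : 1 ≤ k) (f g : PC k) :
    ‖PC.toC1 hk f - PC.toC1 hk g‖ ≤ ‖f - g‖ := by
  refine (PC.norm_le_iff _ (norm_nonneg _)).2 fun i hi => ?_
  have := (PC.norm_le_iff (f - g) (norm_nonneg _)).1 le_rfl i (hi.trans hk)
  exact this

/-- All curves `t ↦ f_t^n(c)` are solutions for one uniformly bounded field. A critical relation at
time `s` means that two of them meet there, and uniqueness makes them meet at every `t` of the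
interval. -/
theorem condA_of_condD (hk : 1 ≤ k) (hf : IsFamily k δ f) {e : ℝ} (he : 0 < e)
    (hst : StablyExpansive e (PC.toC1 hk (f 0))) (hD : CondD δ f) : CondA δ f := by
  obtain ⟨ε₁, hε₁, hε₁δ, hJ0⟩ := hD
  obtain ⟨η, hη, hexpansive⟩ := hst
  have hδ : 0 < δ := hε₁.trans_le hε₁δ
  have h0 : (0 : ℝ) ∈ Ioo (-δ) δ := ⟨by linarith, hδ⟩
  obtain ⟨a, ha, hexp⟩ := exists_expandsBy hk (hf.2 0 h0)
  obtain ⟨b, hb1, hba⟩ := exists_between ha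
  have hf1 : ContDiffOn ℝ (1 : ℕ) f (Ioo (-δ) δ) := hf.1.of_le (by exact_mod_cast hk)
  obtain ⟨V, hV⟩ := exists_norm_iteratedDeriv_le hf1 (half_lt_self hδ)
  have e1 : ∀ᶠ t in 𝓝 (0 : ℝ), ‖f t - f 0‖ < min η (a - b) := by
    have := (hf1.continuousOn.continuousAt (isOpen_Ioo.mem_nhds h0)).eventually
      (Metric.ball_mem_nhds _ (lt_min hη (sub_pos.2 hba)))
    filter_upwards [this] with t ht
    rwa [← dist_eq_norm]
  obtain ⟨ε₂, hε₂, hball⟩ := Metric.eventually_nhds_iff_ball.1 e1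
  rw [Real.ball_zero_eq_Ioo] at hball
  have hV0 : 0 ≤ V := (norm_nonneg _).trans (hV 0 zero_le_one 0 ⟨by linarith, by linarith⟩)
  -- The bound from `exists_twist_solution`, valid for all small `t` since `b` bounds the expansion
  -- and `V` the time derivative.
  set K := V / (b - 1) with hKdef
  have hK0 : 0 ≤ K := div_nonneg hV0 (by linarith)
  -- Times in the interval differ by at most `2 * ε`, so the last term ensures `2 * K * |t - s| ≤
  -- e`; the `+ 1` avoids division by zero.
  let ε := min (min ε₁ ε₂) (min (δ / 2) (e / (4 * (K + 1))))
  have hε : 0 < ε := lt_min (lt_min hε₁ hε₂) (lt_min (by linarith) (by positivity))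
  have hsub : ∀ {r : ℝ}, ε ≤ r → Ioo (-ε) ε ⊆ Ioo (-r) r := fun h =>
    Ioo_subset_Ioo (neg_le_neg h) h
  have i1 : ε ≤ ε₁ := (min_le_left _ _).trans (min_le_left _ _)
  have i2 : ε ≤ ε₂ := (min_le_left _ _).trans (min_le_right _ _)
  have i3 : ε ≤ δ / 2 := (min_le_right _ _).trans (min_le_left _ _)
  have i4 : ε ≤ e / (4 * (K + 1)) := (min_le_right _ _).trans (min_le_right _ _)
  have hU : ∀ t ∈ Ioo (-ε) ε, f t ∈ U k := fun t ht => hf.2 t (hsub (i1.trans hε₁δ) ht)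
  have hexists : ∀ t, ∃ α : I → ℝ, t ∈ Ioo (-ε) ε → (∀ x, |α x| ≤ K) ∧
      (∀ x, α (selfMap (f t) x) = (deriv f t : PC k) x + slope (f t) x * α x) ∧ α c = 0 := by
    intro t
    by_cases ht : t ∈ Ioo (-ε) ε
    · have hexpt : ExpandsBy b (f t) := by
        have := hexp.mono_of_norm_sub_le hk (g := f t) (r := a - b)
          ((hball t (hsub i2 ht)).le.trans (min_le_right _ _))
        rwa [sub_sub_cancel] at this
      have hder : ∀ x, |(deriv f t : PC k) x| ≤ V := fun x => by
        have := hV 1 le_rfl t (hsub i3 ht)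
        rw [iteratedDeriv_one] at this
        exact (abs_apply_le_norm _ x).trans this
      obtain ⟨α, hα1, hα2⟩ := exists_twist_solution (X := DiscreteI) (selfMap (f t))
        (slope (f t)) (deriv f t : PC k) (b := ‖f t‖) hb1
        (fun x => hexpt.le_abs (mem_piece_side x))
        (fun x => abs_branch_le hk (mem_piece_side x) (f t)) hder
      exact ⟨α, fun _ => ⟨hα1, hα2, (J_eq_zero_iff hk (hU t ht) _ α hα1 hder hα2).1
        (hJ0 t (hsub i1 ht))⟩⟩
    · exact ⟨0, fun h => absurd h ht⟩
  choose α hα using hexists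
  have hfε : ContDiffOn ℝ 1 f (Ioo (-ε) ε) := by
    have := hf1.mono (hsub (i1.trans hε₁δ))
    exact_mod_cast this
  have hexpε : ∀ t ∈ Ioo (-ε) ε, Expansive e (selfMap (f t)) := fun t ht => by
    refine hexpansive (PC.toC1 hk (f t)) (hU t ht) ?_
    exact (norm_toC1_sub_le hk _ _).trans_lt
      ((hball t (hsub i2 ht)).trans_le (min_le_left _ _))
  have hsmall : ∀ s ∈ Ioo (-ε) ε, ∀ t ∈ Ioo (-ε) ε, 2 * K * |t - s| ≤ e := by
    intro s hs t ht
    have h1 : |t - s| ≤ 2 * ε := abs_le.2 ⟨by linarith [hs.2, ht.1], by linarith [hs.1, ht.2]⟩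
    rw [le_div_iff₀ (by positivity)] at i4
    nlinarith
  have hsol : ∀ n : ℕ, IsSolution (Ioo (-ε) ε) α fun t => (selfMap (f t))^[n] c := by
    intro n
    induction n with
    | zero => exact isSolution_c fun t ht => (hα t ht).2.2
    | succ n ih =>
      simp_rw [Function.iterate_succ_apply']
      exact isSolution_selfMap hk isOpen_Ioo hfε hU (fun t ht => (hα t ht).2.1)
        (fun t ht => (hα t ht).2.2) ih
  have hrel : ∀ s ∈ Ioo (-ε) ε, ∀ t ∈ Ioo (-ε) ε,
      criticalRelations (f s) ⊆ criticalRelations (f t) := by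
    rintro s hs t ht ⟨i, j⟩ ⟨hij, hlt⟩
    refine ⟨?_, hlt⟩
    exact reach_subsingleton hk isOpen_Ioo ordConnected_Ioo hfε hU (fun t ht => (hα t ht).2.1)
      (fun t ht => (hα t ht).2.2) (fun t ht => (hα t ht).1) hexpε hs ht (hsmall s hs t ht) _
      ⟨_, hsol i, rfl, rfl⟩ ⟨_, hsol j, hij.symm, rfl⟩
  have h0ε : (0 : ℝ) ∈ Ioo (-ε) ε := ⟨by linarith, hε⟩
  exact ⟨ε, hε, i1.trans hε₁δ, fun t ht =>
    (hrel t ht 0 h0ε).antisymm (hrel 0 h0ε t ht)⟩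

end Converse

end PEU

end

theorem theorem1 (k : ℕ) (hk : 1 ≤ k) :
    ∃ C : ℝ, ∀ (δ : ℝ), 0 < δ → ∀ f : ℝ → PEU.PC k, PEU.IsFamily k δ f →
      ((PEU.CondA δ f ↔ PEU.CondB δ f) ∧
        (PEU.CondB δ f ↔ PEU.CondC δ f C) ∧
        (PEU.CondA δ f → PEU.CondD δ f) ∧
        ∀ ε : ℝ, 0 < ε → PEU.StablyExpansive ε (PEU.PC.toC1 hk (f 0)) →
          (PEU.CondD δ f ↔ PEU.CondA δ f)) :=
  ⟨PEU.diamConst k, fun _ _ _ hf =>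
    ⟨⟨fun hA => PEU.condB_of_condC (PEU.condC_of_condA hk hf hA), PEU.condA_of_condB hk hf⟩,
      ⟨fun hB => PEU.condC_of_condA hk hf (PEU.condA_of_condB hk hf hB), PEU.condB_of_condC⟩,
      PEU.condD_of_condA hk hf,
      fun _ hε hst => ⟨PEU.condA_of_condD hk hf hε hst, PEU.condD_of_condA hk hf⟩⟩⟩
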